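/- Let $c\ge 0$. Let $S^4\subset\mathbb R^5=P\oplus P^\perp$ be the unit sphere, $P=\mathbb R^3$, $P^\perp=\mathbb R^2$, with volume form $\partial_r\lrcorner\mathrm{vol}_{\mathbb R^5}$. Let $M=\Lambda^2_-(T^*S^4)$ if $c>0$, and let $M$ be the complement of the zero section in $\Lambda^2_-(T^*S^4)$ if $c=0$. For an oriented orthonormal coframe $b_0,\dots,b_3$ of $S^4$ put $\Omega_i=b_0\wedge b_i-b_j\wedge b_k$ ($(i,j,k)$ cyclic in $(1,2,3)$), let $a_1,a_2,a_3$ be the fibre coordinates with respect to $\Omega_1,\Omega_2,\Omega_3$, let $r^2=a_1^2+a_2^2+a_3^2$, and let $\zeta_1,\zeta_2,\zeta_3$ be the vertical $1$-forms of the connection induced by the Levi-Civita connection. The Bryant–Salamon metric and $3$-form on $M$ are $$g_c=(c+r^2)^{-1/2}\sum_i\zeta_i^2+2(c+r^2)^{1/2}g_{S^4},\qquad \varphi_c=(c+r^2)^{-3/4}\zeta_1\wedge\zeta_2\wedge\zeta_3+2(c+r^2)^{1/4}\sum_i\zeta_i\wedge\Omega_i .$$ Write a point of $S^4$ as $(\cos\alpha\,\mathbf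 u,\sin\alpha\,(\cos\beta,\sin\beta))$ with $\alpha\in[0,\frac\pi2]$ and $|\mathbf u|=1$, take $b_0=\mathrm d\alpha$, $b_1=\sin\alpha\,\mathrm d\beta$, and put $t=a_1$. The coassociative fibration is $\pi_c:M\to\mathbb R^3$, $\pi_c=(u,v\cos\beta,v\sin\beta)$, with $u=t\cos\alpha$ and $v=2(c+r^2)^{1/4}\sin\alpha$, extended smoothly to all of $M$. Let $S^1_c=\{u=0,\ v=2c^{1/4}\}\subset\mathbb R^3$ (a circle if $c>0$, the origin if $c=0$). The group $SO(3)$ acts on $M$ through its action on $P$. The bolt over $x\in\mathbb R^3$ is the union of the two-dimensional $SO(3)$-orbits in $\pi_c^{-1}(x)$, and $B$ is the union of all bolts. Then there are no bolts over $S^1_c$, and $B$ is a smooth $SO(3)$-equivariant $S^2$-bundle over $\mathbb R^3\setminus S^1_c$. It is trivial over each of the open sets $\{u\ne0\text{ or }v<2c^{1/4}\}$ and $\{u\neq 0\text{ or }v>2c^{1/4}\}$, which cover $\mathbb R^3\setminus S^1_c$; the second one is all of $\mathbb R^3\setminus\{0\}$ if $c=0$. Moreover: 1. There is a smooth Riemannian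 metric $k_c$ on $\mathbb R^3\setminus S^1_c$ which is the pushforward of $g_c|_B$, i.e. the metric for which $B\to\mathbb R^3\setminus S^1_c$ is a Riemannian submersion. 2. Over any open set $W\subset\mathbb R^3\setminus S^1_c$ over which the bolts are consistently oriented by an $SO(3)$-equivariant trivialization $W\times S^2\to B|_W$, let $\lambda_c$ be the pushforward of $\varphi_c|_B$, i.e. its integral along the bolts. At each point of $\mathbb R^3\setminus S^1_c$ it is determined by $c$ up to the sign coming from the orientation of the bolt. Then $\lambda_c$ is a smooth harmonic $1$-form on $W$, that is $\mathrm d\lambda_c=\mathrm d{*_{k_c}}\lambda_c=0$; it is invariant under the $S^1$-action of rotations in $\beta$ whenever $W$ is; and $$|\lambda_c|_{k_c}=4\pi a_c=\text{the }g_c\text{-area of the bolt},\qquad a_c=\frac{2c\cos^2\alpha+r^2(1+\cos^2\alpha)}{(c+r^2)^{1/2}},$$ where $\alpha$ and $r$ are evaluated on the bolt, and $r^2=t^2$ on the bolts with $\alpha<\frac\pi2$. 3. The form $\lambda_c$ vanishes nowhere on $\mathbb R^3\setminus S^1_c$ and extends continuously by zero to $S^1_c$. So it vanishes precisely on the circle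 $S^1_c$ if $c>0$, and only at the origin if $c=0$. 4. The metric $k_0$ is a Riemannian cone: $(\mathbb R^3\setminus\{0\},k_0)$ is isometric to $\mathbb R^+\times S^2$ with the metric $\mathrm d\varrho^2+\frac12\varrho^2g_{S^2}$, where $g_{S^2}$ is the round metric of the unit sphere. If $c>0$, then $k_c$ is asymptotically conical with rate $-2$ and with this asymptotic cone: for some $R>0$ and some compact $K\supset S^1_c$ there is a diffeomorphism $\Psi:(R,\infty)\times S^2\to\mathbb R^3\setminus K$ with $|\nabla^j(\Psi^*k_c-g_{\mathrm{cone}})|=O(\varrho^{-2-j})$ as $\varrho\to\infty$ for all $j\ge0$, where $g_{\mathrm{cone}}=\mathrm d\varrho^2+\frac12\varrho^2g_{S^2}$ and where norm and $\nabla$ are those of $g_{\mathrm{cone}}$. -/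

import Mathlib

open Set MeasureTheory
open scoped Matrix ContDiff

attribute [local instance] Matrix.normedAddCommGroup Matrix.normedSpace

/-! ### The Bryant–Salamon structure on the anti-self-dual forms of the unit 4-sphere -/

/-- Euclidean 3-space, with coordinates `(u, v cos β, v sin β)` when used as base. -/
abbrev E3 := EuclideanSpace ℝ (Fin 3)

/-- Pairs `(p, ω)` of a vector of `ℝ⁵ = P ⊕ P^⊥` (`P` is spanned by the first three coordinates)
and a bilinear form on `ℝ⁵`, given by its matrix of components. -/
abbrev Ambient := (Fin 5 → ℝ) × Matrix (Fin 5) (Fin 5) ℝ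

/-- The Hodge star of the oriented Euclidean space `p^⊥ = T_p S⁴` (volume form `p ⌟ vol_{ℝ⁵}`)
on 2-forms: `(*ω)_{ij} = ½ ∑_{k,l} det(p, e_i, e_j, e_k, e_l) ω_{kl}`. -/
noncomputable def starS4 (p : Fin 5 → ℝ) (om : Matrix (Fin 5) (Fin 5) ℝ) :
    Matrix (Fin 5) (Fin 5) ℝ :=
  Matrix.of fun i j => (1 / 2) * ∑ k, ∑ l,
    (Matrix.of ![p, Pi.single i 1, Pi.single j 1, Pi.single k 1, Pi.single l 1]).det * om k l

/-- The squared fibre radius `r² = a₁² + a₂² + a₃²` of `ω = ∑ aᵢ Ωᵢ`; the standard anti-self-dual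
basis `Ω₁, Ω₂, Ω₃` consists of orthogonal matrices with `tr(Ωᵢᵀ Ωᵢ) = 4`. -/
noncomputable def radiusSq (m : Ambient) : ℝ := (1 / 4) * (m.2ᵀ * m.2).trace

/-- The total space: `Λ²₋(T*S⁴)` if `c > 0`, and the complement of its zero section if `c = 0`.
A point is `(p, ω)` with `p` in the unit sphere and `ω` an anti-self-dual 2-form on `T_p S⁴`
(extended by zero to the normal direction). -/
def totalSpace (c : ℝ) : Set Ambient :=
  {m | m.1 ⬝ᵥ m.1 = 1 ∧ m.2ᵀ = -m.2 ∧ m.2 *ᵥ m.1 = 0 ∧ starS4 m.1 m.2 = -m.2 ∧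
    0 < c + radiusSq m}

/-- The vertical part of a tangent vector `X = (ṗ, ω̇)` at `m = (p, ω)`, for the connection induced
by the Levi-Civita connection of `S⁴`: the covariant derivative is the orthogonal projection of
the ordinary derivative `ω̇` to forms on `T_p S⁴`. In terms of `Ω₁, Ω₂, Ω₃` it is `∑ ζᵢ(X) Ωᵢ`. -/
noncomputable def vert (m X : Ambient) : Matrix (Fin 5) (Fin 5) ℝ :=
  (1 - Matrix.vecMulVec m.1 m.1) * X.2 * (1 - Matrix.vecMulVec m.1 m.1)

/-- The metric
`g_c = (c + r²)^{-1/2} (ζ₁² + ζ₂² + ζ₃²) + 2 (c + r²)^{1/2} g_{S⁴}`. -/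
noncomputable def bsMetric (c : ℝ) (m X Y : Ambient) : ℝ :=
  (c + radiusSq m) ^ (-(1 / 2) : ℝ) * ((1 / 4) * ((vert m X)ᵀ * vert m Y).trace)
    + 2 * (c + radiusSq m) ^ (1 / 2 : ℝ) * (X.1 ⬝ᵥ Y.1)

/-- The 3-form
`φ_c = (c + r²)^{-3/4} ζ₁∧ζ₂∧ζ₃ + 2 (c + r²)^{1/4} (ζ₁∧Ω₁ + ζ₂∧Ω₂ + ζ₃∧Ω₃)`.
As matrices `Ω₁ Ω₂ = Ω₃` and `Ωᵢ² = -1` on `T_p S⁴`, so that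
`(ζ₁∧ζ₂∧ζ₃)(X, Y, Z) = -¼ tr (ζ(X) ζ(Y) ζ(Z))` with `ζ = ∑ ζᵢ Ωᵢ`. -/
noncomputable def bsForm (c : ℝ) (m X Y Z : Ambient) : ℝ :=
  (c + radiusSq m) ^ (-(3 / 4) : ℝ) * (-(1 / 4) * (vert m X * vert m Y * vert m Z).trace)
    + 2 * (c + radiusSq m) ^ (1 / 4 : ℝ) *
      (Y.1 ⬝ᵥ (vert m X *ᵥ Z.1) + Z.1 ⬝ᵥ (vert m Y *ᵥ X.1) + X.1 ⬝ᵥ (vert m Z *ᵥ Y.1))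

/-! ### The fibration over `ℝ³` and its bolts -/

/-- The coassociative fibration `(p, ω) ↦ (u, v cos β, v sin β)`. Writing
`p = (cos α 𝐮, sin α (cos β, sin β))` and `ω = t Ω₁ + a₂ Ω₂ + a₃ Ω₃`
(`Ω₁ = sin α dα∧dβ - cos²α vol_{S²}`), the component of `ω` on the last two coordinate
vectors is `u = t cos α`, and `v = 2 (c + r²)^{1/4} sin α`. -/
noncomputable def fibration (c : ℝ) (m : Ambient) : E3 :=
  !₂[m.2 3 4, 2 * (c + radiusSq m) ^ (1 / 4 : ℝ) * m.1 3,
    2 * (c + radiusSq m) ^ (1 / 4 : ℝ) * m.1 4]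

/-- A matrix acting on `P = ℝ³`, extended by the identity on `P^⊥ = ℝ²`. -/
def extendP (A : Matrix (Fin 3) (Fin 3) ℝ) : Matrix (Fin 5) (Fin 5) ℝ :=
  !![A 0 0, A 0 1, A 0 2, 0, 0;
     A 1 0, A 1 1, A 1 2, 0, 0;
     A 2 0, A 2 1, A 2 2, 0, 0;
     0, 0, 0, 1, 0;
     0, 0, 0, 0, 1]

/-- The action of `SO(3)` on points and on 2-forms. -/
def rotAct (A : Matrix (Fin 3) (Fin 3) ℝ) (m : Ambient) : Ambient :=
  (extendP A *ᵥ m.1, extendP A * m.2 * (extendP A)ᵀ)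

/-- The infinitesimal rotation `x ↦ e × x` of `P`, extended by zero on `P^⊥`. -/
def crossP (e : Fin 3 → ℝ) : Matrix (Fin 5) (Fin 5) ℝ :=
  !![0, -e 2, e 1, 0, 0;
     e 2, 0, -e 0, 0, 0;
     -e 1, e 0, 0, 0, 0;
     0, 0, 0, 0, 0;
     0, 0, 0, 0, 0]

/-- The vector field of the `SO(3)`-action generated by the infinitesimal rotation about `e`. -/
def rotField (e : Fin 3 → ℝ) (m : Ambient) : Ambient :=
  (crossP e *ᵥ m.1, crossP e * m.2 - m.2 * crossP e)

/-- The bolt in the fibre over `x`: the union of the two-dimensional `SO(3)`-orbits in the fibre,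
i.e. of the points whose isotropy algebra in `so(3)` is neither zero (three-dimensional orbits)
nor everything (fixed points). -/
def bolt (c : ℝ) (x : E3) : Set Ambient :=
  {m ∈ totalSpace c | fibration c m = x ∧
    (∃ e : Fin 3 → ℝ, e ≠ 0 ∧ rotField e m = 0) ∧ ∃ e : Fin 3 → ℝ, rotField e m ≠ 0}

/-- The radial coordinate `v` of the base. -/
noncomputable def radialV (x : E3) : ℝ := Real.sqrt (x 1 ^ 2 + x 2 ^ 2)

/-- The circle `S¹_c = {u = 0, v = 2 c^{1/4}}`; it is the origin if `c = 0`. -/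
def singularCircle (c : ℝ) : Set E3 := {x | x 0 = 0 ∧ radialV x = 2 * c ^ (1 / 4 : ℝ)}

/-- The bolt size at a point of a bolt,
`a_c = (2 c cos²α + r² (1 + cos²α)) / (c + r²)^{1/2}`, where `r² = t²` on the bolts with
`α < π/2`, and where `cos²α` is the squared length of the `P`-component of the base point. -/
noncomputable def boltSize (c : ℝ) (m : Ambient) : ℝ :=
  let cosSq := m.1 0 ^ 2 + m.1 1 ^ 2 + m.1 2 ^ 2
  (2 * c * cosSq + radiusSq m * (1 + cosSq)) / Real.sqrt (c + radiusSq m)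

/-- A smooth `SO(3)`-equivariant trivialization `F : W × S² → B|_W` of the bundle of bolts over an
open set `W`. Maps on `S² = (ℝ³ ∖ 0)/ℝ⁺` are written as maps on `ℝ³ ∖ 0` constant along rays. -/
structure IsBoltTrivialization (c : ℝ) (W : Set E3) (F : E3 → E3 → Ambient) : Prop where
  isOpen : IsOpen W
  smooth : ContDiffOn ℝ ∞ (Function.uncurry F) (W ×ˢ {0}ᶜ)
  ray : ∀ x ∈ W, ∀ n : E3, n ≠ 0 → ∀ r : ℝ, 0 < r → F x (r • n) = F x n
  bijOn : ∀ x ∈ W, BijOn (F x) (Metric.sphere 0 1) (bolt c x)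
  equivariant : ∀ x ∈ W, ∀ A ∈ Matrix.specialOrthogonalGroup (Fin 3) ℝ, ∀ n : E3, n ≠ 0 →
    F x (WithLp.toLp 2 (A *ᵥ n.ofLp)) = rotAct A (F x n)

/-! ### Pushforward along the bolts -/

/-- The standard basis of `ℝ³`. -/
noncomputable def stdVec (i : Fin 3) : E3 := EuclideanSpace.single i 1

/-- The derivative of a trivialization at `(x, n)`. -/
noncomputable def trivDeriv (F : E3 → E3 → Ambient) (x n : E3) : E3 × E3 →L[ℝ] Ambient :=
  fderiv ℝ (Function.uncurry F) (x, n)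

/-- The density at `n ∈ S²`, with respect to the standard area form of `S²`, of the 2-form
`F_x^* (φ_c(ŵ, ·, ·))` where `ŵ = ∂_w F` is the lift of `w` to the bundle of bolts.
A 2-form `τ` on `S²`, extended to be zero on the radial direction, has density
`n₀ τ(e₁, e₂) + n₁ τ(e₂, e₀) + n₂ τ(e₀, e₁)`. -/
noncomputable def pushDensity (c : ℝ) (F : E3 → E3 → Ambient) (x w n : E3) : ℝ :=
  let τ : Fin 3 → Fin 3 → ℝ := fun i j =>
    bsForm c (F x n) (trivDeriv F x n (w, 0))
      (trivDeriv F x n (0, stdVec i)) (trivDeriv F x n (0, stdVec j))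
  n 0 * τ 1 2 + n 1 * τ 2 0 + n 2 * τ 0 1

/-- The pushforward (integration along the bolts, oriented by the trivialization `F`) of the
restriction of `φ_c` to the bundle of bolts: a 1-form on the base. -/
noncomputable def pushforwardForm (c : ℝ) (F : E3 → E3 → Ambient) (x : E3) : E3 →L[ℝ] ℝ :=
  ∑ i : Fin 3, (∫ n : Metric.sphere (0 : E3) 1, pushDensity c F x (stdVec i) n
    ∂(volume : Measure E3).toSphere) • (EuclideanSpace.proj i : E3 →L[ℝ] ℝ)

/-- The values at `x` of the pushforward of `φ_c`, for the possible orientations of the bolts. -/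
def pushforwardValues (c : ℝ) (x : E3) : Set (E3 →L[ℝ] ℝ) :=
  {ℓ | ∃ W F, IsBoltTrivialization c W F ∧ x ∈ W ∧ ℓ = pushforwardForm c F x}

/-- The area of the bolt over `x` for the metric `g_c`. The Gram matrix `G` of the derivative of
`F x` has the radial direction in its kernel, so its determinant on `T_n S²` is the sum of its
principal 2 × 2 minors. -/
noncomputable def boltArea (c : ℝ) (F : E3 → E3 → Ambient) (x : E3) : ℝ :=
  ∫ n : Metric.sphere (0 : E3) 1,
    (let G : Fin 3 → Fin 3 → ℝ := fun i j =>
      bsMetric c (F x n) (trivDeriv F x n (0, stdVec i)) (trivDeriv F x n (0, stdVec j))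
    Real.sqrt ((G 0 0 * G 1 1 - G 0 1 * G 1 0) + (G 1 1 * G 2 2 - G 1 2 * G 2 1)
      + (G 2 2 * G 0 0 - G 2 0 * G 0 2))) ∂(volume : Measure E3).toSphere

/-- `k` is the pushforward of the restriction of `g_c` to the bundle `B` of bolts, i.e. the metric
on the base for which `B` is a Riemannian submersion: at every point of every bolt, `k(w, w)` is
the least `g_c`-square norm of the tangent vectors of `B` that project to `w`. -/
def IsPushforwardMetric (c : ℝ) (k : E3 → E3 →L[ℝ] E3 →L[ℝ] ℝ) : Prop :=
  ∀ W F, IsBoltTrivialization c W F → ∀ x ∈ W, ∀ n : E3, ‖n‖ = 1 → ∀ w : E3,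
    IsLeast {q : ℝ | ∃ η : E3, inner ℝ η n = 0 ∧
      q = bsMetric c (F x n) (trivDeriv F x n (w, η)) (trivDeriv F x n (w, η))} (k x w w)

/-! ### Riemannian geometry on open subsets of `ℝ³` -/

/-- `g` is a smooth Riemannian metric on `S`. -/
def IsRiemannianMetricOn (g : E3 → E3 →L[ℝ] E3 →L[ℝ] ℝ) (S : Set E3) : Prop :=
  ContDiffOn ℝ ∞ g S ∧ (∀ x ∈ S, ∀ v w, g x v w = g x w v) ∧ ∀ x ∈ S, ∀ v, v ≠ 0 → 0 < g x v v

/-- The vector field metrically dual to a 1-form. -/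
noncomputable def sharp (g : E3 → E3 →L[ℝ] E3 →L[ℝ] ℝ) (l : E3 → E3 →L[ℝ] ℝ) (x : E3) : E3 :=
  (g x).inverse (l x)

/-- The pointwise norm of a 1-form. -/
noncomputable def formNorm (g : E3 → E3 →L[ℝ] E3 →L[ℝ] ℝ) (l : E3 → E3 →L[ℝ] ℝ) (x : E3) : ℝ :=
  Real.sqrt (l x (sharp g l x))

/-- The standard volume form of `ℝ³`, `(v₀, v₁, v₂) ↦ det (v₀, v₁, v₂)`. -/
noncomputable def stdVol : E3 [⋀^Fin 3]→L[ℝ] ℝ :=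
  { (Matrix.detRowAlternating : (Fin 3 → ℝ) [⋀^Fin 3]→ₗ[ℝ] ℝ).compLinearMap
      (EuclideanSpace.equiv (Fin 3) ℝ).toLinearMap with
    cont := by
      change Continuous fun v : Fin 3 → E3 => Matrix.det (fun i => (v i).ofLp)
      apply Continuous.matrix_det
      fun_prop }

/-- The volume form of a metric. -/
noncomputable def metricVol (g : E3 → E3 →L[ℝ] E3 →L[ℝ] ℝ) (x : E3) : E3 [⋀^Fin 3]→L[ℝ] ℝ :=
  Real.sqrt (Matrix.of fun i j => g x (stdVec i) (stdVec j)).det • stdVol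

/-- The Hodge star of a 1-form: `*l = l^♯ ⌟ vol_g`. -/
noncomputable def hodgeStar (g : E3 → E3 →L[ℝ] E3 →L[ℝ] ℝ) (l : E3 → E3 →L[ℝ] ℝ) (x : E3) :
    E3 [⋀^Fin 2]→L[ℝ] ℝ :=
  (metricVol g x).curryLeft (sharp g l x)

/-- A 1-form as an alternating form, for the exterior derivative. -/
noncomputable def asForm (l : E3 → E3 →L[ℝ] ℝ) (x : E3) : E3 [⋀^Fin 1]→L[ℝ] ℝ :=
  ContinuousAlternatingMap.ofSubsingleton ℝ E3 ℝ 0 (l x)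

/-- `l` is a smooth harmonic 1-form on the open set `W`: `dl = 0` and `d * l = 0`. -/
def IsHarmonicOn (g : E3 → E3 →L[ℝ] E3 →L[ℝ] ℝ) (l : E3 → E3 →L[ℝ] ℝ) (W : Set E3) : Prop :=
  ContDiffOn ℝ ∞ l W ∧ ∀ x ∈ W, extDeriv (asForm l) x = 0 ∧ extDeriv (hodgeStar g l) x = 0

/-- Rotation of the base by the angle `ψ` in the coordinate `β`. -/
noncomputable def rotBase (ψ : ℝ) (x : E3) : E3 :=
  !₂[x 0, Real.cos ψ * x 1 - Real.sin ψ * x 2, Real.sin ψ * x 1 + Real.cos ψ * x 2]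

/-- `Ψ` restricts to a diffeomorphism from `A` onto `B` (`A`, `B` open). -/
def IsDiffeoOn (Ψ : E3 → E3) (A B : Set E3) : Prop :=
  ContDiffOn ℝ ∞ Ψ A ∧ MapsTo Ψ A B ∧ ∃ Φ : E3 → E3, ContDiffOn ℝ ∞ Φ B ∧ MapsTo Φ B A ∧
    LeftInvOn Φ Ψ A ∧ RightInvOn Φ Ψ B

/-- The cone metric `dϱ² + ϱ² a² g_{S²}` over the round 2-sphere of radius `a`, on
`ℝ⁺ × S² = ℝ³ ∖ 0` with `ϱ = |y|`; here `ϱ² g_{S²}` is the Euclidean metric minus `dϱ²`. -/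
noncomputable def coneMetric (a : ℝ) (y : E3) : E3 →L[ℝ] E3 →L[ℝ] ℝ :=
  let dx : Fin 3 → E3 →L[ℝ] ℝ := fun i => EuclideanSpace.proj i
  let dr : E3 →L[ℝ] ℝ := ∑ i, (y i / ‖y‖) • dx i
  dr.smulRight dr + a ^ 2 • (∑ i, (dx i).smulRight (dx i) - dr.smulRight dr)

/-- The pullback of a metric. -/
noncomputable def pullbackMetric (Ψ : E3 → E3) (g : E3 → E3 →L[ℝ] E3 →L[ℝ] ℝ) (y v w : E3) : ℝ :=
  g (Ψ y) (fderiv ℝ Ψ y v) (fderiv ℝ Ψ y w)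

/-- The Christoffel map of the Levi-Civita connection, `∇_v w = D_v w + Γ(v, w)`, by the Koszul
formula `2 g(Γ(v, w), z) = (D_v g)(w, z) + (D_w g)(v, z) - (D_z g)(v, w)`. -/
noncomputable def christoffel (g : E3 → E3 →L[ℝ] E3 →L[ℝ] ℝ) (x v w : E3) : E3 :=
  (g x).inverse ((1 / 2 : ℝ) •
    (fderiv ℝ g x v w + fderiv ℝ g x w v - ((fderiv ℝ g x).flip v).flip w))

/-- The covariant derivative of a covariant tensor field of rank `k`; the new first argument is
the direction of differentiation. -/
noncomputable def covDeriv (g : E3 → E3 →L[ℝ] E3 →L[ℝ] ℝ) {k : ℕ} (T : E3 → (Fin k → E3) → ℝ)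
    (x : E3) (v : Fin (k + 1) → E3) : ℝ :=
  fderiv ℝ (fun y => T y (Fin.tail v)) x (v 0)
    - ∑ i : Fin k, T x (Function.update (Fin.tail v) i (christoffel g x (v 0) (Fin.tail v i)))

/-- The iterated covariant derivative `∇^j T`. -/
noncomputable def iterCovDeriv (g : E3 → E3 →L[ℝ] E3 →L[ℝ] ℝ) {k : ℕ}
    (T : E3 → (Fin k → E3) → ℝ) : (j : ℕ) → E3 → (Fin (k + j) → E3) → ℝ
  | 0 => T
  | j + 1 => covDeriv g (iterCovDeriv g T j)

/-- The metric `g` on `ℝ³ ∖ S` is asymptotically conical with the given rate, with asymptotic cone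
the cone over the round 2-sphere of radius `a`: outside a compact set containing `S` there is a
diffeomorphism `Ψ` from `{ϱ > R}` in the cone with `|∇^j (Ψ^*g - g_cone)| = O(ϱ^(rate - j))` for
every `j`, norms and covariant derivatives being those of the cone metric. -/
def IsAsymptoticallyConical (g : E3 → E3 →L[ℝ] E3 →L[ℝ] ℝ) (S : Set E3) (a rate : ℝ) : Prop :=
  ∃ R > 0, ∃ K : Set E3, IsCompact K ∧ S ⊆ K ∧ ∃ Ψ : E3 → E3,
    IsDiffeoOn Ψ {y | R < ‖y‖} Kᶜ ∧
    ∀ j : ℕ, ∃ C R' : ℝ, R ≤ R' ∧ ∀ y : E3, R' < ‖y‖ → ∀ v : Fin (2 + j) → E3,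
      |iterCovDeriv (coneMetric a)
          (fun z (w : Fin 2 → E3) => pullbackMetric Ψ g z (w 0) (w 1) - coneMetric a z (w 0) (w 1))
          j y v|
        ≤ C * ‖y‖ ^ (rate - j) * ∏ i, Real.sqrt (coneMetric a y (v i) (v i))

open scoped Topology

set_option linter.unusedSimpArgs false

/-! ### The scalar equations of a bolt -/

/-! A point on a two-dimensional orbit is fixed by the rotations about some unit vector $n$ of $P$.
Invariance forces its base point to be $(Cn,y_1,y_2)$ and, together with anti-self-duality, its form
to be $t\Omega_1$ (`exists_of_mem_bolt`). So a bolt is governed by two numbers $(t,C)$, not both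
zero, with $u=tC$ and $v^2=4(1-C^2)q^2$, where $q=(c+t^2)^{1/4}$; the triples $(t,C,n)$ and
$(-t,-C,-n)$ give the same point. In terms of $X=q^2-\sqrt c$ and $d=v^2/4-\sqrt c$ the two
equations become one cubic, $X(X-d)(X+2\sqrt c)=u^2(X+\sqrt c)$. Off $S^1_c$ it has exactly one
admissible root, and this root is simple, hence smooth in the base point (`IsExcessRoot.unique`,
`exists_excessRoot`, `contDiffAt_excessRoot`). Only the common sign of $(t,C)$ is left to choose:
$C>0$ is a smooth choice on the inner region, $t>0$ on the outer one.

Conversely every equivariant trivialization comes from smooth solutions $t,C$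
(`IsBoltTrivialization.exists_normalForm`), because $SO(3)$ is transitive on directions and the
image of a direction keeps the isotropy of that direction. All claims thus reduce to algebra in $t$,
$C$, $n$. On the bundle of bolts $g_c$ splits without mixed terms into
$dt^2/q^2+2q^2(dC^2+dy_1^2+dy_2^2)$ and $a\,g_{S^2}$, where $a$ is `boltScale`
(`bsMetric_boltPtVar`). Hence $k_c$ is the first block and the bolt has area $4\pi a$. Integrating
$\varphi_c$ gives $\lambda_c=-4\pi\,(2Cq\,du-\frac{t}{2q}\,v\,dv)$ (`bsForm_boltPtVar`).

For harmonicity, the derivatives of $t$ and $C$ are found by inverting a linear system of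
determinant $-2a$; inserting them shows $d\lambda_c=0$. The dual vector of $\lambda_c$ carries a
factor $a/q$ while $\sqrt{\det k_c}=q/a$, so $*\lambda_c$ is the contraction of the Euclidean volume
with an explicit field free of $a$, and the divergence of this field vanishes. The same dual vector
gives $|\lambda_c|=4\pi a$.

On the outer region, $t>0$ and the unit vector $(C,y_1,y_2)$ are polar coordinates in which
$k_c=dt^2/q^2+2q^2g_{S^2}$. With $t=\varrho^2/4$ this is exactly the cone if $c=0$; if $c>0$ the
error has coefficients $\varrho^{-4}$ times smooth functions of $\varrho^{-1}$ and of the direction.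
Its covariant derivatives are controlled by a small symbol calculus (`ConeSymbol`, `ConeTensor`) in
which each derivative lowers the order by one. -/

/-- The quartic root `(c + t²)^{1/4}`. -/
noncomputable def quarterRoot (c t : ℝ) : ℝ := (c + t ^ 2) ^ (1 / 4 : ℝ)

lemma quarterRoot_pos {c t : ℝ} (h : 0 < c + t ^ 2) : 0 < quarterRoot c t := Real.rpow_pos_of_pos h _

lemma quarterRoot_pow_four {c t : ℝ} (h : 0 < c + t ^ 2) : quarterRoot c t ^ 4 = c + t ^ 2 := by
  rw [quarterRoot, ← Real.rpow_natCast, ← Real.rpow_mul h.le]; norm_num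

lemma quarterRoot_sq_eq {c t r : ℝ} (h : 0 < c + t ^ 2) (hr : 0 ≤ r) (h2 : c + t ^ 2 = r ^ 2) :
    quarterRoot c t ^ 2 = r := by
  have h4 := quarterRoot_pow_four h
  have hq := quarterRoot_pos h
  rw [← sq_eq_sq₀ (by positivity) hr]
  linear_combination h4 + h2

lemma rpow_half_eq {c t : ℝ} (h : 0 < c + t ^ 2) :
    (c + t ^ 2) ^ (1 / 2 : ℝ) = quarterRoot c t ^ 2 := by
  rw [quarterRoot, ← Real.rpow_mul_natCast h.le]; norm_num

lemma rpow_neg_half_eq {c t : ℝ} (h : 0 < c + t ^ 2) :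
    (c + t ^ 2) ^ (-(1 / 2) : ℝ) = (quarterRoot c t ^ 2)⁻¹ := by
  rw [Real.rpow_neg h.le, rpow_half_eq h]

lemma rpow_neg_three_quarters_eq {c t : ℝ} (h : 0 < c + t ^ 2) :
    (c + t ^ 2) ^ (-(3 / 4) : ℝ) = (quarterRoot c t ^ 3)⁻¹ := by
  rw [Real.rpow_neg h.le, quarterRoot, ← Real.rpow_mul_natCast h.le]; norm_num

lemma sqrt_eq_quarterRoot_sq {c t : ℝ} (h : 0 < c + t ^ 2) :
    Real.sqrt (c + t ^ 2) = quarterRoot c t ^ 2 := by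
  rw [Real.sqrt_eq_rpow, rpow_half_eq h]

lemma quarterRoot_neg (c t : ℝ) : quarterRoot c (-t) = quarterRoot c t := by
  simp [quarterRoot]

/-- `(t, C)` with `C = ± cos α` describes a bolt over `x`: `u = t C` and
`v² = 4 (1 - C²) (c + t²)^{1/2}`. -/
structure IsBoltSolution (c : ℝ) (x : E3) (t C : ℝ) : Prop where
  mul : t * C = x 0
  sq : x 1 ^ 2 + x 2 ^ 2 = 4 * (1 - C ^ 2) * quarterRoot c t ^ 2
  pos : 0 < c + t ^ 2
  ne : t ≠ 0 ∨ C ≠ 0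

/-- This is the bolt itself with the axis $n$ reversed, see `boltOf_neg`. -/
lemma IsBoltSolution.neg {c : ℝ} {x : E3} {t C : ℝ} (h : IsBoltSolution c x t C) :
    IsBoltSolution c x (-t) (-C) where
  mul := by rw [← h.mul]; ring
  sq := by rw [quarterRoot_neg, h.sq]; ring
  pos := by simpa using h.pos
  ne := by simpa using h.ne

lemma IsBoltSolution.sq_le_one {c : ℝ} {x : E3} {t C : ℝ} (h : IsBoltSolution c x t C) :
    C ^ 2 ≤ 1 := by
  have hq := quarterRoot_pos h.pos
  by_contra! hlt
  have := h.sq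
  nlinarith [sq_nonneg (x 1), sq_nonneg (x 2), mul_pos (sub_pos.2 hlt) (pow_pos hq 2)]

/-- The bolt size in terms of `t` and `C`. -/
noncomputable def boltScale (c t C : ℝ) : ℝ :=
  2 * quarterRoot c t ^ 2 * C ^ 2 + t ^ 2 * (1 - C ^ 2) / quarterRoot c t ^ 2

lemma IsBoltSolution.boltScale_pos {c : ℝ} {x : E3} {t C : ℝ} (h : IsBoltSolution c x t C) :
    0 < boltScale c t C := by
  have hq := quarterRoot_pos h.pos
  have h1 : 0 ≤ 1 - C ^ 2 := by linarith [h.sq_le_one]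
  rw [boltScale]
  by_cases hC : C = 0
  · have ht : t ≠ 0 := by simpa [hC] using h.ne
    subst hC
    have : 0 < t ^ 2 := by positivity
    simp only [ne_eq, OfNat.ofNat_ne_zero, not_false_eq_true, zero_pow, sub_zero, mul_one, mul_zero,
      zero_add]
    positivity
  · have : 0 < C ^ 2 := by positivity
    have h2 : 0 ≤ t ^ 2 * (1 - C ^ 2) / quarterRoot c t ^ 2 := by positivity
    positivity

/-! ### The cubic equation for the excess root -/

/-- The deviation `v² / 4 - c^{1/2}` from the cylinder over `S¹_c`. -/
noncomputable def excess (c : ℝ) (x : E3) : ℝ := (x 1 ^ 2 + x 2 ^ 2) / 4 - Real.sqrt c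

/-- The equation for `X = (c + t²)^{1/2} - c^{1/2}` of a bolt over `x`. -/
structure IsExcessRoot (c : ℝ) (x : E3) (X : ℝ) : Prop where
  nonneg : 0 ≤ X
  le : excess c x ≤ X
  pos : 0 < X + Real.sqrt c
  lt : 0 < X ∨ excess c x < X
  eq : X * (X - excess c x) * (X + 2 * Real.sqrt c) = x 0 ^ 2 * (X + Real.sqrt c)

/-- The cubic makes $X(X-d)$ nonnegative, so strict positivity of one factor settles the sign of the
other. What has to be checked is then an equation and open conditions, which persist along a
continuous branch of roots. -/
lemma IsExcessRoot.of_lt {c : ℝ} {x : E3} {X : ℝ} (pos : 0 < X + Real.sqrt c)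
    (lt : 0 < X ∨ excess c x < X)
    (eq : X * (X - excess c x) * (X + 2 * Real.sqrt c) = x 0 ^ 2 * (X + Real.sqrt c)) :
    IsExcessRoot c x X := by
  have hs := Real.sqrt_nonneg c
  have h2 : 0 < X + 2 * Real.sqrt c := by linarith
  have hr : 0 ≤ x 0 ^ 2 * (X + Real.sqrt c) := by positivity
  rw [← eq] at hr
  have h3 := nonneg_of_mul_nonneg_left hr h2
  refine ⟨?_, ?_, pos, lt, eq⟩
  · rcases lt with h | h
    · exact h.le
    · exact nonneg_of_mul_nonneg_left h3 (sub_pos.2 h)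
  · rcases lt with h | h
    · exact sub_nonneg.1 (nonneg_of_mul_nonneg_right h3 h)
    · exact h.le

/-- After division by $X+\sqrt c$ the cubic reads $\frac{X(X+2\sqrt c)}{X+\sqrt c}\,(X-d)=u^2$. Both
factors are nonnegative and strictly increasing on the admissible range. -/
lemma IsExcessRoot.unique {c : ℝ} {x : E3} {X X' : ℝ} (h : IsExcessRoot c x X)
    (h' : IsExcessRoot c x X') : X = X' := by
  wlog hlt : X < X' generalizing X X'
  · rcases lt_trichotomy X X' with h1 | h1 | h1
    · exact absurd h1 hlt
    · exact h1
    · exact (this h' h h1).symm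
  exfalso
  have hs := Real.sqrt_nonneg c
  set s := Real.sqrt c
  set d := excess c x
  have e1 := h.eq
  have e2 := h'.eq
  -- Monotonicity of $X(X+2s)/(X+s)$ with denominators cleared.
  have hA : X * (X + 2 * s) * (X' + s) < X' * (X' + 2 * s) * (X + s) := by
    have : 0 < (X' - X) * (X * X' + s * (X + X') + 2 * s ^ 2) := by
      apply mul_pos (sub_pos.2 hlt)
      have h0 := h.nonneg
      have hp := h.pos
      rcases h0.lt_or_eq with h1 | h1
      · have := mul_pos h1 (h1.trans hlt)
        have := mul_nonneg hs (add_nonneg h.nonneg h'.nonneg)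
        positivity
      · have : 0 < s := by rwa [← h1, zero_add] at hp
        have := mul_nonneg h.nonneg h'.nonneg
        have := mul_nonneg hs (add_nonneg h.nonneg h'.nonneg)
        positivity
    nlinarith
  have hA0 : 0 ≤ X * (X + 2 * s) * (X' + s) :=
    mul_nonneg (mul_nonneg h.nonneg (by linarith [h.nonneg])) h'.pos.le
  have hZ : 0 ≤ X - d := sub_nonneg.2 h.le
  have : (X * (X + 2 * s) * (X' + s)) * (X - d) < (X' * (X' + 2 * s) * (X + s)) * (X' - d) :=
    mul_lt_mul'' hA (by linarith) hA0 hZ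
  have e : (X * (X + 2 * s) * (X' + s)) * (X - d) = (X' * (X' + 2 * s) * (X + s)) * (X' - d) := by
    linear_combination (X' + s) * e1 - (X + s) * e2
  linarith

/-- The substitution rests on $X-d=C^2q^2$ and $X(X+2\sqrt c)=t^2$, whose product is $u^2q^2$. -/
lemma IsBoltSolution.isExcessRoot {c : ℝ} (hc : 0 ≤ c) {x : E3} {t C : ℝ}
    (h : IsBoltSolution c x t C) : IsExcessRoot c x (quarterRoot c t ^ 2 - Real.sqrt c) := by
  have hq := quarterRoot_pos h.pos
  have h4 := quarterRoot_pow_four h.pos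
  have hs := Real.sqrt_nonneg c
  have hs2 := Real.sq_sqrt hc
  have hd : excess c x = (1 - C ^ 2) * quarterRoot c t ^ 2 - Real.sqrt c := by
    rw [excess, h.sq]; ring
  apply IsExcessRoot.of_lt
  · simpa using pow_pos hq 2
  · rw [hd]
    rcases h.ne with h1 | h1
    · left
      rw [← sqrt_eq_quarterRoot_sq h.pos, sub_pos]
      exact Real.sqrt_lt_sqrt hc (by have : 0 < t ^ 2 := by positivity
                                     linarith)
    · right
      have : 0 < C ^ 2 * quarterRoot c t ^ 2 := by positivity
      linarith
  · rw [hd, ← h.mul]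
    linear_combination (C ^ 2 * quarterRoot c t ^ 2) * (h4 - hs2)

/-- Uniqueness of the root fixes $q^2$, hence $t^2$, and then $v^2$ fixes $C^2$. The product $tC=u$
ties the two signs together. -/
lemma IsBoltSolution.eq_or_eq_neg {c : ℝ} (hc : 0 ≤ c) {x : E3} {t C t' C' : ℝ}
    (h : IsBoltSolution c x t C) (h' : IsBoltSolution c x t' C') :
    t' = t ∧ C' = C ∨ t' = -t ∧ C' = -C := by
  have hX := (h.isExcessRoot hc).unique (h'.isExcessRoot hc)
  have hq : quarterRoot c t ^ 2 = quarterRoot c t' ^ 2 := by linarith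
  have ht : t' ^ 2 = t ^ 2 := by
    linear_combination quarterRoot_pow_four h.pos - quarterRoot_pow_four h'.pos +
      (-hq) * (quarterRoot c t ^ 2 + quarterRoot c t' ^ 2) * (-1) * (-1)
  have hC : C' ^ 2 = C ^ 2 := by
    have hq0 := quarterRoot_pos h.pos
    have e := h.sq.symm.trans h'.sq
    rw [← hq] at e
    have : (C' ^ 2 - C ^ 2) * quarterRoot c t ^ 2 = 0 := by linear_combination e / 4
    rcases mul_eq_zero.1 this with h1 | h1
    · linarith
    · exact absurd h1 (by positivity)
  have hm := h.mul.trans h'.mul.symm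
  rcases sq_eq_sq_iff_eq_or_eq_neg.1 ht with h1 | h1 <;>
  rcases sq_eq_sq_iff_eq_or_eq_neg.1 hC with h2 | h2
  · exact .inl ⟨h1, h2⟩
  -- With opposite relative signs $tC=-tC$, so one of the two numbers is zero and its sign is
  -- immaterial.
  · subst h1 h2
    have : t' * C = 0 := by linarith
    rcases mul_eq_zero.1 this with h0 | h0
    · right; simp [h0]
    · left; simp [h0]
  · subst h1 h2
    have : t * C' = 0 := by linarith
    rcases mul_eq_zero.1 this with h0 | h0
    · left; simp [h0]
    · right; simp [h0]
  · exact .inr ⟨h1, h2⟩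

lemma quarterRoot_sq_of_excessRoot {c : ℝ} (hc : 0 ≤ c) {x : E3} {X t : ℝ} (h : IsExcessRoot c x X)
    (ht : t ^ 2 = X * (X + 2 * Real.sqrt c)) :
    0 < c + t ^ 2 ∧ quarterRoot c t ^ 2 = X + Real.sqrt c := by
  have e : c + t ^ 2 = (X + Real.sqrt c) ^ 2 := by
    linear_combination ht - Real.sq_sqrt hc
  have hp : 0 < c + t ^ 2 := by rw [e]; exact pow_pos h.pos 2
  exact ⟨hp, quarterRoot_sq_eq hp h.pos.le e⟩

lemma IsExcessRoot.isBoltSolution {c : ℝ} (hc : 0 ≤ c) {x : E3} {X t C : ℝ}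
    (h : IsExcessRoot c x X) (ht : t ^ 2 = X * (X + 2 * Real.sqrt c))
    (hC : C ^ 2 * (X + Real.sqrt c) = X - excess c x) (hm : t * C = x 0) :
    IsBoltSolution c x t C := by
  obtain ⟨hp, hq⟩ := quarterRoot_sq_of_excessRoot hc h ht
  refine ⟨hm, ?_, hp, ?_⟩
  · have : x 1 ^ 2 + x 2 ^ 2 = 4 * (excess c x + Real.sqrt c) := by rw [excess]; ring
    rw [this, hq]
    linear_combination 4 * hC
  · have hs := Real.sqrt_nonneg c
    rcases h.lt with h1 | h1
    · left; rintro rfl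
      have : 0 < X * (X + 2 * Real.sqrt c) := by positivity
      simp [← ht] at this
    · right; rintro rfl
      simp at hC; linarith

lemma exists_excessRoot {c : ℝ} {x : E3} (hx : x 0 ≠ 0 ∨ excess c x ≠ 0) :
    ∃ X, IsExcessRoot c x X := by
  set s := Real.sqrt c with hs_def
  have hs : 0 ≤ s := Real.sqrt_nonneg c
  set d := excess c x with hd
  set u := x 0
  have key : ∀ r : ℝ, 0 ≤ r → |d| ≤ Real.sqrt (d ^ 2 + r) := fun r hr => by
    rw [← Real.sqrt_sq_eq_abs]; exact Real.sqrt_le_sqrt (by linarith)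
  have hsq : ∀ r : ℝ, 0 ≤ r → Real.sqrt (d ^ 2 + r) ^ 2 = d ^ 2 + r := fun r hr =>
    Real.sq_sqrt (by positivity)
  have hu := sq_nonneg u
  -- Since $(X+s)/(X+2s)$ lies between $\frac12$ and $1$, the root lies between the larger roots of
  -- $X(X-d)=u^2/2$ and $X(X-d)=u^2$.
  set X₁ := (d + Real.sqrt (d ^ 2 + 2 * u ^ 2)) / 2 with hX₁
  set X₂ := (d + Real.sqrt (d ^ 2 + 4 * u ^ 2)) / 2 with hX₂
  have e1 : X₁ * (X₁ - d) = u ^ 2 / 2 := by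
    linear_combination hsq (2 * u ^ 2) (by positivity) / 4
  have e2 : X₂ * (X₂ - d) = u ^ 2 := by
    linear_combination hsq (4 * u ^ 2) (by positivity) / 4
  have k1 := key (2 * u ^ 2) (by positivity)
  have hX1 : 0 ≤ X₁ := by linarith [neg_abs_le d]
  have hd1 : d ≤ X₁ := by linarith [le_abs_self d]
  have h12 : X₁ ≤ X₂ := by
    have := Real.sqrt_le_sqrt (show d ^ 2 + 2 * u ^ 2 ≤ d ^ 2 + 4 * u ^ 2 by linarith)
    linarith
  let f : ℝ → ℝ := fun X => X * (X - d) * (X + 2 * s) - u ^ 2 * (X + s)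
  have hf : ContinuousOn f (Icc X₁ X₂) := by fun_prop
  have h0 : (0 : ℝ) ∈ Icc (f X₁) (f X₂) := by
    constructor
    · have : f X₁ = - (u ^ 2 * X₁ / 2) := by
        simp only [f]; linear_combination (X₁ + 2 * s) * e1
      rw [this]
      have : 0 ≤ u ^ 2 * X₁ / 2 := by positivity
      linarith
    · have : f X₂ = u ^ 2 * s := by
        simp only [f]; linear_combination (X₂ + 2 * s) * e2
      rw [this]; positivity
  obtain ⟨X, ⟨hX, -⟩, hfX⟩ := intermediate_value_Icc h12 hf h0
  have hlt : 0 < X ∨ d < X := by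
    by_cases hu0 : u = 0
    · have hd0 : d ≠ 0 := by simpa [hu0] using hx
      rcases lt_or_gt_of_ne hd0 with h | h
      · right; linarith
      · left; linarith
    · left
      have : 0 < X₁ := lt_of_le_of_ne hX1 fun h => by
        rw [← h, zero_mul] at e1
        exact hu0 (pow_eq_zero_iff two_ne_zero |>.1 (by linarith))
      linarith
  -- The sum can vanish only if $X=s=0$; then $d=v^2/4\ge0$, which contradicts both alternatives of
  -- `hlt`.
  have hpos : 0 < X + s := by
    by_contra! hle
    have hX0 : X = 0 := by linarith
    have hs0 : s = 0 := by linarith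
    have hd0 : 0 ≤ d := by
      have : d = (x 1 ^ 2 + x 2 ^ 2) / 4 - s := by rw [hd, excess]
      rw [this, hs0]; simp; positivity
    rcases hlt with h | h <;> linarith
  exact ⟨X, .of_lt hpos hlt (sub_eq_zero.1 hfX)⟩

/-- The root, as a function on the base. -/
noncomputable def excessRoot (c : ℝ) (x : E3) : ℝ := Classical.epsilon (IsExcessRoot c x)

lemma isExcessRoot_excessRoot {c : ℝ} {x : E3} (hx : x 0 ≠ 0 ∨ excess c x ≠ 0) :
    IsExcessRoot c x (excessRoot c x) := Classical.epsilon_spec (exists_excessRoot hx)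

lemma contDiff_excess (c : ℝ) : ContDiff ℝ ∞ (excess c) := by
  unfold excess; fun_prop

/-- The left side is the $X$-derivative of the cubic. Multiplied by $X+s$, and with $u^2$ eliminated
by the equation, it becomes a sum of nonnegative terms that cannot all vanish. This simplicity of
the root feeds the implicit function theorem. -/
lemma IsExcessRoot.deriv_pos_or {c : ℝ} {x : E3} {X : ℝ} (h : IsExcessRoot c x X) :
    (X - excess c x) * (X + 2 * Real.sqrt c) + X * (X + 2 * Real.sqrt c) + X * (X - excess c x)
      - x 0 ^ 2 ≠ 0 := by
  have hs := Real.sqrt_nonneg c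
  set s := Real.sqrt c
  set Z := X - excess c x with hZdef
  have hZ : 0 ≤ Z := sub_nonneg.2 h.le
  have hX := h.nonneg
  have e := h.eq
  rw [← hZdef] at e
  have h1 : 0 < ((Z * (X + 2 * s) + X * (X + 2 * s) + X * Z - x 0 ^ 2)) * (X + s) := by
    have : ((Z * (X + 2 * s) + X * (X + 2 * s) + X * Z - x 0 ^ 2)) * (X + s) =
        Z * s * (X + 2 * s) + (X * (X + 2 * s) + X * Z) * (X + s) := by
      linear_combination -(-e) 
    rw [this]
    have hp : 0 < X + s := h.pos
    rcases hX.lt_or_eq with hX0 | hX0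
    · positivity
    · have : 0 < s := by linarith
      have : 0 < Z := by
        rcases h.lt with h1 | h1
        · linarith
        · exact sub_pos.2 h1
      positivity
  intro h0
  rw [h0] at h1; simp at h1

/-- The implicit function theorem gives a smooth local branch of solutions of the cubic. The
admissibility conditions are open along it, so by uniqueness the branch coincides with `excessRoot`.
-/
lemma contDiffAt_excessRoot {c : ℝ} {x : E3} (hx : x 0 ≠ 0 ∨ excess c x ≠ 0) :
    ContDiffAt ℝ ∞ (excessRoot c) x := by
  set s := Real.sqrt c with hs
  have hX := isExcessRoot_excessRoot hx
  set X := excessRoot c x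
  let f : E3 × ℝ → ℝ := fun z =>
    z.2 * (z.2 - excess c z.1) * (z.2 + 2 * s) - z.1 0 ^ 2 * (z.2 + s)
  have hex := contDiff_excess c
  have hf : ContDiff ℝ ∞ f := by
    have h1 : ContDiff ℝ ∞ fun z : E3 × ℝ => excess c z.1 := hex.comp contDiff_fst
    have h2 : ContDiff ℝ ∞ fun z : E3 × ℝ => z.1 0 := by fun_prop
    fun_prop
  have hfat : ContDiffAt ℝ ∞ f (x, X) := hf.contDiffAt
  have hf0 : f (x, X) = 0 := sub_eq_zero.2 hX.eq
  have hinv : (fderiv ℝ f (x, X) ∘L .inr ℝ E3 ℝ).IsInvertible := by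
    have hd : HasDerivAt (fun Y : ℝ => f (x, Y))
        ((X - excess c x) * (X + 2 * s) + X * (X + 2 * s) + X * (X - excess c x) - x 0 ^ 2) X := by
      have h1 := hasDerivAt_id X
      have := ((h1.mul (h1.sub_const (excess c x))).mul (h1.add_const (2 * s))).sub
        ((h1.add_const s).const_mul (x 0 ^ 2))
      refine this.congr_deriv ?_
      simp; ring
    have hd2 : HasDerivAt (fun Y : ℝ => f (x, Y)) (fderiv ℝ f (x, X) (0, 1)) X := by
      have h1 : HasFDerivAt f (fderiv ℝ f (x, X)) (x, X) :=
        (hf.differentiable (by simp)).differentiableAt.hasFDerivAt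
      exact h1.comp_hasDerivAt X ((hasDerivAt_const X x).prodMk (hasDerivAt_id X))
    have hne : fderiv ℝ f (x, X) (0, 1) ≠ 0 := by
      rw [hd2.unique hd]; exact hX.deriv_pos_or
    refine ⟨ContinuousLinearEquiv.unitsEquivAut ℝ (Units.mk0 _ hne), ?_⟩
    ext
    simp
  have hn : (∞ : WithTop ℕ∞) ≠ 0 := by simp
  set ψ := hfat.implicitFunction hn hinv
  have hψ : ContDiffAt ℝ ∞ ψ x := hfat.contDiffAt_implicitFunction hn hinv
  have hψx : ψ x = X := hfat.implicitFunction_apply_self hn hinv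
  refine hψ.congr_of_eventuallyEq ?_
  have hev : ∀ᶠ z in 𝓝 x, f (z, ψ z) = f (x, X) := hfat.eventually_apply_implicitFunction hn hinv
  have hc1 : ContinuousAt ψ x := hψ.continuousAt
  have hc2 : ContinuousAt (excess c) x := hex.continuous.continuousAt
  have hpos : ∀ᶠ z in 𝓝 x, 0 < ψ z + s :=
    continuousAt_const.eventually_lt (hc1.add continuousAt_const) (by simpa [hψx] using hX.pos)
  have hlt : ∀ᶠ z in 𝓝 x, 0 < ψ z ∨ excess c z < ψ z := by
    rcases hX.lt with h | h
    · filter_upwards [continuousAt_const.eventually_lt hc1 (by rw [hψx]; exact h)] with z hz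
      exact .inl hz
    · filter_upwards [hc2.eventually_lt hc1 (by rw [hψx]; exact h)] with z hz
      exact .inr hz
  filter_upwards [hev, hpos, hlt] with z h1 h2 h3
  have hr : IsExcessRoot c z (ψ z) := .of_lt h2 h3 (sub_eq_zero.1 (h1.trans hf0))
  exact (Classical.epsilon_spec ⟨_, hr⟩ : IsExcessRoot c z (excessRoot c z)).unique hr

/-! ### The Hodge star in components -/

/-- `det (p, e_i, e_j, e_k, e_l)`. -/
noncomputable def normalVol (p : Fin 5 → ℝ) (i j k l : Fin 5) : ℝ :=
  (Matrix.of ![p, Pi.single i 1, Pi.single j 1, Pi.single k 1, Pi.single l 1]).det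

section normalVol
variable (p : Fin 5 → ℝ) (i j k l : Fin 5)

lemma det_eq_neg_of_swap {M N : Matrix (Fin 5) (Fin 5) ℝ} (a b : Fin 5) (hab : a ≠ b)
    (h : ∀ r, N (Equiv.swap a b r) = M r) : M.det = -N.det := by
  have : M = N.submatrix (Equiv.swap a b) id := by ext r s; simp [← h r]
  rw [this, Matrix.det_permute]; simp [Equiv.Perm.sign_swap hab]

lemma normalVol_swap_last : normalVol p i j k l = -normalVol p i j l k :=
  det_eq_neg_of_swap 3 4 (by decide) fun r => by fin_cases r <;> rfl

lemma normalVol_swap_mid : normalVol p i j k l = -normalVol p i k j l :=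
  det_eq_neg_of_swap 2 3 (by decide) fun r => by fin_cases r <;> rfl

lemma normalVol_swap_first : normalVol p i j k l = -normalVol p j i k l :=
  det_eq_neg_of_swap 1 2 (by decide) fun r => by fin_cases r <;> rfl

/-- In this and the next two lemmas the inequality orients the transposition, so that repeated
rewriting sorts the indices and stops. -/
lemma normalVol_sort_last (_ : l < k) : normalVol p i j k l = -normalVol p i j l k :=
  normalVol_swap_last ..

lemma normalVol_sort_mid (_ : k < j) : normalVol p i j k l = -normalVol p i k j l :=
  normalVol_swap_mid ..

lemma normalVol_sort_first (_ : j < i) : normalVol p i j k l = -normalVol p j i k l :=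
  normalVol_swap_first ..

lemma normalVol_last_eq : normalVol p i j k k = 0 := by
  linarith [normalVol_swap_last p i j k k]

lemma normalVol_mid_eq : normalVol p i j j l = 0 := by
  linarith [normalVol_swap_mid p i j j l]

lemma normalVol_first_eq : normalVol p i i k l = 0 := by
  linarith [normalVol_swap_first p i i k l]

lemma normalVol_0123 : normalVol p 0 1 2 3 = p 4 := by
  simp [normalVol, Matrix.det_succ_row_zero, Fin.sum_univ_succ, Fin.succAbove, Pi.single_apply,
    Matrix.submatrix]
  ring

lemma normalVol_0124 : normalVol p 0 1 2 4 = -p 3 := by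
  simp [normalVol, Matrix.det_succ_row_zero, Fin.sum_univ_succ, Fin.succAbove, Pi.single_apply,
    Matrix.submatrix]
  ring

lemma normalVol_0134 : normalVol p 0 1 3 4 = p 2 := by
  simp [normalVol, Matrix.det_succ_row_zero, Fin.sum_univ_succ, Fin.succAbove, Pi.single_apply,
    Matrix.submatrix]

lemma normalVol_0234 : normalVol p 0 2 3 4 = -p 1 := by
  simp [normalVol, Matrix.det_succ_row_zero, Fin.sum_univ_succ, Fin.succAbove, Pi.single_apply,
    Matrix.submatrix]

lemma normalVol_1234 : normalVol p 1 2 3 4 = p 0 := by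
  simp [normalVol, Matrix.det_succ_row_zero, Fin.sum_univ_succ, Fin.succAbove, Pi.single_apply,
    Matrix.submatrix]

end normalVol

lemma starS4_apply (p : Fin 5 → ℝ) (om : Matrix (Fin 5) (Fin 5) ℝ) (i j : Fin 5) :
    starS4 p om i j = (1 / 2) * ∑ k, ∑ l, normalVol p i j k l * om k l := rfl

lemma starS4_transpose (p : Fin 5 → ℝ) (om : Matrix (Fin 5) (Fin 5) ℝ) (i j : Fin 5) :
    starS4 p om j i = -starS4 p om i j := by
  simp_rw [starS4_apply, normalVol_swap_first p j i, neg_mul, Finset.sum_neg_distrib, mul_neg]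

section star
variable (p : Fin 5 → ℝ) {om : Matrix (Fin 5) (Fin 5) ℝ}

/-- For antisymmetric $\omega$ the terms $(k,l)$ and $(l,k)$ agree, which absorbs the factor
$\frac12$. Only pairs disjoint from the two free indices survive, each with one coordinate of $p$ as
its determinant. -/
lemma starS4_01 (h : ∀ i j, om j i = -om i j) :
    starS4 p om 0 1 = p 4 * om 2 3 - p 3 * om 2 4 + p 2 * om 3 4 := by
  simp only [starS4_apply, Fin.sum_univ_five, normalVol_first_eq, normalVol_mid_eq,
    normalVol_last_eq, Fin.reduceLT, normalVol_sort_first, normalVol_sort_mid, normalVol_sort_last,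
    normalVol_0123, normalVol_0124, normalVol_0134, normalVol_0234, normalVol_1234]
  rw [h 2 3, h 2 4, h 3 4]
  ring

lemma starS4_02 (h : ∀ i j, om j i = -om i j) :
    starS4 p om 0 2 = -p 4 * om 1 3 + p 3 * om 1 4 - p 1 * om 3 4 := by
  simp only [starS4_apply, Fin.sum_univ_five, normalVol_first_eq, normalVol_mid_eq,
    normalVol_last_eq, Fin.reduceLT, normalVol_sort_first, normalVol_sort_mid, normalVol_sort_last,
    normalVol_0123, normalVol_0124, normalVol_0134, normalVol_0234, normalVol_1234]
  rw [h 1 3, h 1 4, h 3 4]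
  ring

lemma starS4_03 (h : ∀ i j, om j i = -om i j) :
    starS4 p om 0 3 = p 4 * om 1 2 - p 2 * om 1 4 + p 1 * om 2 4 := by
  simp only [starS4_apply, Fin.sum_univ_five, normalVol_first_eq, normalVol_mid_eq,
    normalVol_last_eq, Fin.reduceLT, normalVol_sort_first, normalVol_sort_mid, normalVol_sort_last,
    normalVol_0123, normalVol_0124, normalVol_0134, normalVol_0234, normalVol_1234]
  rw [h 1 2, h 1 4, h 2 4]
  ring

lemma starS4_04 (h : ∀ i j, om j i = -om i j) :
    starS4 p om 0 4 = -p 3 * om 1 2 + p 2 * om 1 3 - p 1 * om 2 3 := by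
  simp only [starS4_apply, Fin.sum_univ_five, normalVol_first_eq, normalVol_mid_eq,
    normalVol_last_eq, Fin.reduceLT, normalVol_sort_first, normalVol_sort_mid, normalVol_sort_last,
    normalVol_0123, normalVol_0124, normalVol_0134, normalVol_0234, normalVol_1234]
  rw [h 1 2, h 1 3, h 2 3]
  ring

lemma starS4_12 (h : ∀ i j, om j i = -om i j) :
    starS4 p om 1 2 = p 4 * om 0 3 - p 3 * om 0 4 + p 0 * om 3 4 := by
  simp only [starS4_apply, Fin.sum_univ_five, normalVol_first_eq, normalVol_mid_eq,
    normalVol_last_eq, Fin.reduceLT, normalVol_sort_first, normalVol_sort_mid, normalVol_sort_last,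
    normalVol_0123, normalVol_0124, normalVol_0134, normalVol_0234, normalVol_1234]
  rw [h 0 3, h 0 4, h 3 4]
  ring

lemma starS4_13 (h : ∀ i j, om j i = -om i j) :
    starS4 p om 1 3 = -p 4 * om 0 2 + p 2 * om 0 4 - p 0 * om 2 4 := by
  simp only [starS4_apply, Fin.sum_univ_five, normalVol_first_eq, normalVol_mid_eq,
    normalVol_last_eq, Fin.reduceLT, normalVol_sort_first, normalVol_sort_mid, normalVol_sort_last,
    normalVol_0123, normalVol_0124, normalVol_0134, normalVol_0234, normalVol_1234]
  rw [h 0 2, h 0 4, h 2 4]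
  ring

lemma starS4_14 (h : ∀ i j, om j i = -om i j) :
    starS4 p om 1 4 = p 3 * om 0 2 - p 2 * om 0 3 + p 0 * om 2 3 := by
  simp only [starS4_apply, Fin.sum_univ_five, normalVol_first_eq, normalVol_mid_eq,
    normalVol_last_eq, Fin.reduceLT, normalVol_sort_first, normalVol_sort_mid, normalVol_sort_last,
    normalVol_0123, normalVol_0124, normalVol_0134, normalVol_0234, normalVol_1234]
  rw [h 0 2, h 0 3, h 2 3]
  ring

lemma starS4_23 (h : ∀ i j, om j i = -om i j) :
    starS4 p om 2 3 = p 4 * om 0 1 - p 1 * om 0 4 + p 0 * om 1 4 := by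
  simp only [starS4_apply, Fin.sum_univ_five, normalVol_first_eq, normalVol_mid_eq,
    normalVol_last_eq, Fin.reduceLT, normalVol_sort_first, normalVol_sort_mid, normalVol_sort_last,
    normalVol_0123, normalVol_0124, normalVol_0134, normalVol_0234, normalVol_1234]
  rw [h 0 1, h 0 4, h 1 4]
  ring

lemma starS4_24 (h : ∀ i j, om j i = -om i j) :
    starS4 p om 2 4 = -p 3 * om 0 1 + p 1 * om 0 3 - p 0 * om 1 3 := by
  simp only [starS4_apply, Fin.sum_univ_five, normalVol_first_eq, normalVol_mid_eq,
    normalVol_last_eq, Fin.reduceLT, normalVol_sort_first, normalVol_sort_mid, normalVol_sort_last,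
    normalVol_0123, normalVol_0124, normalVol_0134, normalVol_0234, normalVol_1234]
  rw [h 0 1, h 0 3, h 1 3]
  ring

lemma starS4_34 (h : ∀ i j, om j i = -om i j) :
    starS4 p om 3 4 = p 2 * om 0 1 - p 1 * om 0 2 + p 0 * om 1 2 := by
  simp only [starS4_apply, Fin.sum_univ_five, normalVol_first_eq, normalVol_mid_eq,
    normalVol_last_eq, Fin.reduceLT, normalVol_sort_first, normalVol_sort_mid, normalVol_sort_last,
    normalVol_0123, normalVol_0124, normalVol_0134, normalVol_0234, normalVol_1234]
  rw [h 0 1, h 0 2, h 1 2]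
  ring

end star

/-! ### Points of the bolts -/

/-- The form `Ω₁` at the point `(C n, y₁, y₂)` of `S⁴`, invariant under rotations about the unit
vector `n`. -/
def antiForm (C y₁ y₂ : ℝ) (n : Fin 3 → ℝ) : Matrix (Fin 5) (Fin 5) ℝ :=
  !![0, -n 2, n 1, n 0 * y₂, -(n 0 * y₁);
     n 2, 0, -n 0, n 1 * y₂, -(n 1 * y₁);
     -n 1, n 0, 0, n 2 * y₂, -(n 2 * y₁);
     -(n 0 * y₂), -(n 1 * y₂), -(n 2 * y₂), 0, C;
     n 0 * y₁, n 1 * y₁, n 2 * y₁, -C, 0]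

/-- The point `(p, t Ω₁)` with `p = (C n, y₁, y₂)`. -/
def boltPt (t C y₁ y₂ : ℝ) (n : Fin 3 → ℝ) : Ambient :=
  (![C * n 0, C * n 1, C * n 2, y₁, y₂], t • antiForm C y₁ y₂ n)

lemma antiForm_antisymm (C y₁ y₂ : ℝ) (n : Fin 3 → ℝ) (i j : Fin 5) :
    antiForm C y₁ y₂ n j i = -antiForm C y₁ y₂ n i j := by
  fin_cases i <;> fin_cases j <;> simp [antiForm]

lemma smul_antiForm_antisymm (t C y₁ y₂ : ℝ) (n : Fin 3 → ℝ) (i j : Fin 5) :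
    (t • antiForm C y₁ y₂ n) j i = -(t • antiForm C y₁ y₂ n) i j := by
  simp [antiForm_antisymm C y₁ y₂ n i j]

lemma ext_of_antisymm {A B : Matrix (Fin 5) (Fin 5) ℝ} (hA : ∀ i j, A j i = -A i j)
    (hB : ∀ i j, B j i = -B i j) (h : ∀ i j, i < j → A i j = B i j) : A = B := by
  ext i j
  rcases lt_trichotomy i j with hij | rfl | hij
  · exact h i j hij
  · linarith [hA i i, hB i i]
  · rw [hA j i, hB j i, h j i hij]

section
variable {t C y₁ y₂ : ℝ} {n : Fin 3 → ℝ} (hn : n 0 ^ 2 + n 1 ^ 2 + n 2 ^ 2 = 1)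
  (hy : C ^ 2 + y₁ ^ 2 + y₂ ^ 2 = 1)

lemma radiusSq_boltPt (hn : n 0 ^ 2 + n 1 ^ 2 + n 2 ^ 2 = 1) (hy : C ^ 2 + y₁ ^ 2 + y₂ ^ 2 = 1) :
    radiusSq (boltPt t C y₁ y₂ n) = t ^ 2 := by
  simp [radiusSq, boltPt, Matrix.trace, Matrix.mul_apply, Fin.sum_univ_five, antiForm]
  linear_combination (t ^ 2 / 2) * (y₁ ^ 2 + y₂ ^ 2 + 1) * hn + (t ^ 2 / 2) * hy

lemma starS4_antiForm (hn : n 0 ^ 2 + n 1 ^ 2 + n 2 ^ 2 = 1) (hy : C ^ 2 + y₁ ^ 2 + y₂ ^ 2 = 1) :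
    starS4 (boltPt t C y₁ y₂ n).1 (boltPt t C y₁ y₂ n).2 = -(boltPt t C y₁ y₂ n).2 := by
  have h := smul_antiForm_antisymm t C y₁ y₂ n
  refine ext_of_antisymm (starS4_transpose _ _) (fun i j => by simp [boltPt, h i j]) ?_
  intro i j hij
  fin_cases i <;> fin_cases j <;> simp at hij
  · refine (starS4_01 _ h).trans ?_; simp [boltPt, antiForm]; linear_combination t * n 2 * hy
  · refine (starS4_02 _ h).trans ?_; simp [boltPt, antiForm]; linear_combination -t * n 1 * hy
  · refine (starS4_03 _ h).trans ?_; simp [boltPt, antiForm]; ring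
  · refine (starS4_04 _ h).trans ?_; simp [boltPt, antiForm]; ring
  · refine (starS4_12 _ h).trans ?_; simp [boltPt, antiForm]; linear_combination t * n 0 * hy
  · refine (starS4_13 _ h).trans ?_; simp [boltPt, antiForm]; ring
  · refine (starS4_14 _ h).trans ?_; simp [boltPt, antiForm]; ring
  · refine (starS4_23 _ h).trans ?_; simp [boltPt, antiForm]; ring
  · refine (starS4_24 _ h).trans ?_; simp [boltPt, antiForm]; ring
  · refine (starS4_34 _ h).trans ?_; simp [boltPt, antiForm]; linear_combination -t * C * hn

lemma boltPt_mem_totalSpace {c : ℝ} (hn : n 0 ^ 2 + n 1 ^ 2 + n 2 ^ 2 = 1)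
    (hy : C ^ 2 + y₁ ^ 2 + y₂ ^ 2 = 1) (hc : 0 < c + t ^ 2) :
    boltPt t C y₁ y₂ n ∈ totalSpace c := by
  refine ⟨?_, ?_, ?_, starS4_antiForm hn hy, by rwa [radiusSq_boltPt hn hy]⟩
  · simp [boltPt, dotProduct, Fin.sum_univ_five]
    linear_combination C ^ 2 * hn + hy
  · ext i j; simpa [boltPt] using congrArg (t * ·) (antiForm_antisymm C y₁ y₂ n i j)
  · ext i
    fin_cases i <;>
    simp [boltPt, antiForm, Matrix.mulVec, dotProduct, Fin.sum_univ_five] 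
    all_goals first
      | ring1
      | linear_combination (-t * y₂ * C) * hn
      | linear_combination (t * y₁ * C) * hn

lemma fibration_boltPt {c : ℝ} (hn : n 0 ^ 2 + n 1 ^ 2 + n 2 ^ 2 = 1)
    (hy : C ^ 2 + y₁ ^ 2 + y₂ ^ 2 = 1) :
    fibration c (boltPt t C y₁ y₂ n) =
      !₂[t * C, 2 * quarterRoot c t * y₁, 2 * quarterRoot c t * y₂] := by
  rw [fibration, radiusSq_boltPt hn hy]
  simp [boltPt, antiForm, quarterRoot]

set_option maxHeartbeats 1000000 in
lemma rotField_boltPt_self : rotField n (boltPt t C y₁ y₂ n) = 0 := by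
  ext i j
  · fin_cases i <;> simp [rotField, boltPt, crossP, Matrix.mulVec, dotProduct, Fin.sum_univ_five]
    all_goals ring
  · simp only [rotField, boltPt, Matrix.sub_apply, Matrix.mul_apply, Fin.sum_univ_five,
      Matrix.smul_apply, smul_eq_mul]
    fin_cases i <;> fin_cases j <;> simp [crossP, antiForm]
    all_goals ring

/-- Rotations about coordinate axes detect the components of the vectors $Cn$ and $tn$, at least one
of which is nonzero. -/
lemma exists_rotField_boltPt_ne (hn : n 0 ^ 2 + n 1 ^ 2 + n 2 ^ 2 = 1) (h : t ≠ 0 ∨ C ≠ 0) :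
    ∃ e : Fin 3 → ℝ, rotField e (boltPt t C y₁ y₂ n) ≠ 0 := by
  by_contra! hall
  have h1 : ∀ e : Fin 3 → ℝ, ∀ i, (rotField e (boltPt t C y₁ y₂ n)).1 i = 0 := fun e i => by
    rw [hall e]; rfl
  have h2 : ∀ e : Fin 3 → ℝ, ∀ i j, (rotField e (boltPt t C y₁ y₂ n)).2 i j = 0 := fun e i j => by
    rw [hall e]; rfl
  have a0 := h1 ![0, 0, 1] 1
  have a1 := h1 ![0, 0, 1] 0
  have a2 := h1 ![0, 1, 0] 0
  have b0 := h2 ![0, 0, 1] 0 2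
  have b1 := h2 ![0, 0, 1] 1 2
  have b2 := h2 ![0, 1, 0] 1 2
  simp [rotField, boltPt, crossP, antiForm, Matrix.mul_apply, Matrix.mulVec, dotProduct,
    Fin.sum_univ_five] at a0 a1 a2 b0 b1 b2
  have hne : ¬(n 0 = 0 ∧ n 1 = 0 ∧ n 2 = 0) := by
    rintro ⟨e0, e1, e2⟩; simp [e0, e1, e2] at hn
  tauto

lemma boltPt_mem_bolt {c : ℝ} {x : E3} (hn : n 0 ^ 2 + n 1 ^ 2 + n 2 ^ 2 = 1)
    (hy : C ^ 2 + y₁ ^ 2 + y₂ ^ 2 = 1) (hc : 0 < c + t ^ 2) (h : t ≠ 0 ∨ C ≠ 0)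
    (hx : x = !₂[t * C, 2 * quarterRoot c t * y₁, 2 * quarterRoot c t * y₂]) :
    boltPt t C y₁ y₂ n ∈ bolt c x := by
  refine ⟨boltPt_mem_totalSpace hn hy hc, (fibration_boltPt hn hy).trans hx.symm, ⟨n, ?_, ?_⟩,
    exists_rotField_boltPt_ne hn h⟩
  · rintro rfl; simp at hn
  · exact rotField_boltPt_self

end

/-- The point of the bolt over `x` in the direction `n`, for a solution `(t, C)`. -/
noncomputable def boltOf (c : ℝ) (x : E3) (t C : ℝ) (n : Fin 3 → ℝ) : Ambient :=
  boltPt t C (x 1 / (2 * quarterRoot c t)) (x 2 / (2 * quarterRoot c t)) n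

lemma IsBoltSolution.sphere {c : ℝ} {x : E3} {t C : ℝ} (h : IsBoltSolution c x t C) :
    C ^ 2 + (x 1 / (2 * quarterRoot c t)) ^ 2 + (x 2 / (2 * quarterRoot c t)) ^ 2 = 1 := by
  have hq := quarterRoot_pos h.pos
  have := h.sq
  field_simp
  linear_combination this

lemma IsBoltSolution.boltOf_mem {c : ℝ} {x : E3} {t C : ℝ} (h : IsBoltSolution c x t C)
    {n : Fin 3 → ℝ} (hn : n 0 ^ 2 + n 1 ^ 2 + n 2 ^ 2 = 1) : boltOf c x t C n ∈ bolt c x := by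
  have hq := quarterRoot_pos h.pos
  refine boltPt_mem_bolt hn h.sphere h.pos h.ne ?_
  ext i; fin_cases i
  · simp [h.mul]
  · simp; field_simp
  · simp; field_simp

lemma parallel_of_cross_eq_zero {n a : Fin 3 → ℝ} (hn : n 0 ^ 2 + n 1 ^ 2 + n 2 ^ 2 = 1)
    (h0 : n 1 * a 2 - n 2 * a 1 = 0) (h1 : n 2 * a 0 - n 0 * a 2 = 0)
    (h2 : n 0 * a 1 - n 1 * a 0 = 0) :
    a 0 = (n 0 * a 0 + n 1 * a 1 + n 2 * a 2) * n 0 ∧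
    a 1 = (n 0 * a 0 + n 1 * a 1 + n 2 * a 2) * n 1 ∧
    a 2 = (n 0 * a 0 + n 1 * a 1 + n 2 * a 2) * n 2 := by
  refine ⟨?_, ?_, ?_⟩
  · linear_combination (-a 0) * hn - n 1 * h2 + n 2 * h1
  · linear_combination (-a 1) * hn + n 0 * h2 - n 2 * h0
  · linear_combination (-a 2) * hn - n 0 * h1 + n 1 * h0

lemma exists_unit_rotField {m : Ambient} {e : Fin 3 → ℝ} (he : e ≠ 0) (h : rotField e m = 0) :
    ∃ n : Fin 3 → ℝ, n 0 ^ 2 + n 1 ^ 2 + n 2 ^ 2 = 1 ∧ rotField n m = 0 := by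
  have hpos : 0 < e 0 ^ 2 + e 1 ^ 2 + e 2 ^ 2 := by
    by_contra! hle
    refine he (funext fun i => ?_)
    fin_cases i <;> simp <;> nlinarith [sq_nonneg (e 0), sq_nonneg (e 1), sq_nonneg (e 2)]
  set r := Real.sqrt (e 0 ^ 2 + e 1 ^ 2 + e 2 ^ 2)
  have hr : 0 < r := Real.sqrt_pos.2 hpos
  have hr2 : r ^ 2 = e 0 ^ 2 + e 1 ^ 2 + e 2 ^ 2 := Real.sq_sqrt hpos.le
  refine ⟨r⁻¹ • e, ?_, ?_⟩
  · simp only [Pi.smul_apply, smul_eq_mul]; field_simp; exact hr2.symm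
  · have hcr : crossP (r⁻¹ • e) = r⁻¹ • crossP e := by
      ext i j; fin_cases i <;> fin_cases j <;> simp [crossP]
    have : rotField (r⁻¹ • e) m = r⁻¹ • rotField e m := by
      ext i j
      · simp [rotField, hcr, Matrix.smul_mulVec]
      · simp [rotField, hcr, mul_sub]
    rw [this, h, smul_zero]

/-- Under rotations about $n$ the $P$-part of $p$, the $P$-block of $\omega$ read as a vector, and
the two mixed columns of $\omega$ are four invariant vectors of $P$, hence multiples of $n$.
Anti-self-duality expresses the remaining coefficients through the first two. -/
lemma exists_of_mem_bolt {c : ℝ} {x : E3} {m : Ambient} (hm : m ∈ bolt c x) :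
    ∃ (n : Fin 3 → ℝ) (t C : ℝ), n 0 ^ 2 + n 1 ^ 2 + n 2 ^ 2 = 1 ∧ IsBoltSolution c x t C ∧
      m = boltOf c x t C n := by
  obtain ⟨⟨hp, hanti, -, hstar, hpos⟩, hfib, ⟨e, he, hrot⟩, e', he'⟩ := hm
  obtain ⟨n, hn, hrot⟩ := exists_unit_rotField he hrot
  obtain ⟨p, om⟩ := m
  simp only at hp hanti hstar
  have h : ∀ i j, om j i = -om i j := fun i j => by
    simpa using congrFun (congrFun hanti i) j
  have hd : ∀ i, om i i = 0 := fun i => by linarith [h i i]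
  have h1 : ∀ i, (rotField n (p, om)).1 i = 0 := fun i => by rw [hrot]; rfl
  have h2 : ∀ i j, (rotField n (p, om)).2 i j = 0 := fun i j => by rw [hrot]; rfl
  have hS : ∀ i j, starS4 p om i j = -om i j := fun i j => by rw [hstar]; rfl
  have p0 := h1 0
  have p1 := h1 1
  have p2 := h1 2
  have a0 := h2 0 1
  have a1 := h2 0 2
  have a2 := h2 1 2
  simp only [rotField, crossP, Matrix.mul_apply, Matrix.mulVec, dotProduct, Fin.sum_univ_five,
    Matrix.sub_apply] at p0 p1 p2 a0 a1 a2
  simp [hd, h 0 1, h 0 2, h 1 2] at p0 p1 p2 a0 a1 a2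
  -- Vanishing of the infinitesimal rotation means that the cross product with $n$ is zero.
  obtain ⟨P0, P1, P2⟩ := parallel_of_cross_eq_zero (a := ![p 0, p 1, p 2]) hn
    (by simp; linarith) (by simp; linarith) (by simp; linarith)
  obtain ⟨A0, A1, A2⟩ := parallel_of_cross_eq_zero (a := ![-om 1 2, om 0 2, -om 0 1]) hn
    (by simp; linarith) (by simp; linarith) (by simp; linarith)
  simp at P0 P1 P2 A0 A1 A2
  set C := n 0 * p 0 + n 1 * p 1 + n 2 * p 2
  set t := -(n 0 * om 1 2) + n 1 * om 0 2 + -(n 2 * om 0 1)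
  have c03 := h2 0 3
  have c13 := h2 1 3
  have c23 := h2 2 3
  have c04 := h2 0 4
  have c14 := h2 1 4
  have c24 := h2 2 4
  simp only [rotField, crossP, Matrix.mul_apply, Fin.sum_univ_five, Matrix.sub_apply]
    at c03 c13 c23 c04 c14 c24
  simp at c03 c13 c23 c04 c14 c24
  obtain ⟨B0, B1, B2⟩ := parallel_of_cross_eq_zero (a := ![om 0 3, om 1 3, om 2 3]) hn
    (by simp; linarith) (by simp; linarith) (by simp; linarith)
  obtain ⟨D0, D1, D2⟩ := parallel_of_cross_eq_zero (a := ![om 0 4, om 1 4, om 2 4]) hn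
    (by simp; linarith) (by simp; linarith) (by simp; linarith)
  simp at B0 B1 B2 D0 D1 D2
  set b := n 0 * om 0 3 + n 1 * om 1 3 + n 2 * om 2 3
  set d := n 0 * om 0 4 + n 1 * om 1 4 + n 2 * om 2 4
  have A0' : om 1 2 = -(t * n 0) := by linarith
  have A2' : om 0 1 = -(t * n 2) := by linarith
  have s34 := hS 3 4
  have s03 := hS 0 3
  have s13 := hS 1 3
  have s23 := hS 2 3
  have s04 := hS 0 4
  have s14 := hS 1 4
  have s24 := hS 2 4
  -- With everything parallel to $n$, the star equations give the mixed columns $ty_2\,n$ and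
  -- $-ty_1\,n$ and the last entry $tC$.
  rw [starS4_34 _ h, A0', A1, A2', P0, P1, P2] at s34
  rw [starS4_03 _ h, A0', P1, P2, D1, D2] at s03
  rw [starS4_13 _ h, A1, P0, P2, D0, D2] at s13
  rw [starS4_23 _ h, A2', P0, P1, D0, D1] at s23
  rw [starS4_04 _ h, A0', P1, P2, B1, B2] at s04
  rw [starS4_14 _ h, A1, P0, P2, B0, B2] at s14
  rw [starS4_24 _ h, A2', P0, P1, B0, B1] at s24
  have hm : (p, om) = boltPt t C (p 3) (p 4) n := by
    refine Prod.ext ?_ ?_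
    · ext i; fin_cases i <;> simp [boltPt] <;> assumption
    · refine ext_of_antisymm h (smul_antiForm_antisymm _ _ _ _ _) ?_
      intro i j hij
      fin_cases i <;> fin_cases j <;> simp at hij <;> simp [boltPt, antiForm]
      · exact A2'
      · exact A1
      · linarith
      · linarith
      · exact A0'
      · linarith
      · linarith
      · linarith
      · linarith
      · linear_combination s34 + (t * C) * hn
  have hy : C ^ 2 + p 3 ^ 2 + p 4 ^ 2 = 1 := by
    simp only [dotProduct, Fin.sum_univ_five] at hp
    rw [P0, P1, P2] at hp
    linear_combination hp - C ^ 2 * hn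
  rw [hm, radiusSq_boltPt hn hy] at hpos
  rw [hm, fibration_boltPt hn hy] at hfib
  have hq := quarterRoot_pos hpos
  have x0 : x 0 = t * C := by rw [← hfib]; simp
  have x1 : x 1 = 2 * quarterRoot c t * p 3 := by rw [← hfib]; simp
  have x2 : x 2 = 2 * quarterRoot c t * p 4 := by rw [← hfib]; simp
  refine ⟨n, t, C, hn, ⟨x0.symm, ?_, hpos, ?_⟩, ?_⟩
  · rw [x1, x2]; linear_combination 4 * quarterRoot c t ^ 2 * hy
  -- If $t=C=0$ the point is fixed by all of $SO(3)$, which the second isotropy condition excludes.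
  · by_contra! h0
    refine he' ?_
    rw [hm, h0.1, h0.2]
    ext i j
    · fin_cases i <;> simp [rotField, boltPt, crossP, Matrix.mulVec, dotProduct, Fin.sum_univ_five]
    · simp [rotField, boltPt]
  · rw [hm, boltOf, x1, x2]
    congr 1 <;> field_simp

/-! ### Equivariance and the normal form of a trivialization -/

/-- The $P$-block of $\Omega_1$ is a cross-product matrix, which conjugation by $A$ transforms
through the cofactors of $A$. For rotations these are the entries of $A$. -/
lemma specialOrthogonal_cofactor {A : Matrix (Fin 3) (Fin 3) ℝ}
    (hA : A ∈ Matrix.specialOrthogonalGroup (Fin 3) ℝ) : A.adjugate = Aᵀ := by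
  obtain ⟨h1, h2⟩ := Matrix.mem_specialOrthogonalGroup_iff.1 hA
  have h3 : Aᵀ * A = 1 := (Matrix.mem_orthogonalGroup_iff' _ _).1 h1
  calc A.adjugate = (Aᵀ * A) * A.adjugate := by rw [h3, one_mul]
    _ = Aᵀ := by rw [Matrix.mul_assoc, Matrix.mul_adjugate, h2, one_smul, mul_one]

lemma specialOrthogonal_norm {A : Matrix (Fin 3) (Fin 3) ℝ}
    (hA : A ∈ Matrix.specialOrthogonalGroup (Fin 3) ℝ) (n : Fin 3 → ℝ) :
    (A *ᵥ n) 0 ^ 2 + (A *ᵥ n) 1 ^ 2 + (A *ᵥ n) 2 ^ 2 = n 0 ^ 2 + n 1 ^ 2 + n 2 ^ 2 := by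
  have h3 : Aᵀ * A = 1 :=
    (Matrix.mem_orthogonalGroup_iff' _ _).1 (Matrix.mem_specialOrthogonalGroup_iff.1 hA).1
  have h : (A *ᵥ n) ⬝ᵥ (A *ᵥ n) = n ⬝ᵥ n := by
    rw [Matrix.dotProduct_mulVec, ← Matrix.mulVec_transpose, Matrix.mulVec_mulVec, h3,
      Matrix.one_mulVec]
  simp only [dotProduct, Fin.sum_univ_three] at h
  linarith

/-- The mixed columns rotate as vectors. The $P$-block needs the cofactor identity, and therefore
$\det A=1$. -/
lemma rotAct_boltPt {A : Matrix (Fin 3) (Fin 3) ℝ}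
    (hA : A ∈ Matrix.specialOrthogonalGroup (Fin 3) ℝ) (t C y₁ y₂ : ℝ) (n : Fin 3 → ℝ) :
    rotAct A (boltPt t C y₁ y₂ n) = boltPt t C y₁ y₂ (A *ᵥ n) := by
  have hadj := specialOrthogonal_cofactor hA
  rw [Matrix.adjugate_fin_three] at hadj
  have hc : ∀ i j, A j i = _ := fun i j => (congrFun (congrFun hadj i) j).symm
  have c00 := hc 0 0
  have c01 := hc 0 1
  have c02 := hc 0 2
  have c10 := hc 1 0
  have c11 := hc 1 1
  have c12 := hc 1 2
  have c20 := hc 2 0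
  have c21 := hc 2 1
  have c22 := hc 2 2
  simp at c00 c01 c02 c10 c11 c12 c20 c21 c22
  clear hc hadj hA
  refine Prod.ext ?_ ?_
  · ext i
    simp only [rotAct, boltPt, Matrix.mulVec, dotProduct, Fin.sum_univ_five, Fin.sum_univ_three]
    fin_cases i <;> simp [extendP]
    all_goals ring
  · have h0 := smul_antiForm_antisymm t C y₁ y₂ n
    refine ext_of_antisymm ?_ (smul_antiForm_antisymm _ _ _ _ _) ?_
    · intro i j
      have hT : (t • antiForm C y₁ y₂ n)ᵀ = -(t • antiForm C y₁ y₂ n) := by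
        ext i j; simpa using h0 i j
      have : (rotAct A (boltPt t C y₁ y₂ n)).2ᵀ = -(rotAct A (boltPt t C y₁ y₂ n)).2 := by
        simp only [rotAct, boltPt, Matrix.transpose_mul, Matrix.transpose_transpose, hT]
        simp [Matrix.mul_assoc]
      simpa using congrFun (congrFun this i) j
    · intro i j hij
      simp only [rotAct, boltPt, Matrix.mul_apply, Fin.sum_univ_five, Matrix.transpose_apply,
        Matrix.smul_apply, smul_eq_mul]
      fin_cases i <;> fin_cases j <;> simp at hij <;>
        simp [extendP, antiForm, Matrix.mulVec, dotProduct, Fin.sum_univ_three]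
      · linear_combination (t * n 0) * c02 + (t * n 1) * c12 + (t * n 2) * c22
      · linear_combination -(t * n 0) * c01 - (t * n 1) * c11 - (t * n 2) * c21
      · ring
      · ring
      · linear_combination (t * n 0) * c00 + (t * n 1) * c10 + (t * n 2) * c20
      · ring
      · ring
      · ring
      · ring

lemma rotAct_boltOf {A : Matrix (Fin 3) (Fin 3) ℝ}
    (hA : A ∈ Matrix.specialOrthogonalGroup (Fin 3) ℝ) (c : ℝ) (x : E3) (t C : ℝ)
    (n : Fin 3 → ℝ) : rotAct A (boltOf c x t C n) = boltOf c x t C (A *ᵥ n) :=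
  rotAct_boltPt hA ..

lemma boltOf_neg (c : ℝ) (x : E3) (t C : ℝ) (n : Fin 3 → ℝ) :
    boltOf c x (-t) (-C) n = boltOf c x t C (-n) := by
  rw [boltOf, boltOf, quarterRoot_neg]
  refine Prod.ext ?_ ?_
  · ext i; fin_cases i <;> simp [boltPt]
  · ext i j; fin_cases i <;> fin_cases j <;> simp [boltPt, antiForm]

/-- The vectors $Cn$ and $tn$ are both entries of the point, and one of the scalars is nonzero. -/
lemma boltOf_injective {c : ℝ} {x : E3} {t C : ℝ} (h : t ≠ 0 ∨ C ≠ 0) :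
    Function.Injective (boltOf c x t C) := by
  intro n n' hnn
  have a0 := congrFun (congrArg Prod.fst hnn) 0
  have a1 := congrFun (congrArg Prod.fst hnn) 1
  have a2 := congrFun (congrArg Prod.fst hnn) 2
  have b0 := congrFun (congrFun (congrArg Prod.snd hnn) 2) 1
  have b1 := congrFun (congrFun (congrArg Prod.snd hnn) 0) 2
  have b2 := congrFun (congrFun (congrArg Prod.snd hnn) 1) 0
  simp [boltOf, boltPt, antiForm] at a0 a1 a2 b0 b1 b2
  funext i
  fin_cases i <;> simp <;> tauto

/-- The rotation by the angle `π` about `m`. -/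
def halfTurn (m : Fin 3 → ℝ) : Matrix (Fin 3) (Fin 3) ℝ :=
  !![2 * m 0 * m 0 - 1, 2 * m 0 * m 1, 2 * m 0 * m 2;
     2 * m 1 * m 0, 2 * m 1 * m 1 - 1, 2 * m 1 * m 2;
     2 * m 2 * m 0, 2 * m 2 * m 1, 2 * m 2 * m 2 - 1]

lemma halfTurn_mem {m : Fin 3 → ℝ} (hm : m 0 ^ 2 + m 1 ^ 2 + m 2 ^ 2 = 1) :
    halfTurn m ∈ Matrix.specialOrthogonalGroup (Fin 3) ℝ := by
  rw [Matrix.mem_specialOrthogonalGroup_iff, Matrix.mem_orthogonalGroup_iff]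
  constructor
  · ext i j
    fin_cases i <;> fin_cases j <;> simp [halfTurn, Matrix.mul_apply, Fin.sum_univ_three]
    · linear_combination 4 * m 0 ^ 2 * hm
    · linear_combination 4 * m 0 * m 1 * hm
    · linear_combination 4 * m 0 * m 2 * hm
    · linear_combination 4 * m 0 * m 1 * hm
    · linear_combination 4 * m 1 ^ 2 * hm
    · linear_combination 4 * m 1 * m 2 * hm
    · linear_combination 4 * m 0 * m 2 * hm
    · linear_combination 4 * m 1 * m 2 * hm
    · linear_combination 4 * m 2 ^ 2 * hm
  · simp [halfTurn, Matrix.det_fin_three]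
    linear_combination 2 * hm

/-- The half turn about the bisector of $e_0$ and $n$ exchanges the two. The bisector is undefined
for $n=-e_0$, where any perpendicular axis serves. -/
lemma exists_rotation {n : Fin 3 → ℝ} (hn : n 0 ^ 2 + n 1 ^ 2 + n 2 ^ 2 = 1) :
    ∃ A ∈ Matrix.specialOrthogonalGroup (Fin 3) ℝ, A *ᵥ ![1, 0, 0] = n := by
  by_cases h : n 0 = -1
  · have h12 : n 1 ^ 2 + n 2 ^ 2 = 0 := by rw [h] at hn; linarith
    have h1 : n 1 = 0 := by nlinarith [sq_nonneg (n 1), sq_nonneg (n 2)]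
    have h2 : n 2 = 0 := by nlinarith [sq_nonneg (n 1), sq_nonneg (n 2)]
    refine ⟨halfTurn ![0, 0, 1], halfTurn_mem (by simp), ?_⟩
    ext i; fin_cases i <;> simp [halfTurn, h, h1, h2]
  · have hlt : 0 < 1 + n 0 := by
      have : -1 ≤ n 0 := by nlinarith [sq_nonneg (n 1), sq_nonneg (n 2)]
      have := lt_of_le_of_ne this (Ne.symm h)
      linarith
    -- This is the length of $e_0+n$.
    set r := Real.sqrt (2 * (1 + n 0))
    have hr : 0 < r := Real.sqrt_pos.2 (by linarith)
    have hr2 : r ^ 2 = 2 * (1 + n 0) := Real.sq_sqrt (by linarith)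
    refine ⟨halfTurn ![(1 + n 0) / r, n 1 / r, n 2 / r], halfTurn_mem ?_, ?_⟩
    · simp; field_simp; linear_combination hn - hr2
    · ext i; fin_cases i <;> simp [halfTurn] <;> field_simp <;> rw [hr2] <;> ring

/-- The components of a unit vector along `n`. -/
noncomputable def unitVec (n : E3) : Fin 3 → ℝ := (‖n‖⁻¹ • n).ofLp

lemma norm_sq_eq_sum (n : E3) : ‖n‖ ^ 2 = n 0 ^ 2 + n 1 ^ 2 + n 2 ^ 2 := by
  rw [EuclideanSpace.norm_sq_eq, Fin.sum_univ_three]; simp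

lemma unitVec_sq {n : E3} (hn : n ≠ 0) :
    unitVec n 0 ^ 2 + unitVec n 1 ^ 2 + unitVec n 2 ^ 2 = 1 := by
  have h : ‖n‖ ≠ 0 := norm_ne_zero_iff.2 hn
  simp only [unitVec, WithLp.ofLp_smul, Pi.smul_apply, smul_eq_mul]
  field_simp
  exact (norm_sq_eq_sum n).symm

lemma unitVec_of_norm {n : E3} (hn : ‖n‖ = 1) : unitVec n = n.ofLp := by
  simp [unitVec, hn]

lemma unitVec_smul (n : E3) {r : ℝ} (hr : 0 < r) : unitVec (r • n) = unitVec n := by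
  rw [unitVec, unitVec, norm_smul, smul_smul, Real.norm_of_nonneg hr.le]
  congr 2
  field_simp

/-- The half turn about $e_0$ fixes $e_0$, so by equivariance it fixes the image point. The axis of
that point is then $\pm e_0$, and the sign can be moved into $(t,C)$. -/
lemma exists_boltOf_stdVec {c : ℝ} {W : Set E3} {F : E3 → E3 → Ambient}
    (hF : IsBoltTrivialization c W F) {x : E3} (hx : x ∈ W) :
    ∃ t C, IsBoltSolution c x t C ∧ F x (stdVec 0) = boltOf c x t C ![1, 0, 0] := by
  have hs : stdVec 0 ∈ Metric.sphere (0 : E3) 1 := by simp [stdVec]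
  have hs0 : stdVec 0 ≠ 0 := by
    intro h; rw [h] at hs; simp at hs
  obtain ⟨n, t, C, hn, hsol, hFn⟩ := exists_of_mem_bolt ((hF.bijOn x hx).mapsTo hs)
  have hmem : halfTurn ![1, 0, 0] ∈ Matrix.specialOrthogonalGroup (Fin 3) ℝ :=
    halfTurn_mem (by simp)
  have heq := hF.equivariant x hx _ hmem _ hs0
  have hfix : WithLp.toLp 2 (halfTurn ![1, 0, 0] *ᵥ (stdVec 0).ofLp) = stdVec 0 := by
    ext i; fin_cases i <;> norm_num [halfTurn, stdVec]
    rfl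
  rw [hfix, hFn, rotAct_boltOf hmem] at heq
  have hinj := boltOf_injective hsol.ne heq
  have h1 := congrFun hinj 1
  have h2 := congrFun hinj 2
  simp [halfTurn, Matrix.mulVec, dotProduct, Fin.sum_univ_three] at h1 h2
  have h1 : n 1 = 0 := by linarith
  have h2 : n 2 = 0 := by linarith
  rw [h1, h2] at hn
  rcases sq_eq_sq_iff_eq_or_eq_neg.1 (show n 0 ^ 2 = 1 ^ 2 by linarith) with h | h
  · refine ⟨t, C, hsol, ?_⟩
    rw [hFn]; congr 1
    ext i; fin_cases i <;> simp [h, h1, h2]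
  · refine ⟨-t, -C, hsol.neg, ?_⟩
    rw [hFn, boltOf_neg]; congr 1
    ext i; fin_cases i <;> simp [h, h1, h2]

theorem IsBoltTrivialization.exists_normalForm {c : ℝ} {W : Set E3} {F : E3 → E3 → Ambient}
    (hF : IsBoltTrivialization c W F) :
    ∃ t C : E3 → ℝ, ContDiffOn ℝ ∞ t W ∧ ContDiffOn ℝ ∞ C W ∧
      ∀ x ∈ W, IsBoltSolution c x (t x) (C x) ∧
        ∀ n : E3, n ≠ 0 → F x n = boltOf c x (t x) (C x) (unitVec n) := by
  have hs0 : stdVec 0 ≠ 0 := by simp [stdVec]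
  have hsm : ContDiffOn ℝ ∞ (fun x => F x (stdVec 0)) W :=
    hF.smooth.comp (contDiff_id.prodMk contDiff_const).contDiffOn fun x hx => ⟨hx, hs0⟩
  -- At $n=e_0$ the $(1,2)$ entry of $\Omega_1$ is $-1$ and the first coordinate of the base point
  -- is $C$. So $t$ and $C$ are components of the smooth map $F(\cdot,e_0)$.
  refine ⟨fun x => -(F x (stdVec 0)).2 1 2, fun x => (F x (stdVec 0)).1 0, ?_, ?_, ?_⟩
  · have h2 : ContDiffOn ℝ ∞ (fun x => (F x (stdVec 0)).2) W := hsm.snd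
    exact (contDiffOn_pi.1 (contDiffOn_pi.1 h2 1) 2).neg
  · exact contDiffOn_pi.1 hsm.fst 0
  · intro x hx
    obtain ⟨t, C, hsol, hFx⟩ := exists_boltOf_stdVec hF hx
    have ht : -(F x (stdVec 0)).2 1 2 = t := by rw [hFx]; simp [boltOf, boltPt, antiForm]
    have hC : (F x (stdVec 0)).1 0 = C := by rw [hFx]; simp [boltOf, boltPt]
    simp only [ht, hC]
    refine ⟨hsol, fun n hn => ?_⟩
    obtain ⟨A, hA, hAn⟩ := exists_rotation (unitVec_sq hn)
    have h0 := hF.equivariant x hx A hA _ hs0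
    have h1 : WithLp.toLp 2 (A *ᵥ (stdVec 0).ofLp) = ‖n‖⁻¹ • n := by
      have : (stdVec 0).ofLp = ![1, 0, 0] := by ext i; fin_cases i <;> simp [stdVec]
      rw [this, hAn]; rfl
    rw [h1, hF.ray x hx n hn _ (inv_pos.2 (norm_pos_iff.2 hn)), hFx, rotAct_boltOf hA, hAn] at h0
    exact h0

/-! ### Existence of trivializations -/

lemma ContDiffOn.quarterRoot {E : Type*} [NormedAddCommGroup E] [NormedSpace ℝ E] {c : ℝ}
    {t : E → ℝ} {s : Set E} (ht : ContDiffOn ℝ ∞ t s) (h : ∀ x ∈ s, 0 < c + t x ^ 2) :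
    ContDiffOn ℝ ∞ (fun x => quarterRoot c (t x)) s :=
  (contDiffOn_const.add (ht.pow 2)).rpow_const_of_ne fun x hx => (h x hx).ne'

lemma contDiffOn_unitVec (i : Fin 3) : ContDiffOn ℝ ∞ (fun n : E3 => unitVec n i) {0}ᶜ := by
  have h : ContDiffOn ℝ ∞ (fun n : E3 => ‖n‖⁻¹ * n i) {0}ᶜ := by
    refine ContDiffOn.mul (ContDiffOn.inv (fun n hn => ?_) fun n hn => norm_ne_zero_iff.2 hn) ?_
    · exact (contDiffAt_norm ℝ hn).contDiffWithinAt
    · exact ContDiff.contDiffOn (by fun_prop)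
  exact h

lemma contDiffOn_boltOf {c : ℝ} {W : Set E3} {t C : E3 → ℝ} (ht : ContDiffOn ℝ ∞ t W)
    (hC : ContDiffOn ℝ ∞ C W) (h : ∀ x ∈ W, IsBoltSolution c x (t x) (C x)) :
    ContDiffOn ℝ ∞ (fun z : E3 × E3 => boltOf c z.1 (t z.1) (C z.1) (unitVec z.2))
      (W ×ˢ {0}ᶜ) := by
  have hq := ht.quarterRoot (c := c) fun x hx => (h x hx).pos
  have hfst : ∀ f : E3 → ℝ, ContDiffOn ℝ ∞ f W →
      ContDiffOn ℝ ∞ (fun z : E3 × E3 => f z.1) (W ×ˢ {0}ᶜ) := fun f hf =>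
    hf.comp contDiff_fst.contDiffOn fun z hz => hz.1
  have hn : ∀ i, ContDiffOn ℝ ∞ (fun z : E3 × E3 => unitVec z.2 i) (W ×ˢ {0}ᶜ) := fun i =>
    (contDiffOn_unitVec i).comp contDiff_snd.contDiffOn fun z hz => hz.2
  have hy : ∀ i : Fin 3, ContDiffOn ℝ ∞ (fun z : E3 × E3 => z.1 i / (2 * quarterRoot c (t z.1)))
      (W ×ˢ {0}ᶜ) := fun i => by
    refine hfst (fun x => x i / (2 * quarterRoot c (t x))) ?_
    refine ContDiffOn.div (ContDiff.contDiffOn (by fun_prop)) (contDiffOn_const.mul hq) ?_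
    intro x hx
    have := quarterRoot_pos (h x hx).pos
    positivity
  have ht' := hfst t ht
  have hC' := hfst C hC
  refine ContDiffOn.prodMk ?_ ?_
  · refine contDiffOn_pi.2 fun i => ?_
    fin_cases i
    · exact hC'.mul (hn 0)
    · exact hC'.mul (hn 1)
    · exact hC'.mul (hn 2)
    · exact hy 1
    · exact hy 2
  · refine contDiffOn_pi.2 fun i => contDiffOn_pi.2 fun j => ht'.mul ?_
    fin_cases i <;> fin_cases j
    all_goals first
      | exact contDiffOn_const
      | exact hC'
      | exact hC'.neg
      | exact hn _
      | exact (hn _).neg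
      | exact (hn _).mul (hy _)
      | exact ((hn _).mul (hy _)).neg

theorem isBoltTrivialization_boltOf {c : ℝ} (hc : 0 ≤ c) {W : Set E3} (hW : IsOpen W)
    {t C : E3 → ℝ} (ht : ContDiffOn ℝ ∞ t W) (hC : ContDiffOn ℝ ∞ C W)
    (h : ∀ x ∈ W, IsBoltSolution c x (t x) (C x)) :
    IsBoltTrivialization c W fun x n => boltOf c x (t x) (C x) (unitVec n) where
  isOpen := hW
  smooth := contDiffOn_boltOf ht hC h
  ray x _ n _ r hr := by simp only [unitVec_smul n hr]
  bijOn x hx := by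
    have hne : ∀ n ∈ Metric.sphere (0 : E3) 1, n ≠ 0 := fun n hn h0 => by
      rw [h0] at hn; simp at hn
    refine ⟨fun n hn => (h x hx).boltOf_mem (unitVec_sq (hne n hn)), fun n hn n' hn' hnn => ?_, ?_⟩
    · have := boltOf_injective (h x hx).ne hnn
      rw [unitVec_of_norm (by simpa using hn), unitVec_of_norm (by simpa using hn')] at this
      exact WithLp.ofLp_injective 2 this
    · intro m hm
      obtain ⟨n, t', C', hn, hsol, rfl⟩ := exists_of_mem_bolt hm
      have key : ∀ n' : Fin 3 → ℝ, n' 0 ^ 2 + n' 1 ^ 2 + n' 2 ^ 2 = 1 →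
          boltOf c x (t x) (C x) n' ∈
            (fun n => boltOf c x (t x) (C x) (unitVec n)) '' Metric.sphere (0 : E3) 1 := by
        intro n' hn'
        have h1 : ‖WithLp.toLp 2 n'‖ = 1 := by
          rw [← sq_eq_sq₀ (norm_nonneg _) zero_le_one, norm_sq_eq_sum]; simpa using hn'
        refine ⟨WithLp.toLp 2 n', by simpa using h1, ?_⟩
        simp only [unitVec_of_norm h1]
      -- A point described by the opposite solution is the point of the chosen one in direction
      -- $-n$, so every point of the bolt is reached.
      rcases (h x hx).eq_or_eq_neg hc hsol with ⟨h1, h2⟩ | ⟨h1, h2⟩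
      · rw [h1, h2]; exact key n hn
      · rw [h1, h2, boltOf_neg]; exact key (-n) (by simpa using hn)
  equivariant x hx A hA n hn := by
    rw [rotAct_boltOf hA]
    congr 1
    have hnorm : ‖WithLp.toLp 2 (A *ᵥ n.ofLp)‖ = ‖n‖ := by
      rw [← sq_eq_sq₀ (norm_nonneg _) (norm_nonneg _), norm_sq_eq_sum, norm_sq_eq_sum]
      exact specialOrthogonal_norm hA n.ofLp
    rw [unitVec, unitVec, hnorm, WithLp.ofLp_smul, WithLp.ofLp_smul, Matrix.mulVec_smul]

/-! ### The two regions of the base and their smooth solutions -/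

lemma radialV_nonneg (x : E3) : 0 ≤ radialV x := Real.sqrt_nonneg _

lemma radialV_sq (x : E3) : radialV x ^ 2 = x 1 ^ 2 + x 2 ^ 2 := Real.sq_sqrt (by positivity)

lemma two_mul_rpow_sq {c : ℝ} (hc : 0 ≤ c) : (2 * c ^ (1 / 4 : ℝ)) ^ 2 = 4 * Real.sqrt c := by
  rw [mul_pow, ← Real.rpow_mul_natCast hc, Real.sqrt_eq_rpow]; norm_num

lemma excess_eq {c : ℝ} (hc : 0 ≤ c) (x : E3) :
    excess c x = (radialV x ^ 2 - (2 * c ^ (1 / 4 : ℝ)) ^ 2) / 4 := by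
  rw [excess, radialV_sq, two_mul_rpow_sq hc]; ring

lemma radialV_lt_iff {c : ℝ} (hc : 0 ≤ c) (x : E3) :
    radialV x < 2 * c ^ (1 / 4 : ℝ) ↔ excess c x < 0 := by
  rw [excess_eq hc, ← sq_lt_sq₀ (radialV_nonneg x) (by positivity)]
  constructor <;> intro h <;> linarith

lemma lt_radialV_iff {c : ℝ} (hc : 0 ≤ c) (x : E3) :
    2 * c ^ (1 / 4 : ℝ) < radialV x ↔ 0 < excess c x := by
  rw [excess_eq hc, ← sq_lt_sq₀ (by positivity) (radialV_nonneg x)]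
  constructor <;> intro h <;> linarith

lemma radialV_eq_iff {c : ℝ} (hc : 0 ≤ c) (x : E3) :
    radialV x = 2 * c ^ (1 / 4 : ℝ) ↔ excess c x = 0 := by
  rw [excess_eq hc, ← sq_eq_sq₀ (radialV_nonneg x) (by positivity)]
  constructor <;> intro h <;> linarith

lemma mem_singularCircle_iff {c : ℝ} (hc : 0 ≤ c) (x : E3) :
    x ∈ singularCircle c ↔ x 0 = 0 ∧ excess c x = 0 := by
  rw [← radialV_eq_iff hc]; rfl

lemma isOpen_innerRegion {c : ℝ} (hc : 0 ≤ c) :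
    IsOpen {x : E3 | x 0 ≠ 0 ∨ radialV x < 2 * c ^ (1 / 4 : ℝ)} := by
  simp_rw [radialV_lt_iff hc]
  exact (isOpen_ne_fun (by fun_prop) continuous_const).union
    (isOpen_lt (contDiff_excess c).continuous continuous_const)

lemma isOpen_outerRegion {c : ℝ} (hc : 0 ≤ c) :
    IsOpen {x : E3 | x 0 ≠ 0 ∨ 2 * c ^ (1 / 4 : ℝ) < radialV x} := by
  simp_rw [lt_radialV_iff hc]
  exact (isOpen_ne_fun (by fun_prop) continuous_const).union
    (isOpen_lt continuous_const (contDiff_excess c).continuous)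

/-- Here $X-d>0$, so $C^2=(X-d)/(X+\sqrt c)$ has a smooth positive root, and $t=u/C$. -/
theorem exists_solution_innerRegion {c : ℝ} (hc : 0 ≤ c) :
    ∃ t C : E3 → ℝ, ContDiffOn ℝ ∞ t {x | x 0 ≠ 0 ∨ radialV x < 2 * c ^ (1 / 4 : ℝ)} ∧
      ContDiffOn ℝ ∞ C {x | x 0 ≠ 0 ∨ radialV x < 2 * c ^ (1 / 4 : ℝ)} ∧
      ∀ x ∈ {x : E3 | x 0 ≠ 0 ∨ radialV x < 2 * c ^ (1 / 4 : ℝ)},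
        IsBoltSolution c x (t x) (C x) := by
  set W : Set E3 := {x | x 0 ≠ 0 ∨ radialV x < 2 * c ^ (1 / 4 : ℝ)}
  have hs := Real.sqrt_nonneg c
  have hmem : ∀ x ∈ W, x 0 ≠ 0 ∨ excess c x < 0 := fun x hx => by
    rwa [← radialV_lt_iff hc]
  have hroot : ∀ x ∈ W, IsExcessRoot c x (excessRoot c x) := fun x hx =>
    isExcessRoot_excessRoot ((hmem x hx).imp_right ne_of_lt)
  have hXs : ContDiffOn ℝ ∞ (excessRoot c) W := fun x hx =>
    (contDiffAt_excessRoot ((hmem x hx).imp_right ne_of_lt)).contDiffWithinAt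
  have hZ : ∀ x ∈ W, 0 < excessRoot c x - excess c x := fun x hx => by
    have hr := hroot x hx
    rcases hmem x hx with h | h
    · refine lt_of_le_of_ne (sub_nonneg.2 hr.le) fun h0 => ?_
      have := hr.eq
      rw [← h0] at this
      have hp := hr.pos
      have h2 : 0 < x 0 ^ 2 * (excessRoot c x + Real.sqrt c) := by positivity
      simp at this; rcases this with h3 | h3
      · exact h h3
      · linarith
    · linarith [hr.nonneg]
  have hK : ContDiffOn ℝ ∞
      (fun x => (excessRoot c x - excess c x) / (excessRoot c x + Real.sqrt c)) W :=
    (hXs.sub (contDiff_excess c).contDiffOn).div (hXs.add contDiffOn_const)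
      fun x hx => (hroot x hx).pos.ne'
  have hKpos : ∀ x ∈ W, 0 < (excessRoot c x - excess c x) / (excessRoot c x + Real.sqrt c) :=
    fun x hx => div_pos (hZ x hx) (hroot x hx).pos
  have hC : ContDiffOn ℝ ∞
      (fun x => √((excessRoot c x - excess c x) / (excessRoot c x + Real.sqrt c))) W :=
    hK.sqrt fun x hx => (hKpos x hx).ne'
  have hCpos := fun x hx => Real.sqrt_pos.2 (hKpos x hx)
  refine ⟨fun x => x 0 / √((excessRoot c x - excess c x) / (excessRoot c x + Real.sqrt c)), _,
    ContDiffOn.div (ContDiff.contDiffOn (by fun_prop)) hC fun x hx => (hCpos x hx).ne', hC, ?_⟩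
  intro x hx
  have hr := hroot x hx
  have hp := hr.pos
  have h2 := Real.sq_sqrt (hKpos x hx).le
  refine hr.isBoltSolution hc ?_ ?_ ?_
  · have h3 := hZ x hx
    rw [div_pow, h2]
    field_simp
    linear_combination -hr.eq
  · rw [h2]; field_simp
  · exact div_mul_cancel₀ _ (hCpos x hx).ne'

/-- Here $X>0$, so $t^2=X(X+2\sqrt c)$ has a smooth positive root, and $C=u/t$. The sign of $t$ is
recorded for the polar coordinates on this region. -/
theorem exists_solution_outerRegion {c : ℝ} (hc : 0 ≤ c) :
    ∃ t C : E3 → ℝ, ContDiffOn ℝ ∞ t {x | x 0 ≠ 0 ∨ 2 * c ^ (1 / 4 : ℝ) < radialV x} ∧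
      ContDiffOn ℝ ∞ C {x | x 0 ≠ 0 ∨ 2 * c ^ (1 / 4 : ℝ) < radialV x} ∧
      ∀ x ∈ {x : E3 | x 0 ≠ 0 ∨ 2 * c ^ (1 / 4 : ℝ) < radialV x},
        IsBoltSolution c x (t x) (C x) ∧ 0 < t x := by
  set W : Set E3 := {x | x 0 ≠ 0 ∨ 2 * c ^ (1 / 4 : ℝ) < radialV x}
  have hs := Real.sqrt_nonneg c
  have hmem : ∀ x ∈ W, x 0 ≠ 0 ∨ 0 < excess c x := fun x hx => by
    rwa [← lt_radialV_iff hc]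
  have hroot : ∀ x ∈ W, IsExcessRoot c x (excessRoot c x) := fun x hx =>
    isExcessRoot_excessRoot ((hmem x hx).imp_right ne_of_gt)
  have hXs : ContDiffOn ℝ ∞ (excessRoot c) W := fun x hx =>
    (contDiffAt_excessRoot ((hmem x hx).imp_right ne_of_gt)).contDiffWithinAt
  have hX : ∀ x ∈ W, 0 < excessRoot c x := fun x hx => by
    have hr := hroot x hx
    rcases hmem x hx with h | h
    · refine lt_of_le_of_ne hr.nonneg fun h0 => ?_
      have := hr.eq
      have hp := hr.pos
      have h2 : 0 < x 0 ^ 2 * (excessRoot c x + Real.sqrt c) := by positivity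
      rw [← this, ← h0] at h2
      simp at h2
    · linarith [hr.le]
  have hT : ContDiffOn ℝ ∞ (fun x => excessRoot c x * (excessRoot c x + 2 * Real.sqrt c)) W :=
    hXs.mul (hXs.add contDiffOn_const)
  have hTpos : ∀ x ∈ W, 0 < excessRoot c x * (excessRoot c x + 2 * Real.sqrt c) := fun x hx => by
    have := hX x hx
    positivity
  have ht : ContDiffOn ℝ ∞ (fun x => √(excessRoot c x * (excessRoot c x + 2 * Real.sqrt c))) W :=
    hT.sqrt fun x hx => (hTpos x hx).ne'
  have htpos := fun x hx => Real.sqrt_pos.2 (hTpos x hx)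
  refine ⟨_, fun x => x 0 / √(excessRoot c x * (excessRoot c x + 2 * Real.sqrt c)), ht,
    ContDiffOn.div (ContDiff.contDiffOn (by fun_prop)) ht fun x hx => (htpos x hx).ne', ?_⟩
  intro x hx
  have hr := hroot x hx
  have h2 := Real.sq_sqrt (hTpos x hx).le
  refine ⟨hr.isBoltSolution hc h2 ?_ (mul_div_cancel₀ _ (htpos x hx).ne'), htpos x hx⟩
  have h3 := hX x hx
  rw [div_pow, h2]
  field_simp
  linear_combination -hr.eq

lemma IsBoltSolution.notMem_singularCircle {c : ℝ} (hc : 0 ≤ c) {x : E3} {t C : ℝ}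
    (h : IsBoltSolution c x t C) : x ∉ singularCircle c := by
  rw [mem_singularCircle_iff hc]
  rintro ⟨h0, h1⟩
  have hr := h.isExcessRoot hc
  have h2 := hr.eq
  have hp := hr.pos
  have hs := Real.sqrt_nonneg c
  rw [h0, h1] at h2
  have h3 := hr.lt
  -- On the singular circle $d=0$, so both alternatives say $X>0$, while the cubic has become
  -- $X^2(X+2\sqrt c)=0$.
  rw [h1, or_self] at h3
  have : 0 < (quarterRoot c t ^ 2 - √c) * (quarterRoot c t ^ 2 - √c - 0) *
      (quarterRoot c t ^ 2 - √c + 2 * √c) := by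
    rw [sub_zero]; positivity
  rw [h2] at this
  simp at this

theorem bolt_eq_empty {c : ℝ} (hc : 0 ≤ c) {x : E3} (hx : x ∈ singularCircle c) :
    bolt c x = ∅ := by
  rw [eq_empty_iff_forall_notMem]
  intro m hm
  obtain ⟨n, t, C, -, hsol, -⟩ := exists_of_mem_bolt hm
  exact hsol.notMem_singularCircle hc hx

lemma singularCircle_zero : singularCircle 0 = {0} := by
  ext x
  rw [mem_singularCircle_iff le_rfl, mem_singleton_iff]
  constructor
  · rintro ⟨h0, h1⟩
    simp only [excess, Real.sqrt_zero, sub_zero] at h1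
    have h1' : x 1 = 0 := by nlinarith [sq_nonneg (x 1), sq_nonneg (x 2)]
    have h2' : x 2 = 0 := by nlinarith [sq_nonneg (x 1), sq_nonneg (x 2)]
    ext i; fin_cases i <;> simp [h0, h1', h2']
  · rintro rfl; simp [excess]

/-- Near every point off the singular circle there are smooth solutions. -/
lemma exists_local_solution {c : ℝ} (hc : 0 ≤ c) {x : E3} (hx : x ∉ singularCircle c) :
    ∃ W : Set E3, IsOpen W ∧ x ∈ W ∧ ∃ t C : E3 → ℝ, ContDiffOn ℝ ∞ t W ∧ ContDiffOn ℝ ∞ C W ∧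
      ∀ x ∈ W, IsBoltSolution c x (t x) (C x) := by
  by_cases h : x 0 ≠ 0 ∨ radialV x < 2 * c ^ (1 / 4 : ℝ)
  · exact ⟨_, isOpen_innerRegion hc, h, exists_solution_innerRegion hc⟩
  · obtain ⟨t, C, h1, h2, h3⟩ := exists_solution_outerRegion hc
    refine ⟨_, isOpen_outerRegion hc, ?_, t, C, h1, h2, fun x hx => (h3 x hx).1⟩
    push Not at h
    exact .inr (lt_of_le_of_ne h.2 fun h' => hx ⟨h.1, h'.symm⟩)

/-! ### The metric and the 3-form on tangent vectors of the bundle of bolts -/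

/-- The variation of `antiForm` when `C`, `y₁`, `y₂`, `n` vary by `C'`, `d₁`, `d₂`, `ν`. -/
def antiFormVar (y₁ y₂ : ℝ) (n : Fin 3 → ℝ) (C' d₁ d₂ : ℝ) (ν : Fin 3 → ℝ) :
    Matrix (Fin 5) (Fin 5) ℝ :=
  !![0, -ν 2, ν 1, ν 0 * y₂ + n 0 * d₂, -(ν 0 * y₁ + n 0 * d₁);
     ν 2, 0, -ν 0, ν 1 * y₂ + n 1 * d₂, -(ν 1 * y₁ + n 1 * d₁);
     -ν 1, ν 0, 0, ν 2 * y₂ + n 2 * d₂, -(ν 2 * y₁ + n 2 * d₁);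
     -(ν 0 * y₂ + n 0 * d₂), -(ν 1 * y₂ + n 1 * d₂), -(ν 2 * y₂ + n 2 * d₂), 0, C';
     ν 0 * y₁ + n 0 * d₁, ν 1 * y₁ + n 1 * d₁, ν 2 * y₁ + n 2 * d₁, -C', 0]

/-- The variation of `boltPt`. -/
def boltPtVar (t C y₁ y₂ : ℝ) (n : Fin 3 → ℝ) (t' C' d₁ d₂ : ℝ) (ν : Fin 3 → ℝ) : Ambient :=
  (![C' * n 0 + C * ν 0, C' * n 1 + C * ν 1, C' * n 2 + C * ν 2, d₁, d₂],
    t' • antiForm C y₁ y₂ n + t • antiFormVar y₁ y₂ n C' d₁ d₂ ν)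

lemma hasDerivAt_boltPt {t C y₁ y₂ : ℝ → ℝ} {n : ℝ → Fin 3 → ℝ} {t' C' d₁ d₂ s : ℝ}
    {ν : Fin 3 → ℝ} (ht : HasDerivAt t t' s) (hC : HasDerivAt C C' s) (h1 : HasDerivAt y₁ d₁ s)
    (h2 : HasDerivAt y₂ d₂ s) (hn : ∀ i, HasDerivAt (fun r => n r i) (ν i) s) :
    HasDerivAt (fun r => boltPt (t r) (C r) (y₁ r) (y₂ r) (n r))
      (boltPtVar (t s) (C s) (y₁ s) (y₂ s) (n s) t' C' d₁ d₂ ν) s := by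
  have key : ∀ i j, HasDerivAt (fun r => antiForm (C r) (y₁ r) (y₂ r) (n r) i j)
      (antiFormVar (y₁ s) (y₂ s) (n s) C' d₁ d₂ ν i j) s := by
    intro i j
    fin_cases i <;> fin_cases j
    all_goals first
      | exact hasDerivAt_const _ _
      | exact hC
      | exact hC.neg
      | exact hn _
      | exact (hn _).neg
      | exact (hn _).mul h1
      | exact (hn _).mul h2
      | exact ((hn _).mul h1).neg
      | exact ((hn _).mul h2).neg
  refine HasDerivAt.prodMk ?_ ?_
  · refine hasDerivAt_pi.2 fun i => ?_
    fin_cases i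
    · exact hC.mul (hn 0)
    · exact hC.mul (hn 1)
    · exact hC.mul (hn 2)
    · exact h1
    · exact h2
  · exact hasDerivAt_pi.2 fun i => hasDerivAt_pi.2 fun j => ht.mul (key i j)

/-- In the two-sided projection the term quadratic in $pp^{T}$ drops out, since $p\cdot X p=0$ for
antisymmetric $X$. -/
lemma vert_apply_of_antisymm {m X : Ambient} (hX : ∀ i j, X.2 j i = -X.2 i j) (i j : Fin 5) :
    vert m X i j = X.2 i j + m.1 i * (X.2 *ᵥ m.1) j - (X.2 *ᵥ m.1) i * m.1 j := by
  have hT : X.2ᵀ = -X.2 := by ext i j; simpa using hX i j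
  have h1 : m.1 ᵥ* X.2 = -(X.2 *ᵥ m.1) := by
    rw [← Matrix.mulVec_transpose, hT, Matrix.neg_mulVec]
  have h2 : m.1 ⬝ᵥ (X.2 *ᵥ m.1) = 0 := by
    have : m.1 ⬝ᵥ (X.2 *ᵥ m.1) = -(m.1 ⬝ᵥ (X.2 *ᵥ m.1)) := by
      conv_lhs => rw [Matrix.dotProduct_mulVec, h1, neg_dotProduct, dotProduct_comm]
    linarith
  rw [vert, sub_mul, one_mul, mul_sub, mul_one, sub_mul, Matrix.vecMulVec_mul, h1,
    Matrix.mul_vecMulVec, Matrix.vecMulVec_mul_vecMulVec, neg_dotProduct, dotProduct_comm, h2]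
  simp [Matrix.vecMulVec_apply]

/-- The vertical part of the variation of `Ω₁` along an orbit. -/
def orbitForm (C y₁ y₂ : ℝ) (n ν : Fin 3 → ℝ) : Matrix (Fin 5) (Fin 5) ℝ :=
  !![0, -((1 - C ^ 2) * ν 2), (1 - C ^ 2) * ν 1,
      ν 0 * y₂ + C * (n 1 * ν 2 - n 2 * ν 1) * y₁, -(ν 0 * y₁) + C * (n 1 * ν 2 - n 2 * ν 1) * y₂;
     (1 - C ^ 2) * ν 2, 0, -((1 - C ^ 2) * ν 0),
      ν 1 * y₂ + C * (n 2 * ν 0 - n 0 * ν 2) * y₁, -(ν 1 * y₁) + C * (n 2 * ν 0 - n 0 * ν 2) * y₂;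
     -((1 - C ^ 2) * ν 1), (1 - C ^ 2) * ν 0, 0,
      ν 2 * y₂ + C * (n 0 * ν 1 - n 1 * ν 0) * y₁, -(ν 2 * y₁) + C * (n 0 * ν 1 - n 1 * ν 0) * y₂;
     -(ν 0 * y₂ + C * (n 1 * ν 2 - n 2 * ν 1) * y₁), -(ν 1 * y₂ + C * (n 2 * ν 0 - n 0 * ν 2) * y₁),
      -(ν 2 * y₂ + C * (n 0 * ν 1 - n 1 * ν 0) * y₁), 0, 0;
     ν 0 * y₁ - C * (n 1 * ν 2 - n 2 * ν 1) * y₂, ν 1 * y₁ - C * (n 2 * ν 0 - n 0 * ν 2) * y₂,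
      ν 2 * y₁ - C * (n 0 * ν 1 - n 1 * ν 0) * y₂, 0, 0]

section variation
variable {t C y₁ y₂ : ℝ} {n ν η η' : Fin 3 → ℝ} {t' C' d₁ d₂ : ℝ}

lemma boltPtVar_antisymm (i j : Fin 5) :
    (boltPtVar t C y₁ y₂ n t' C' d₁ d₂ ν).2 j i = -(boltPtVar t C y₁ y₂ n t' C' d₁ d₂ ν).2 i j := by
  have h : antiFormVar y₁ y₂ n C' d₁ d₂ ν j i = -antiFormVar y₁ y₂ n C' d₁ d₂ ν i j := by
    fin_cases i <;> fin_cases j <;> simp [antiFormVar]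
  simp only [boltPtVar, Matrix.add_apply, Matrix.smul_apply, smul_eq_mul, h,
    antiForm_antisymm C y₁ y₂ n i j]
  ring

lemma boltPtVar_mulVec (hn : n 0 ^ 2 + n 1 ^ 2 + n 2 ^ 2 = 1)
    (hν : n 0 * ν 0 + n 1 * ν 1 + n 2 * ν 2 = 0) :
    (boltPtVar t C y₁ y₂ n t' C' d₁ d₂ ν).2 *ᵥ (boltPt t C y₁ y₂ n).1 =
      t • ![n 0 * (y₁ * d₂ - y₂ * d₁) - C * (n 1 * ν 2 - n 2 * ν 1),
        n 1 * (y₁ * d₂ - y₂ * d₁) - C * (n 2 * ν 0 - n 0 * ν 2),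
        n 2 * (y₁ * d₂ - y₂ * d₁) - C * (n 0 * ν 1 - n 1 * ν 0),
        C' * y₂ - C * d₂, C * d₁ - C' * y₁] := by
  ext i
  simp only [Matrix.mulVec, dotProduct, Fin.sum_univ_five, boltPtVar, boltPt, Matrix.add_apply,
    Matrix.smul_apply, smul_eq_mul]
  fin_cases i <;> simp [antiForm, antiFormVar]
  · ring
  · ring
  · ring
  · linear_combination (-t' * y₂ * C - t * C * d₂) * hn - t * C * y₂ * hν
  · linear_combination (t' * y₁ * C + t * C * d₁) * hn + t * C * y₁ * hν

/-- Moving $(C,y_1,y_2)$ with $n$ fixed changes $\Omega_1$ only by terms involving the normal of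
$S^4$, which the projection removes: $\Omega_1$ is parallel in these directions. What survives is
the change of $t$ and the motion of $n$. -/
lemma vert_boltPtVar (hn : n 0 ^ 2 + n 1 ^ 2 + n 2 ^ 2 = 1)
    (hν : n 0 * ν 0 + n 1 * ν 1 + n 2 * ν 2 = 0)
    (hy : C ^ 2 + y₁ ^ 2 + y₂ ^ 2 = 1) (hd : C * C' + y₁ * d₁ + y₂ * d₂ = 0) :
    vert (boltPt t C y₁ y₂ n) (boltPtVar t C y₁ y₂ n t' C' d₁ d₂ ν) =
      t' • antiForm C y₁ y₂ n + t • orbitForm C y₁ y₂ n ν := by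
  have hanti := boltPtVar_antisymm (t := t) (C := C) (y₁ := y₁) (y₂ := y₂) (n := n) (ν := ν)
    (t' := t') (C' := C') (d₁ := d₁) (d₂ := d₂)
  refine ext_of_antisymm (fun i j => ?_) (fun i j => ?_) fun i j hij => ?_
  · rw [vert_apply_of_antisymm hanti, vert_apply_of_antisymm hanti, hanti i j]; ring
  · have h : orbitForm C y₁ y₂ n ν j i = -orbitForm C y₁ y₂ n ν i j := by
      fin_cases i <;> fin_cases j <;> simp [orbitForm] <;> ring
    simp only [Matrix.add_apply, Matrix.smul_apply, smul_eq_mul, h, antiForm_antisymm C y₁ y₂ n i j]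
    ring
  · rw [vert_apply_of_antisymm hanti, boltPtVar_mulVec hn hν]
    fin_cases i <;> fin_cases j <;> simp at hij <;>
      simp [boltPt, boltPtVar, antiForm, antiFormVar, orbitForm]
    · linear_combination t * C ^ 2 * (ν 2 * hn - n 2 * hν)
    · linear_combination t * C ^ 2 * (-ν 1 * hn + n 1 * hν)
    · linear_combination t * n 0 * y₂ * hd - t * n 0 * d₂ * hy
    · linear_combination -t * n 0 * y₁ * hd + t * n 0 * d₁ * hy
    · linear_combination t * C ^ 2 * (ν 0 * hn - n 0 * hν)
    · linear_combination t * n 1 * y₂ * hd - t * n 1 * d₂ * hy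
    · linear_combination -t * n 1 * y₁ * hd + t * n 1 * d₁ * hy
    · linear_combination t * n 2 * y₂ * hd - t * n 2 * d₂ * hy
    · linear_combination -t * n 2 * y₁ * hd + t * n 2 * d₁ * hy
    · linear_combination (-t * C') * hy + t * C * hd 

/-- The cross product in components. -/
def crossVec (a b : Fin 3 → ℝ) : Fin 3 → ℝ :=
  ![a 1 * b 2 - a 2 * b 1, a 2 * b 0 - a 0 * b 2, a 0 * b 1 - a 1 * b 0]

/-- The triple product in components. -/
def tripleProd (a b d : Fin 3 → ℝ) : ℝ :=
  a 0 * (b 1 * d 2 - b 2 * d 1) + a 1 * (b 2 * d 0 - b 0 * d 2) + a 2 * (b 0 * d 1 - b 1 * d 0)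

set_option maxHeartbeats 2000000 in
-- The form `orbitForm` lies in the span of $\Omega_2,\Omega_3$, on which left multiplication by
-- $\Omega_1$ is a quarter turn. On the parameter $\nu$ this is $\nu\mapsto n\times\nu$, and it
-- reduces triple traces to double ones.
lemma antiForm_mul_orbitForm (hn : n 0 ^ 2 + n 1 ^ 2 + n 2 ^ 2 = 1)
    (hν : n 0 * ν 0 + n 1 * ν 1 + n 2 * ν 2 = 0) (hy : C ^ 2 + y₁ ^ 2 + y₂ ^ 2 = 1) :
    antiForm C y₁ y₂ n * orbitForm C y₁ y₂ n ν = orbitForm C y₁ y₂ n (crossVec n ν) := by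
  ext i j
  simp only [Matrix.mul_apply, Fin.sum_univ_five]
  fin_cases i <;> fin_cases j <;> simp [antiForm, orbitForm, crossVec]
  all_goals first | ring1 | grind

lemma trace_orbitForm (hn : n 0 ^ 2 + n 1 ^ 2 + n 2 ^ 2 = 1)
    (hη : n 0 * η 0 + n 1 * η 1 + n 2 * η 2 = 0)
    (hy : C ^ 2 + y₁ ^ 2 + y₂ ^ 2 = 1) :
    (orbitForm C y₁ y₂ n η * orbitForm C y₁ y₂ n η').trace =
      -4 * ((1 - C ^ 2) * (η 0 * η' 0 + η 1 * η' 1 + η 2 * η' 2)) := by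
  simp [Matrix.trace, Matrix.mul_apply, Fin.sum_univ_five, orbitForm]
  linear_combination
    (-2 * (y₁ ^ 2 + y₂ ^ 2) * C ^ 2 * (η 0 * η' 0 + η 1 * η' 1 + η 2 * η' 2)) * hn
    - 2 * (1 + C ^ 2) * (η 0 * η' 0 + η 1 * η' 1 + η 2 * η' 2) * hy
    + (2 * (y₁ ^ 2 + y₂ ^ 2) * C ^ 2 * (n 0 * η' 0 + n 1 * η' 1 + n 2 * η' 2)) * hη

lemma trace_vertical (a b : ℝ) (hn : n 0 ^ 2 + n 1 ^ 2 + n 2 ^ 2 = 1)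
    (hη : n 0 * η 0 + n 1 * η 1 + n 2 * η 2 = 0) (hη' : n 0 * η' 0 + n 1 * η' 1 + n 2 * η' 2 = 0)
    (hy : C ^ 2 + y₁ ^ 2 + y₂ ^ 2 = 1) :
    ((a • antiForm C y₁ y₂ n + t • orbitForm C y₁ y₂ n η)ᵀ *
      (b • antiForm C y₁ y₂ n + t • orbitForm C y₁ y₂ n η')).trace =
      4 * (a * b + t ^ 2 * (1 - C ^ 2) * (η 0 * η' 0 + η 1 * η' 1 + η 2 * η' 2)) := by
  simp [Matrix.trace, Matrix.mul_apply, Fin.sum_univ_five, orbitForm, antiForm]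
  linear_combination
    2 * (a * b * (1 + y₁ ^ 2 + y₂ ^ 2) +
      t ^ 2 * (y₁ ^ 2 + y₂ ^ 2) * C ^ 2 * (η 0 * η' 0 + η 1 * η' 1 + η 2 * η' 2)) * hn
    + 2 * (a * b + t ^ 2 * (1 + C ^ 2) * (η 0 * η' 0 + η 1 * η' 1 + η 2 * η' 2)) * hy
    + 2 * (t * (1 - C ^ 2) * b + t * (y₁ ^ 2 + y₂ ^ 2) * b
      - t ^ 2 * (y₁ ^ 2 + y₂ ^ 2) * C ^ 2 * (n 0 * η' 0 + n 1 * η' 1 + n 2 * η' 2)) * hη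
    + 2 * (t * (1 - C ^ 2) * a + t * (y₁ ^ 2 + y₂ ^ 2) * a) * hη'

/-- Mixed terms vanish because $\Omega_1$ is orthogonal to the orbit forms and $n\perp\eta$. The
coefficient of the orbit part collects $2q^2C^2$ from the motion in $S^4$ and $t^2(1-C^2)/q^2$ from
the motion in the fibre. -/
theorem bsMetric_boltPtVar {c a C'' e₁ e₂ : ℝ} (hn : n 0 ^ 2 + n 1 ^ 2 + n 2 ^ 2 = 1)
    (hη : n 0 * η 0 + n 1 * η 1 + n 2 * η 2 = 0) (hη' : n 0 * η' 0 + n 1 * η' 1 + n 2 * η' 2 = 0)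
    (hy : C ^ 2 + y₁ ^ 2 + y₂ ^ 2 = 1) (hc : 0 < c + t ^ 2)
    (hd : C * C' + y₁ * d₁ + y₂ * d₂ = 0) (he : C * C'' + y₁ * e₁ + y₂ * e₂ = 0) :
    bsMetric c (boltPt t C y₁ y₂ n) (boltPtVar t C y₁ y₂ n t' C' d₁ d₂ η)
      (boltPtVar t C y₁ y₂ n a C'' e₁ e₂ η') =
      t' * a / quarterRoot c t ^ 2 + 2 * quarterRoot c t ^ 2 * (C' * C'' + d₁ * e₁ + d₂ * e₂)
        + boltScale c t C * (η 0 * η' 0 + η 1 * η' 1 + η 2 * η' 2) := by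
  have hq := quarterRoot_pos hc
  rw [bsMetric, radiusSq_boltPt hn hy, vert_boltPtVar hn hη hy hd, vert_boltPtVar hn hη' hy he,
    trace_vertical _ _ hn hη hη' hy, rpow_half_eq hc, rpow_neg_half_eq hc]
  have hdot : (boltPtVar t C y₁ y₂ n t' C' d₁ d₂ η).1 ⬝ᵥ (boltPtVar t C y₁ y₂ n a C'' e₁ e₂ η').1 =
      C' * C'' + d₁ * e₁ + d₂ * e₂ + C ^ 2 * (η 0 * η' 0 + η 1 * η' 1 + η 2 * η' 2) := by
    simp [boltPtVar, dotProduct, Fin.sum_univ_five]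
    linear_combination C' * C'' * hn + C * C'' * hη + C' * C * hη'
  rw [hdot, boltScale]
  field_simp
  ring

theorem bsForm_boltPtVar {c : ℝ} (hn : n 0 ^ 2 + n 1 ^ 2 + n 2 ^ 2 = 1)
    (hη : n 0 * η 0 + n 1 * η 1 + n 2 * η 2 = 0) (hη' : n 0 * η' 0 + n 1 * η' 1 + n 2 * η' 2 = 0)
    (hy : C ^ 2 + y₁ ^ 2 + y₂ ^ 2 = 1) (hc : 0 < c + t ^ 2)
    (hd : C * C' + y₁ * d₁ + y₂ * d₂ = 0) :
    bsForm c (boltPt t C y₁ y₂ n) (boltPtVar t C y₁ y₂ n t' C' d₁ d₂ 0)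
      (boltPtVar t C y₁ y₂ n 0 0 0 0 η) (boltPtVar t C y₁ y₂ n 0 0 0 0 η') =
      (t ^ 2 * (1 - C ^ 2) * t' / quarterRoot c t ^ 3 -
        2 * quarterRoot c t * (C ^ 2 * t' + 2 * C * t * C')) * tripleProd n η η' := by
  have hq := quarterRoot_pos hc
  have h0 : n 0 * (0 : Fin 3 → ℝ) 0 + n 1 * (0 : Fin 3 → ℝ) 1 + n 2 * (0 : Fin 3 → ℝ) 2 = 0 := by
    simp
  have hO : orbitForm C y₁ y₂ n 0 = 0 := by
    ext i j; fin_cases i <;> fin_cases j <;> simp [orbitForm]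
  have hcr : n 0 * crossVec n η 0 + n 1 * crossVec n η 1 + n 2 * crossVec n η 2 = 0 := by
    simp [crossVec]; ring
  have hq1 : (c + t ^ 2) ^ (1 / 4 : ℝ) = quarterRoot c t := rfl
  rw [bsForm, radiusSq_boltPt hn hy, vert_boltPtVar hn h0 hy hd,
    vert_boltPtVar hn hη hy (by simp), vert_boltPtVar hn hη' hy (by simp), hO, hq1,
    rpow_neg_three_quarters_eq hc]
  simp only [smul_zero, add_zero, zero_smul, zero_add]
  have htr : ((t' • antiForm C y₁ y₂ n) * (t • orbitForm C y₁ y₂ n η) *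
      (t • orbitForm C y₁ y₂ n η')).trace =
      -4 * (t' * t ^ 2 * (1 - C ^ 2) * tripleProd n η η') := by
    simp only [Matrix.smul_mul, Matrix.mul_smul, antiForm_mul_orbitForm hn hη hy,
      Matrix.trace_smul, trace_orbitForm hn hcr hy]
    simp [crossVec, tripleProd]
    ring
  have h1 : (boltPtVar t C y₁ y₂ n 0 0 0 0 η).1 ⬝ᵥ
      ((t' • antiForm C y₁ y₂ n) *ᵥ (boltPtVar t C y₁ y₂ n 0 0 0 0 η').1) =
      -(C ^ 2 * t' * tripleProd n η η') := by
    simp only [Matrix.mulVec, dotProduct, Fin.sum_univ_five]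
    simp [boltPtVar, antiForm, tripleProd]
    ring
  -- The part symmetric in $a,b$ cancels between the last two terms of the 3-form, whereas the
  -- triple product doubles; the sign comes from `h3`.
  have h2 : ∀ a b : Fin 3 → ℝ, n 0 * a 0 + n 1 * a 1 + n 2 * a 2 = 0 →
      n 0 * b 0 + n 1 * b 1 + n 2 * b 2 = 0 → (boltPtVar t C y₁ y₂ n 0 0 0 0 b).1 ⬝ᵥ
      ((t • orbitForm C y₁ y₂ n a) *ᵥ (boltPtVar t C y₁ y₂ n t' C' d₁ d₂ 0).1) =
      -(C * t * C' * tripleProd n a b) +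
        C * t * (y₂ * d₁ - y₁ * d₂) * (a 0 * b 0 + a 1 * b 1 + a 2 * b 2) := by
    intro a b ha hb
    simp only [Matrix.mulVec, dotProduct, Fin.sum_univ_five]
    simp [boltPtVar, orbitForm, tripleProd]
    linear_combination C ^ 2 * t * (n 0 * (a 1 * b 2 - a 2 * b 1) + n 1 * (a 2 * b 0 - a 0 * b 2) +
      n 2 * (a 0 * b 1 - a 1 * b 0)) * hd
  have h3 : (boltPtVar t C y₁ y₂ n t' C' d₁ d₂ 0).1 ⬝ᵥ
      ((t • orbitForm C y₁ y₂ n η') *ᵥ (boltPtVar t C y₁ y₂ n 0 0 0 0 η).1) =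
      -((boltPtVar t C y₁ y₂ n 0 0 0 0 η).1 ⬝ᵥ
      ((t • orbitForm C y₁ y₂ n η') *ᵥ (boltPtVar t C y₁ y₂ n t' C' d₁ d₂ 0).1)) := by
    have hT : (t • orbitForm C y₁ y₂ n η')ᵀ = -(t • orbitForm C y₁ y₂ n η') := by
      ext i j; fin_cases i <;> fin_cases j <;> simp [orbitForm] <;> ring
    rw [Matrix.dotProduct_mulVec, ← Matrix.mulVec_transpose, hT, Matrix.neg_mulVec,
      neg_dotProduct, dotProduct_comm]
  have htri : tripleProd n η' η = -tripleProd n η η' := by simp [tripleProd]; ring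
  rw [htr, h1, h2 η η' hη hη', h3, h2 η' η hη' hη, htri]
  field_simp
  ring

end variation

/-! ### Derivatives of a trivialization in normal form -/

/-- `F` is given over `W` by the smooth solutions `t`, `C`. -/
structure IsNormalForm (c : ℝ) (W : Set E3) (F : E3 → E3 → Ambient) (t C : E3 → ℝ) : Prop where
  isOpen : IsOpen W
  smooth : ContDiffOn ℝ ∞ (Function.uncurry F) (W ×ˢ {0}ᶜ)
  smooth_t : ContDiffOn ℝ ∞ t W
  smooth_C : ContDiffOn ℝ ∞ C W
  sol : ∀ x ∈ W, IsBoltSolution c x (t x) (C x)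
  eq : ∀ x ∈ W, ∀ n : E3, n ≠ 0 → F x n = boltOf c x (t x) (C x) (unitVec n)

/-- The scalar equations satisfied by the derivatives `T`, `C'`, `d₁`, `d₂` of `t`, `C`, `y₁`, `y₂`
in the direction `w`. -/
structure IsSolutionVar (c : ℝ) (x : E3) (t C : ℝ) (w : E3) (T C' d₁ d₂ : ℝ) : Prop where
  mul : T * C + t * C' = w 0
  y₁ : 2 * quarterRoot c t * d₁ + t * T / quarterRoot c t ^ 3 * (x 1 / (2 * quarterRoot c t)) = w 1
  y₂ : 2 * quarterRoot c t * d₂ + t * T / quarterRoot c t ^ 3 * (x 2 / (2 * quarterRoot c t)) = w 2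
  sphere : C * C' + x 1 / (2 * quarterRoot c t) * d₁ + x 2 / (2 * quarterRoot c t) * d₂ = 0

lemma hasDerivAt_line (x w : E3) : HasDerivAt (fun r : ℝ => x + r • w) w 0 := by
  simpa using ((hasDerivAt_id (0 : ℝ)).smul_const w).const_add x

lemma hasDerivAt_comp_line {f : E3 → ℝ} {x : E3} (hf : DifferentiableAt ℝ f x) (w : E3) :
    HasDerivAt (fun r : ℝ => f (x + r • w)) (fderiv ℝ f x w) 0 := by
  have h : HasFDerivAt f (fderiv ℝ f x) (x + (0 : ℝ) • w) := by simpa using hf.hasFDerivAt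
  exact h.comp_hasDerivAt 0 (hasDerivAt_line x w)

lemma eventually_line_mem {W : Set E3} (hW : IsOpen W) {x : E3} (hx : x ∈ W) (w : E3) :
    ∀ᶠ r : ℝ in 𝓝 0, x + r • w ∈ W :=
  (hasDerivAt_line x w).continuousAt.eventually_mem (hW.mem_nhds (by simpa using hx))

section solutions
variable {c : ℝ} {W : Set E3} {t C : E3 → ℝ}

lemma contDiffOn_yCoord (ht : ContDiffOn ℝ ∞ t W)
    (h : ∀ x ∈ W, IsBoltSolution c x (t x) (C x)) (i : Fin 3) :
    ContDiffOn ℝ ∞ (fun x : E3 => x i / (2 * quarterRoot c (t x))) W := by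
  refine ContDiffOn.div (ContDiff.contDiffOn (by fun_prop))
    (contDiffOn_const.mul (ht.quarterRoot fun x hx => (h x hx).pos)) ?_
  intro x hx
  have := quarterRoot_pos (h x hx).pos
  positivity

lemma ContDiffOn.differentiableAt_of_isOpen {E G : Type*} [NormedAddCommGroup E] [NormedSpace ℝ E]
    [NormedAddCommGroup G] [NormedSpace ℝ G] {f : E → G} {s : Set E} (hf : ContDiffOn ℝ ∞ f s)
    (hs : IsOpen s) {x : E} (hx : x ∈ s) : DifferentiableAt ℝ f x :=
  (hf.contDiffAt (hs.mem_nhds hx)).differentiableAt (by simp)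

lemma isSolutionVar (hW : IsOpen W) (ht : ContDiffOn ℝ ∞ t W) (hC : ContDiffOn ℝ ∞ C W)
    (h : ∀ x ∈ W, IsBoltSolution c x (t x) (C x)) {x : E3} (hx : x ∈ W) (w : E3) :
    IsSolutionVar c x (t x) (C x) w (fderiv ℝ t x w) (fderiv ℝ C x w)
      (fderiv ℝ (fun x : E3 => x 1 / (2 * quarterRoot c (t x))) x w)
      (fderiv ℝ (fun x : E3 => x 2 / (2 * quarterRoot c (t x))) x w) := by
  have hq : ContDiffOn ℝ ∞ (fun x => quarterRoot c (t x)) W :=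
    ht.quarterRoot fun x hx => (h x hx).pos
  have hqpos := quarterRoot_pos (h x hx).pos
  have lt := hasDerivAt_comp_line (ht.differentiableAt_of_isOpen hW hx) w
  have lC := hasDerivAt_comp_line (hC.differentiableAt_of_isOpen hW hx) w
  have lq := hasDerivAt_comp_line (hq.differentiableAt_of_isOpen hW hx) w
  have ly := fun i => hasDerivAt_comp_line
    ((contDiffOn_yCoord ht h i).differentiableAt_of_isOpen hW hx) w
  have lx : ∀ i : Fin 3, HasDerivAt (fun r : ℝ => (x + r • w) i) (w i) 0 := fun i => by
    simpa using ((hasDerivAt_id (0 : ℝ)).mul_const (w i)).const_add (x i)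
  have hev := eventually_line_mem hW hx w
  set q' := fderiv ℝ (fun x => quarterRoot c (t x)) x w
  have e4 : 4 * quarterRoot c (t x) ^ 3 * q' = 2 * t x * fderiv ℝ t x w := by
    have h1 := (lq.pow 4).congr_of_eventuallyEq (f₁ := fun r : ℝ => c + t (x + r • w) ^ 2) ?_
    · have := h1.unique ((lt.pow 2).const_add c)
      simpa using this
    · filter_upwards [hev] with r hr
      exact (quarterRoot_pow_four (h _ hr).pos).symm
  -- From $q^4=c+t^2$. This accounts for the factor $tT/q^3$ in `IsSolutionVar`.
  have eq' : 2 * q' = t x * fderiv ℝ t x w / quarterRoot c (t x) ^ 3 := by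
    field_simp; linarith
  have ey : ∀ i : Fin 3, 2 * quarterRoot c (t x) *
      fderiv ℝ (fun x : E3 => x i / (2 * quarterRoot c (t x))) x w +
      t x * fderiv ℝ t x w / quarterRoot c (t x) ^ 3 * (x i / (2 * quarterRoot c (t x))) = w i := by
    intro i
    have h1 := ((lq.const_mul 2).mul (ly i)).congr_of_eventuallyEq
      (f₁ := fun r : ℝ => (x + r • w) i) ?_
    · have := h1.unique (lx i)
      rw [← eq']
      simp only [zero_smul, add_zero] at this
      linarith
    · filter_upwards [hev] with r hr
      have := quarterRoot_pos (h _ hr).pos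
      simp only [Pi.mul_apply]
      field_simp
  refine ⟨?_, ey 1, ey 2, ?_⟩
  · have h1 := (lt.mul lC).congr_of_eventuallyEq (f₁ := fun r : ℝ => (x + r • w) 0) ?_
    · simpa using h1.unique (lx 0)
    · filter_upwards [hev] with r hr
      exact (h _ hr).mul.symm
  · have h1 := (((lC.pow 2).add ((ly 1).pow 2)).add ((ly 2).pow 2)).congr_of_eventuallyEq
      (f₁ := fun _ : ℝ => (1 : ℝ)) ?_
    · have := h1.unique (hasDerivAt_const 0 1)
      simp at this
      linarith
    · filter_upwards [hev] with r hr
      exact (h _ hr).sphere.symm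

end solutions

lemma hasDerivAt_unitVec_line {n : E3} (hn : ‖n‖ = 1) (η : E3) (i : Fin 3) :
    HasDerivAt (fun r : ℝ => unitVec (n + r • η) i) (η i - inner ℝ n η * n i) 0 := by
  have h1 := hasDerivAt_line n η
  have h2 := h1.norm_sq.sqrt (by simp [hn])
  have h3 := h2.inv (by simp [hn])
  have h4 : HasDerivAt (fun r : ℝ => (n + r • η) i) (η i) 0 := by
    simpa using ((hasDerivAt_id (0 : ℝ)).mul_const (η i)).const_add (n i)
  have h5 := (h3.mul h4).congr_of_eventuallyEq (f₁ := fun r : ℝ => unitVec (n + r • η) i) ?_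
  · refine h5.congr_deriv ?_
    simp [hn]
    ring
  · refine Filter.Eventually.of_forall fun r => ?_
    simp [unitVec]
    ring

/-- The variation of the point of the bolt in direction `n`. -/
noncomputable def boltOfVar (c : ℝ) (t C : E3 → ℝ) (x n w η : E3) : Ambient :=
  boltPtVar (t x) (C x) (x 1 / (2 * quarterRoot c (t x))) (x 2 / (2 * quarterRoot c (t x))) n.ofLp
    (fderiv ℝ t x w) (fderiv ℝ C x w)
    (fderiv ℝ (fun x : E3 => x 1 / (2 * quarterRoot c (t x))) x w)
    (fderiv ℝ (fun x : E3 => x 2 / (2 * quarterRoot c (t x))) x w)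
    (η.ofLp - (inner ℝ n η : ℝ) • n.ofLp)

theorem IsNormalForm.trivDeriv_eq {c : ℝ} {W : Set E3} {F : E3 → E3 → Ambient} {t C : E3 → ℝ}
    (hF : IsNormalForm c W F t C) {x n : E3} (hx : x ∈ W) (hn : ‖n‖ = 1) (w η : E3) :
    trivDeriv F x n (w, η) = boltOfVar c t C x n w η := by
  have hn0 : n ≠ 0 := by rintro rfl; simp at hn
  have hopen : IsOpen (W ×ˢ ({0}ᶜ : Set E3)) := hF.isOpen.prod isOpen_compl_singleton
  have hd := hF.smooth.differentiableAt_of_isOpen hopen (x := (x, n)) ⟨hx, hn0⟩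
  have h1 : HasDerivAt (Function.uncurry F ∘ fun r : ℝ => (x + r • w, n + r • η))
      (trivDeriv F x n (w, η)) 0 :=
    hd.hasFDerivAt.comp_hasDerivAt_of_eq 0 ((hasDerivAt_line x w).prodMk (hasDerivAt_line n η))
      (by simp)
  have ly := fun i => hasDerivAt_comp_line
    ((contDiffOn_yCoord hF.smooth_t hF.sol i).differentiableAt_of_isOpen hF.isOpen hx) w
  have h2 := hasDerivAt_boltPt
    (hasDerivAt_comp_line (hF.smooth_t.differentiableAt_of_isOpen hF.isOpen hx) w)
    (hasDerivAt_comp_line (hF.smooth_C.differentiableAt_of_isOpen hF.isOpen hx) w)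
    (ly 1) (ly 2) (n := fun r => unitVec (n + r • η)) (hasDerivAt_unitVec_line hn η)
  have h3 := h2.congr_of_eventuallyEq
    (f₁ := Function.uncurry F ∘ fun r : ℝ => (x + r • w, n + r • η)) ?_
  · rw [h1.unique h3, boltOfVar]
    simp only [zero_smul, add_zero, unitVec_of_norm hn]
    rfl
  · have hev : ∀ᶠ r : ℝ in 𝓝 0, n + r • η ∈ ({0}ᶜ : Set E3) :=
      eventually_line_mem isOpen_compl_singleton hn0 η
    filter_upwards [eventually_line_mem hF.isOpen hx w, hev] with r hr hr'
    exact hF.eq _ hr _ hr'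

theorem IsBoltTrivialization.exists_isNormalForm {c : ℝ} {W : Set E3} {F : E3 → E3 → Ambient}
    (hF : IsBoltTrivialization c W F) : ∃ t C : E3 → ℝ, IsNormalForm c W F t C := by
  obtain ⟨t, C, ht, hC, h⟩ := hF.exists_normalForm
  exact ⟨t, C, hF.isOpen, hF.smooth, ht, hC, fun x hx => (h x hx).1, fun x hx => (h x hx).2⟩

/-! ### The metric on the base -/

/-- The 1-form `x₁ dx₁ + x₂ dx₂ = v dv`. -/
noncomputable def radialForm (x : E3) : E3 →L[ℝ] ℝ :=
  x 1 • (EuclideanSpace.proj 1 : E3 →L[ℝ] ℝ) + x 2 • (EuclideanSpace.proj 2 : E3 →L[ℝ] ℝ)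

@[simp] lemma radialForm_apply (x v : E3) : radialForm x v = x 1 * v 1 + x 2 * v 2 := by
  simp [radialForm]

/-- The metric `(2 / a) du² + ½ (dx₁² + dx₂²) + (2 c + t²) / (8 a q⁴) (v dv)²`. -/
noncomputable def solMetric (c t C : ℝ) (x : E3) : E3 →L[ℝ] E3 →L[ℝ] ℝ :=
  (2 / boltScale c t C) • (EuclideanSpace.proj 0 : E3 →L[ℝ] ℝ).smulRight
      (EuclideanSpace.proj 0 : E3 →L[ℝ] ℝ)
    + (1 / 2 : ℝ) • ((EuclideanSpace.proj 1 : E3 →L[ℝ] ℝ).smulRight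
      (EuclideanSpace.proj 1 : E3 →L[ℝ] ℝ) + (EuclideanSpace.proj 2 : E3 →L[ℝ] ℝ).smulRight
      (EuclideanSpace.proj 2 : E3 →L[ℝ] ℝ))
    + ((2 * c + t ^ 2) / (8 * boltScale c t C * quarterRoot c t ^ 4)) •
      (radialForm x).smulRight (radialForm x)

set_option synthInstance.maxHeartbeats 400000 in
lemma solMetric_apply (c t C : ℝ) (x v w : E3) : solMetric c t C x v w =
    2 / boltScale c t C * (v 0 * w 0) + 1 / 2 * (v 1 * w 1 + v 2 * w 2) +
      (2 * c + t ^ 2) / (8 * boltScale c t C * quarterRoot c t ^ 4) *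
        ((x 1 * v 1 + x 2 * v 2) * (x 1 * w 1 + x 2 * w 2)) := by
  simp only [solMetric, add_apply, smul_apply,
    ContinuousLinearMap.smulRight_apply, PiLp.proj_apply, radialForm_apply, smul_eq_mul]

lemma boltScale_neg (c t C : ℝ) : boltScale c (-t) (-C) = boltScale c t C := by
  simp [boltScale, quarterRoot_neg]

lemma solMetric_neg (c t C : ℝ) (x : E3) : solMetric c (-t) (-C) x = solMetric c t C x := by
  simp only [solMetric, boltScale_neg, quarterRoot_neg, neg_sq]

open Classical in
/-- The metric `k_c` on the base. -/
noncomputable def baseMetric (c : ℝ) (x : E3) : E3 →L[ℝ] E3 →L[ℝ] ℝ :=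
  if h : ∃ s : ℝ × ℝ, IsBoltSolution c x s.1 s.2 then solMetric c h.choose.1 h.choose.2 x else 0

/-- Only even expressions in $(t,C)$ occur in `solMetric`, so the chosen solution does not matter.
-/
lemma baseMetric_eq {c : ℝ} (hc : 0 ≤ c) {x : E3} {t C : ℝ} (h : IsBoltSolution c x t C) :
    baseMetric c x = solMetric c t C x := by
  have hex : ∃ s : ℝ × ℝ, IsBoltSolution c x s.1 s.2 := ⟨(t, C), h⟩
  rw [baseMetric, dif_pos hex]
  rcases h.eq_or_eq_neg hc hex.choose_spec with ⟨h1, h2⟩ | ⟨h1, h2⟩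
  · rw [h1, h2]
  · rw [h1, h2, solMetric_neg]

/-- The left side is the block of $g_c$ transverse to the bolt. The sphere relation removes
$y_1,y_2$ in favour of $v\,dv$ and $dx_1^2+dx_2^2$, and the remaining quadratic form in $(dt,dC)$ is
rewritten in terms of $du$ and $v\,dv$. -/
lemma IsSolutionVar.metric_eq {c : ℝ} {x : E3} {t C : ℝ} (h : IsBoltSolution c x t C)
    {w w' : E3} {T C' d₁ d₂ T₂ C₂ e₁ e₂ : ℝ} (hv : IsSolutionVar c x t C w T C' d₁ d₂)
    (hv' : IsSolutionVar c x t C w' T₂ C₂ e₁ e₂) :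
    T * T₂ / quarterRoot c t ^ 2 + 2 * quarterRoot c t ^ 2 * (C' * C₂ + d₁ * e₁ + d₂ * e₂) =
      solMetric c t C x w w' := by
  have hq := quarterRoot_pos h.pos
  have hc : c = quarterRoot c t ^ 4 - t ^ 2 := by rw [quarterRoot_pow_four h.pos]; ring
  have hsph := h.sphere
  have ha := h.boltScale_pos
  have ea : boltScale c t C * quarterRoot c t ^ 2 =
      2 * quarterRoot c t ^ 4 * C ^ 2 + t ^ 2 * (1 - C ^ 2) := by
    rw [boltScale]; field_simp
  have s1 := hv.sphere
  have s2 := hv'.sphere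
  rw [solMetric_apply, ← hv.mul, ← hv.y₁, ← hv.y₂, ← hv'.mul, ← hv'.y₁, ← hv'.y₂]
  have ex1 : x 1 = 2 * quarterRoot c t * (x 1 / (2 * quarterRoot c t)) := by field_simp
  have ex2 : x 2 = 2 * quarterRoot c t * (x 2 / (2 * quarterRoot c t)) := by field_simp
  rw [ex1, ex2]
  simp only [mul_div_cancel_left₀ _ (show (2 * quarterRoot c t) ≠ 0 by positivity)]
  generalize x 1 / (2 * quarterRoot c t) = y₁ at *
  generalize x 2 / (2 * quarterRoot c t) = y₂ at *
  set q := quarterRoot c t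
  set a := boltScale c t C
  have hp : 2 * q * y₁ * (2 * q * d₁ + t * T / q ^ 3 * y₁) +
      2 * q * y₂ * (2 * q * d₂ + t * T / q ^ 3 * y₂) =
      2 * q * (-(2 * q * C * C') + t * T / q ^ 3 * (1 - C ^ 2)) := by
    linear_combination 4 * q ^ 2 * s1 + 2 * q * (t * T / q ^ 3) * hsph
  have hp' : 2 * q * y₁ * (2 * q * e₁ + t * T₂ / q ^ 3 * y₁) +
      2 * q * y₂ * (2 * q * e₂ + t * T₂ / q ^ 3 * y₂) =
      2 * q * (-(2 * q * C * C₂) + t * T₂ / q ^ 3 * (1 - C ^ 2)) := by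
    linear_combination 4 * q ^ 2 * s2 + 2 * q * (t * T₂ / q ^ 3) * hsph
  have hm : (2 * q * d₁ + t * T / q ^ 3 * y₁) * (2 * q * e₁ + t * T₂ / q ^ 3 * y₁) +
      (2 * q * d₂ + t * T / q ^ 3 * y₂) * (2 * q * e₂ + t * T₂ / q ^ 3 * y₂) =
      4 * q ^ 2 * (d₁ * e₁ + d₂ * e₂) - 2 * q * (t * T₂ / q ^ 3) * (C * C')
        - 2 * q * (t * T / q ^ 3) * (C * C₂) + (t * T / q ^ 3) * (t * T₂ / q ^ 3) * (1 - C ^ 2) := by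
    linear_combination 2 * q * (t * T₂ / q ^ 3) * s1 + 2 * q * (t * T / q ^ 3) * s2 +
      (t * T / q ^ 3) * (t * T₂ / q ^ 3) * hsph
  rw [hp, hp', hm, show 2 * c + t ^ 2 = 2 * q ^ 4 - t ^ 2 by linarith]
  generalize hP : 2 * q * (-(2 * q * C * C') + t * T / q ^ 3 * (1 - C ^ 2)) = P
  generalize hP' : 2 * q * (-(2 * q * C * C₂) + t * T₂ / q ^ 3 * (1 - C ^ 2)) = P'
  -- Multiplication by $aq^2$ turns the claim into an identity without `boltScale` in a denominator.
  have key : (T * T₂ / q ^ 2 + 2 * q ^ 2 * (C' * C₂ + d₁ * e₁ + d₂ * e₂) -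
      1 / 2 * (4 * q ^ 2 * (d₁ * e₁ + d₂ * e₂) - 2 * q * (t * T₂ / q ^ 3) * (C * C')
        - 2 * q * (t * T / q ^ 3) * (C * C₂) +
        (t * T / q ^ 3) * (t * T₂ / q ^ 3) * (1 - C ^ 2))) * (a * q ^ 2) =
      q ^ 2 * (2 * ((T * C + t * C') * (T₂ * C + t * C₂)) +
        (2 * q ^ 4 - t ^ 2) / (8 * q ^ 4) * (P * P')) := by
    rw [ea, ← hP, ← hP']
    field_simp
    ring
  have : 2 / a * ((T * C + t * C') * (T₂ * C + t * C₂)) +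
      (2 * q ^ 4 - t ^ 2) / (8 * a * q ^ 4) * (P * P') = (2 * ((T * C + t * C') * (T₂ * C + t * C₂)) +
        (2 * q ^ 4 - t ^ 2) / (8 * q ^ 4) * (P * P')) / a := by
    field_simp
  have hq2 : q ^ 2 ≠ 0 := by positivity
  have key1 := mul_right_cancel₀ hq2 ((mul_assoc _ a (q ^ 2)).trans (key.trans (mul_comm _ _)))
  have key2 := eq_div_of_mul_eq ha.ne' key1
  linear_combination key2 - this

/-! ### The pushforward of the metric and of the 3-form -/

/-- The 1-form `- 4 π (2 C q du - t / (2 q) v dv)`. -/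
noncomputable def solForm (c t C : ℝ) (x : E3) : E3 →L[ℝ] ℝ :=
  (-(4 * Real.pi)) • ((2 * C * quarterRoot c t) • (EuclideanSpace.proj 0 : E3 →L[ℝ] ℝ)
    - (t / (2 * quarterRoot c t)) • radialForm x)

lemma solForm_apply (c t C : ℝ) (x w : E3) : solForm c t C x w =
    -(4 * Real.pi) * (2 * C * quarterRoot c t * w 0 -
      t / (2 * quarterRoot c t) * (x 1 * w 1 + x 2 * w 2)) := by
  simp [solForm]

lemma solForm_neg (c t C : ℝ) (x : E3) : solForm c (-t) (-C) x = -solForm c t C x := by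
  ext w
  simp only [solForm_apply, quarterRoot_neg, neg_apply]
  ring

lemma IsSolutionVar.form_eq {c : ℝ} {x : E3} {t C : ℝ} (h : IsBoltSolution c x t C)
    {w : E3} {T C' d₁ d₂ : ℝ} (hv : IsSolutionVar c x t C w T C' d₁ d₂) :
    t ^ 2 * (1 - C ^ 2) * T / quarterRoot c t ^ 3 -
        2 * quarterRoot c t * (C ^ 2 * T + 2 * C * t * C') =
      -(2 * C * quarterRoot c t * w 0 - t / (2 * quarterRoot c t) * (x 1 * w 1 + x 2 * w 2)) := by
  have hq := quarterRoot_pos h.pos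
  have hsph := h.sphere
  have s1 := hv.sphere
  rw [← hv.mul, ← hv.y₁, ← hv.y₂]
  have ex1 : x 1 = 2 * quarterRoot c t * (x 1 / (2 * quarterRoot c t)) := by field_simp
  have ex2 : x 2 = 2 * quarterRoot c t * (x 2 / (2 * quarterRoot c t)) := by field_simp
  rw [ex1, ex2]
  simp only [mul_div_cancel_left₀ _ (show (2 * quarterRoot c t) ≠ 0 by positivity)]
  generalize x 1 / (2 * quarterRoot c t) = y₁ at *
  generalize x 2 / (2 * quarterRoot c t) = y₂ at *
  set q := quarterRoot c t
  have hp : 2 * q * y₁ * (2 * q * d₁ + t * T / q ^ 3 * y₁) +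
      2 * q * y₂ * (2 * q * d₂ + t * T / q ^ 3 * y₂) =
      2 * q * (-(2 * q * C * C') + t * T / q ^ 3 * (1 - C ^ 2)) := by
    linear_combination 4 * q ^ 2 * s1 + 2 * q * (t * T / q ^ 3) * hsph
  rw [hp]
  field_simp
  ring

lemma integral_sphere_const (r : ℝ) :
    ∫ _ : Metric.sphere (0 : E3) 1, r ∂(volume : Measure E3).toSphere = 4 * Real.pi * r := by
  rw [integral_const, Measure.toSphere_real_apply_univ, Measure.real,
    EuclideanSpace.volume_ball_fin_three]
  simp [ENNReal.toReal_mul, ENNReal.toReal_ofReal (by positivity : 0 ≤ Real.pi * 4 / 3)]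
  left
  ring

/-- The tangential part of `η` at the unit vector `n`. -/
noncomputable def tangPart (n η : E3) : Fin 3 → ℝ := η.ofLp - (inner ℝ n η : ℝ) • n.ofLp

lemma unit_sum {n : E3} (hn : ‖n‖ = 1) : n 0 ^ 2 + n 1 ^ 2 + n 2 ^ 2 = 1 := by
  rw [← norm_sq_eq_sum, hn, one_pow]

lemma inner_eq_sum (v w : E3) : inner ℝ v w = v 0 * w 0 + v 1 * w 1 + v 2 * w 2 := by
  simp [PiLp.inner_apply, Fin.sum_univ_three]; ring

lemma tangPart_perp {n : E3} (hn : ‖n‖ = 1) (η : E3) :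
    n 0 * tangPart n η 0 + n 1 * tangPart n η 1 + n 2 * tangPart n η 2 = 0 := by
  have h := unit_sum hn
  simp only [tangPart, inner_eq_sum, Pi.sub_apply, Pi.smul_apply, smul_eq_mul]
  linear_combination (-(n 0 * η 0 + n 1 * η 1 + n 2 * η 2)) * h

lemma tangPart_dot {n : E3} (hn : ‖n‖ = 1) (η η' : E3) :
    tangPart n η 0 * tangPart n η' 0 + tangPart n η 1 * tangPart n η' 1 +
      tangPart n η 2 * tangPart n η' 2 = inner ℝ η η' - inner ℝ n η * inner ℝ n η' := by
  have h := unit_sum hn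
  simp only [tangPart, inner_eq_sum, Pi.sub_apply, Pi.smul_apply, smul_eq_mul]
  linear_combination
    (n 0 * η 0 + n 1 * η 1 + n 2 * η 2) * (n 0 * η' 0 + n 1 * η' 1 + n 2 * η' 2) * h

lemma tangPart_zero (n : E3) : tangPart n 0 = 0 := by simp [tangPart]

section normalForm
variable {c : ℝ} {W : Set E3} {F : E3 → E3 → Ambient} {t C : E3 → ℝ}

lemma IsNormalForm.isSolutionVar (hF : IsNormalForm c W F t C) {x : E3} (hx : x ∈ W) (w : E3) :
    IsSolutionVar c x (t x) (C x) w (fderiv ℝ t x w) (fderiv ℝ C x w)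
      (fderiv ℝ (fun x : E3 => x 1 / (2 * quarterRoot c (t x))) x w)
      (fderiv ℝ (fun x : E3 => x 2 / (2 * quarterRoot c (t x))) x w) :=
  _root_.isSolutionVar hF.isOpen hF.smooth_t hF.smooth_C hF.sol hx w

lemma IsNormalForm.eq_boltPt (hF : IsNormalForm c W F t C) {x n : E3} (hx : x ∈ W)
    (hn : ‖n‖ = 1) : F x n = boltPt (t x) (C x) (x 1 / (2 * quarterRoot c (t x)))
      (x 2 / (2 * quarterRoot c (t x))) n.ofLp := by
  have hn0 : n ≠ 0 := by rintro rfl; simp at hn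
  rw [hF.eq x hx n hn0, unitVec_of_norm hn]; rfl

lemma IsNormalForm.bsMetric_trivDeriv (hF : IsNormalForm c W F t C) {x n : E3} (hx : x ∈ W)
    (hn : ‖n‖ = 1) (w η w' η' : E3) :
    bsMetric c (F x n) (trivDeriv F x n (w, η)) (trivDeriv F x n (w', η')) =
      solMetric c (t x) (C x) x w w' + boltScale c (t x) (C x) *
        (tangPart n η 0 * tangPart n η' 0 + tangPart n η 1 * tangPart n η' 1 +
          tangPart n η 2 * tangPart n η' 2) := by
  have hs := hF.sol x hx
  have h := hF.isSolutionVar hx w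
  have h' := hF.isSolutionVar hx w'
  rw [hF.trivDeriv_eq hx hn, hF.trivDeriv_eq hx hn, hF.eq_boltPt hx hn, boltOfVar, boltOfVar,
    ← h.metric_eq hs h']
  exact bsMetric_boltPtVar (unit_sum hn) (tangPart_perp hn η) (tangPart_perp hn η') hs.sphere hs.pos
    h.sphere h'.sphere

lemma IsNormalForm.bsForm_trivDeriv (hF : IsNormalForm c W F t C) {x n : E3} (hx : x ∈ W)
    (hn : ‖n‖ = 1) (w η η' : E3) :
    bsForm c (F x n) (trivDeriv F x n (w, 0)) (trivDeriv F x n (0, η)) (trivDeriv F x n (0, η')) =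
      -(2 * C x * quarterRoot c (t x) * w 0 -
        t x / (2 * quarterRoot c (t x)) * (x 1 * w 1 + x 2 * w 2)) *
        tripleProd n.ofLp (tangPart n η) (tangPart n η') := by
  have hs := hF.sol x hx
  have h := hF.isSolutionVar hx w
  rw [hF.trivDeriv_eq hx hn, hF.trivDeriv_eq hx hn, hF.trivDeriv_eq hx hn, hF.eq_boltPt hx hn,
    boltOfVar, boltOfVar, boltOfVar, ← h.form_eq hs]
  simp only [map_zero]
  have h0 : (0 : E3).ofLp - (inner ℝ n 0 : ℝ) • n.ofLp = 0 := tangPart_zero n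
  rw [h0]
  exact bsForm_boltPtVar (unit_sum hn) (tangPart_perp hn η) (tangPart_perp hn η') hs.sphere hs.pos
    h.sphere

lemma IsNormalForm.pushDensity_eq (hF : IsNormalForm c W F t C) {x n : E3} (hx : x ∈ W)
    (hn : ‖n‖ = 1) (w : E3) :
    pushDensity c F x w n = -(2 * C x * quarterRoot c (t x) * w 0 -
        t x / (2 * quarterRoot c (t x)) * (x 1 * w 1 + x 2 * w 2)) := by
  have h := unit_sum hn
  simp only [pushDensity, hF.bsForm_trivDeriv hx hn]
  simp [tripleProd, tangPart, inner_eq_sum, stdVec]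
  linear_combination (-(2 * C x * quarterRoot c (t x) * w 0 -
        t x / (2 * quarterRoot c (t x)) * (x 1 * w 1 + x 2 * w 2))) * h

theorem IsNormalForm.pushforwardForm_eq (hF : IsNormalForm c W F t C) {x : E3} (hx : x ∈ W) :
    pushforwardForm c F x = solForm c (t x) (C x) x := by
  have key : ∀ w : E3, ∫ n : Metric.sphere (0 : E3) 1, pushDensity c F x w n
      ∂(volume : Measure E3).toSphere = solForm c (t x) (C x) x w := by
    intro w
    have : ∀ n : Metric.sphere (0 : E3) 1, pushDensity c F x w n = _ := fun n =>
      hF.pushDensity_eq hx (by simp) w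
    simp only [this]
    rw [integral_sphere_const, solForm_apply]
    ring
  ext w
  simp only [pushforwardForm, key]
  have hw : w = ∑ i, w i • stdVec i := by
    ext j; fin_cases j <;> simp [stdVec, Fin.sum_univ_three]
  conv_rhs => rw [hw, map_sum]
  simp [mul_comm]

/-- The lift $(w,0)$ is orthogonal to the bolt, so any additional $\eta$ adds $a$ times its squared
tangential length. -/
theorem isPushforwardMetric_baseMetric (hc : 0 ≤ c) : IsPushforwardMetric c (baseMetric c) := by
  intro W F hF x hx n hn w
  obtain ⟨t, C, hN⟩ := hF.exists_isNormalForm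
  have hs := hN.sol x hx
  rw [baseMetric_eq hc hs]
  constructor
  · refine ⟨0, by simp, ?_⟩
    rw [hN.bsMetric_trivDeriv hx hn, tangPart_zero]
    simp
  · rintro q ⟨η, -, rfl⟩
    rw [hN.bsMetric_trivDeriv hx hn]
    have := hs.boltScale_pos
    have h2 : 0 ≤ boltScale c (t x) (C x) *
        (tangPart n η 0 * tangPart n η 0 + tangPart n η 1 * tangPart n η 1 +
          tangPart n η 2 * tangPart n η 2) := by
      have := mul_self_nonneg (tangPart n η 0)
      have := mul_self_nonneg (tangPart n η 1)
      have := mul_self_nonneg (tangPart n η 2)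
      positivity
    linarith

/-- The Gram matrix is $a(\delta_{ij}-n_in_j)$, whose principal $2\times2$ minors add up to $a^2$.
-/
theorem IsNormalForm.boltArea_eq (hF : IsNormalForm c W F t C) {x : E3} (hx : x ∈ W) :
    boltArea c F x = 4 * Real.pi * boltScale c (t x) (C x) := by
  have ha := (hF.sol x hx).boltScale_pos
  rw [boltArea, ← integral_sphere_const]
  congr 1
  funext n
  have hn : ‖(n : E3)‖ = 1 := by simp
  have h := unit_sum hn
  have hG : ∀ i j : Fin 3, tangPart n (stdVec i) 0 * tangPart n (stdVec j) 0 +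
      tangPart n (stdVec i) 1 * tangPart n (stdVec j) 1 +
      tangPart n (stdVec i) 2 * tangPart n (stdVec j) 2 =
      (if i = j then 1 else 0) - (n : E3) i * (n : E3) j := by
    intro i j
    rw [tangPart_dot hn]
    fin_cases i <;> fin_cases j <;> simp [inner_eq_sum, stdVec]
  simp only [hF.bsMetric_trivDeriv hx hn, map_zero, hG, zero_add]
  rw [Real.sqrt_eq_iff_mul_self_eq_of_pos ha]
  simp
  linear_combination (2 * boltScale c (t x) (C x) ^ 2) * h

theorem boltSize_eq (hc : 0 ≤ c) {x : E3} {t C : ℝ} (h : IsBoltSolution c x t C) {m : Ambient}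
    (hm : m ∈ bolt c x) : boltSize c m = boltScale c t C := by
  obtain ⟨n, t', C', hn, h', rfl⟩ := exists_of_mem_bolt hm
  have e : boltScale c t C = boltScale c t' C' := by
    rcases h.eq_or_eq_neg hc h' with ⟨h1, h2⟩ | ⟨h1, h2⟩
    · rw [h1, h2]
    · rw [h1, h2, boltScale_neg]
  have hq := quarterRoot_pos h'.pos
  have hcos : (boltOf c x t' C' n).1 0 ^ 2 + (boltOf c x t' C' n).1 1 ^ 2 +
      (boltOf c x t' C' n).1 2 ^ 2 = C' ^ 2 := by
    simp [boltOf, boltPt]; linear_combination C' ^ 2 * hn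
  have hr : radiusSq (boltOf c x t' C' n) = t' ^ 2 := radiusSq_boltPt hn h'.sphere
  rw [e, boltSize]
  simp only [hcos, hr, sqrt_eq_quarterRoot_sq h'.pos, boltScale]
  have h4 := quarterRoot_pow_four h'.pos
  field_simp
  linear_combination -2 * C' ^ 2 * h4

end normalForm

/-! ### Positive definite bilinear forms -/

lemma exists_equiv_of_pos {B : E3 →L[ℝ] E3 →L[ℝ] ℝ} (hB : ∀ v, v ≠ 0 → 0 < B v v) :
    ∃ e : E3 ≃L[ℝ] (E3 →L[ℝ] ℝ), (e : E3 →L[ℝ] E3 →L[ℝ] ℝ) = B := by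
  have hdim : Module.finrank ℝ E3 = Module.finrank ℝ (E3 →L[ℝ] ℝ) := by
    rw [← (LinearMap.toContinuousLinearMap : (E3 →ₗ[ℝ] ℝ) ≃ₗ[ℝ] (E3 →L[ℝ] ℝ)).finrank_eq]
    exact Subspace.dual_finrank_eq.symm
  have hinj : Function.Injective (B : E3 →ₗ[ℝ] (E3 →L[ℝ] ℝ)) := by
    rw [← LinearMap.ker_eq_bot, LinearMap.ker_eq_bot']
    intro v hv
    by_contra hne
    have h := hB v hne
    have hv' : B v = 0 := hv
    simp [hv'] at h
  refine ⟨(LinearMap.linearEquivOfInjective _ hinj hdim).toContinuousLinearEquiv, ?_⟩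
  ext v w
  rfl

/-- Positive definiteness makes $B$ invertible, so a dual vector can be guessed and then checked. -/
lemma inverse_apply_eq {B : E3 →L[ℝ] E3 →L[ℝ] ℝ} (hB : ∀ v, v ≠ 0 → 0 < B v v) {z : E3}
    {l : E3 →L[ℝ] ℝ} (h : B z = l) : B.inverse l = z := by
  obtain ⟨e, rfl⟩ := exists_equiv_of_pos hB
  rw [ContinuousLinearMap.inverse_equiv, ← h]
  simp

/-! ### Smoothness and positivity of the metric on the base -/

lemma IsBoltSolution.coeff_nonneg {c : ℝ} (hc : 0 ≤ c) {x : E3} {t C : ℝ}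
    (h : IsBoltSolution c x t C) :
    0 ≤ (2 * c + t ^ 2) / (8 * boltScale c t C * quarterRoot c t ^ 4) := by
  have := h.boltScale_pos
  have := quarterRoot_pos h.pos
  positivity

lemma IsBoltSolution.solMetric_pos {c : ℝ} (hc : 0 ≤ c) {x : E3} {t C : ℝ}
    (h : IsBoltSolution c x t C) {v : E3} (hv : v ≠ 0) : 0 < solMetric c t C x v v := by
  have ha := h.boltScale_pos
  have h3 := mul_nonneg (h.coeff_nonneg hc) (mul_self_nonneg (x 1 * v 1 + x 2 * v 2))
  rw [solMetric_apply]
  have hv' : v 0 ≠ 0 ∨ v 1 ≠ 0 ∨ v 2 ≠ 0 := by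
    by_contra! h0
    apply hv
    ext i; fin_cases i
    · exact h0.1
    · exact h0.2.1
    · exact h0.2.2
  have e0 := mul_self_nonneg (v 0)
  have e1 := mul_self_nonneg (v 1)
  have e2 := mul_self_nonneg (v 2)
  have e3 : 0 < 2 / boltScale c t C := by positivity
  have e4 := mul_nonneg e3.le e0
  rcases hv' with h0 | h0 | h0
  · have := mul_pos e3 (mul_self_pos.2 h0)
    linarith
  · have := mul_self_pos.2 h0
    linarith
  · have := mul_self_pos.2 h0
    linarith

lemma solMetric_symm (c t C : ℝ) (x v w : E3) : solMetric c t C x v w = solMetric c t C x w v := by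
  simp only [solMetric_apply]; ring

section smooth
variable {c : ℝ} {W : Set E3} {t C : E3 → ℝ}

lemma contDiffOn_boltScale (ht : ContDiffOn ℝ ∞ t W) (hC : ContDiffOn ℝ ∞ C W)
    (h : ∀ x ∈ W, IsBoltSolution c x (t x) (C x)) :
    ContDiffOn ℝ ∞ (fun x => boltScale c (t x) (C x)) W := by
  have hq := ht.quarterRoot fun x hx => (h x hx).pos
  have hq0 : ∀ x ∈ W, quarterRoot c (t x) ^ 2 ≠ 0 := fun x hx =>
    (pow_pos (quarterRoot_pos (h x hx).pos) 2).ne'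
  simp only [boltScale]
  exact ((contDiffOn_const.mul (hq.pow 2)).mul (hC.pow 2)).add
    (((ht.pow 2).mul (contDiffOn_const.sub (hC.pow 2))).div (hq.pow 2) hq0)

lemma contDiff_radialForm : ContDiff ℝ ∞ radialForm := by
  unfold radialForm
  fun_prop

lemma contDiffOn_solMetric (ht : ContDiffOn ℝ ∞ t W) (hC : ContDiffOn ℝ ∞ C W)
    (h : ∀ x ∈ W, IsBoltSolution c x (t x) (C x)) :
    ContDiffOn ℝ ∞ (fun x => solMetric c (t x) (C x) x) W := by
  have hq := ht.quarterRoot fun x hx => (h x hx).pos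
  have ha := contDiffOn_boltScale ht hC h
  have ha0 : ∀ x ∈ W, boltScale c (t x) (C x) ≠ 0 := fun x hx => (h x hx).boltScale_pos.ne'
  have hq0 : ∀ x ∈ W, quarterRoot c (t x) ≠ 0 := fun x hx => (quarterRoot_pos (h x hx).pos).ne'
  have hd : ∀ x ∈ W, 8 * boltScale c (t x) (C x) * quarterRoot c (t x) ^ 4 ≠ 0 := fun x hx => by
    have := ha0 x hx
    have := hq0 x hx
    positivity
  refine contDiffOn_clm_apply.2 fun v => contDiffOn_clm_apply.2 fun w => ?_
  simp only [solMetric_apply]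
  refine (((contDiffOn_const.div ha ha0).mul contDiffOn_const).add contDiffOn_const).add
    (((contDiffOn_const.add (ht.pow 2)).div ((contDiffOn_const.mul ha).mul (hq.pow 4)) hd).mul
      (ContDiff.contDiffOn ?_))
  fun_prop

lemma contDiffOn_solForm (ht : ContDiffOn ℝ ∞ t W) (hC : ContDiffOn ℝ ∞ C W)
    (h : ∀ x ∈ W, IsBoltSolution c x (t x) (C x)) :
    ContDiffOn ℝ ∞ (fun x => solForm c (t x) (C x) x) W := by
  have hq := ht.quarterRoot fun x hx => (h x hx).pos
  have hq0 : ∀ x ∈ W, quarterRoot c (t x) ≠ 0 := fun x hx => (quarterRoot_pos (h x hx).pos).ne'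
  unfold solForm
  refine ContDiffOn.const_smul _ ((ContDiffOn.smul ((contDiffOn_const.mul hC).mul hq)
    contDiffOn_const).sub (ContDiffOn.smul (ht.div (contDiffOn_const.mul hq) ?_)
      contDiff_radialForm.contDiffOn))
  intro x hx
  have := hq0 x hx
  positivity

end smooth

theorem isRiemannianMetricOn_baseMetric {c : ℝ} (hc : 0 ≤ c) :
    IsRiemannianMetricOn (baseMetric c) (singularCircle c)ᶜ := by
  refine ⟨fun x hx => ?_, fun x hx v w => ?_, fun x hx v hv => ?_⟩ <;>
  obtain ⟨W, hW, hxW, t, C, ht, hC, h⟩ := exists_local_solution hc hx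
  · refine ContDiffAt.contDiffWithinAt ?_
    refine ((contDiffOn_solMetric ht hC h).contDiffAt (hW.mem_nhds hxW)).congr_of_eventuallyEq ?_
    filter_upwards [hW.mem_nhds hxW] with y hy
    exact baseMetric_eq hc (h y hy)
  · rw [baseMetric_eq hc (h x hxW), solMetric_symm]
  · rw [baseMetric_eq hc (h x hxW)]
    exact (h x hxW).solMetric_pos hc hv

/-! ### The pushforward form is dual to a divergence-free vector field -/

/-- The vector field metrically dual to `solForm`, without the factor `-4 π a / q`. -/
noncomputable def solField (c t C : ℝ) (x : E3) : E3 :=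
  !₂[quarterRoot c t ^ 2 * C, -(x 1 * t / (2 * quarterRoot c t ^ 2)),
    -(x 2 * t / (2 * quarterRoot c t ^ 2))]

section pointwise
variable {c : ℝ} {x : E3} {t C : ℝ}

lemma IsBoltSolution.boltScale_mul (h : IsBoltSolution c x t C) :
    boltScale c t C * quarterRoot c t ^ 2 =
      2 * quarterRoot c t ^ 4 * C ^ 2 + t ^ 2 * (1 - C ^ 2) := by
  have hq := quarterRoot_pos h.pos
  rw [boltScale]; field_simp

lemma IsBoltSolution.solMetric_solField (h : IsBoltSolution c x t C) :
    solMetric c t C x ((-(4 * Real.pi) * (boltScale c t C / quarterRoot c t)) • solField c t C x) =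
      solForm c t C x := by
  have hq := quarterRoot_pos h.pos
  have ha := h.boltScale_pos
  have hc : c = quarterRoot c t ^ 4 - t ^ 2 := by rw [quarterRoot_pow_four h.pos]; ring
  have ea := h.boltScale_mul
  have hsq := h.sq
  ext w
  rw [solMetric_apply, solForm_apply, show 2 * c + t ^ 2 = 2 * quarterRoot c t ^ 4 - t ^ 2 by linarith]
  simp only [solField, PiLp.smul_apply, smul_eq_mul, Matrix.cons_val_zero, Matrix.cons_val_one,
    Matrix.cons_val]
  set q := quarterRoot c t
  set a := boltScale c t C
  clear_value q a
  have e : x 1 * (-(4 * Real.pi) * (a / q) * -(x 1 * t / (2 * q ^ 2))) +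
      x 2 * (-(4 * Real.pi) * (a / q) * -(x 2 * t / (2 * q ^ 2))) =
      (4 * Real.pi) * (a / q) * (t / (2 * q ^ 2)) * (4 * (1 - C ^ 2) * q ^ 2) := by
    rw [← hsq]; ring
  rw [e]
  field_simp
  linear_combination (8 * t * (w 1 * x 1 + w 2 * x 2)) * ea

lemma IsBoltSolution.solForm_solField (h : IsBoltSolution c x t C) :
    solForm c t C x ((-(4 * Real.pi) * (boltScale c t C / quarterRoot c t)) • solField c t C x) =
      (4 * Real.pi * boltScale c t C) ^ 2 := by
  have hq := quarterRoot_pos h.pos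
  have ha := h.boltScale_pos
  have ea := h.boltScale_mul
  have hsq := h.sq
  rw [solForm_apply]
  simp only [solField, PiLp.smul_apply, smul_eq_mul, Matrix.cons_val_zero, Matrix.cons_val_one,
    Matrix.cons_val]
  set q := quarterRoot c t
  set a := boltScale c t C
  clear_value q a
  have e : x 1 * (-(4 * Real.pi) * (a / q) * -(x 1 * t / (2 * q ^ 2))) +
      x 2 * (-(4 * Real.pi) * (a / q) * -(x 2 * t / (2 * q ^ 2))) =
      (4 * Real.pi) * (a / q) * (t / (2 * q ^ 2)) * (4 * (1 - C ^ 2) * q ^ 2) := by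
    rw [← hsq]; ring
  rw [e]
  field_simp
  linear_combination -4 * ea

/-- Its root $q/a$ cancels the factor $a/q$ of the dual vector in `IsBoltSolution.hodgeStar_eq`. -/
lemma IsBoltSolution.det_solMetric (h : IsBoltSolution c x t C) :
    (Matrix.of fun i j => solMetric c t C x (stdVec i) (stdVec j)).det =
      (quarterRoot c t / boltScale c t C) ^ 2 := by
  have hq := quarterRoot_pos h.pos
  have ha := h.boltScale_pos
  have hc : c = quarterRoot c t ^ 4 - t ^ 2 := by rw [quarterRoot_pow_four h.pos]; ring
  have ea := h.boltScale_mul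
  have hsq := h.sq
  rw [Matrix.det_fin_three]
  simp only [Matrix.of_apply, solMetric_apply]
  rw [show 2 * c + t ^ 2 = 2 * quarterRoot c t ^ 4 - t ^ 2 by linarith]
  simp [stdVec]
  set q := quarterRoot c t
  set a := boltScale c t C
  clear_value q a
  generalize hk : (2 * q ^ 4 - t ^ 2) / (8 * a * q ^ 4) = κ
  have e : 2 / a * (1 / 4 + κ / 2 * (4 * (1 - C ^ 2) * q ^ 2)) = (q / a) ^ 2 := by
    rw [← hk]
    field_simp
    linear_combination 16 * ea
  rw [← e, ← hsq]
  ring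

lemma IsBoltSolution.sharp_eq (hc : 0 ≤ c) (h : IsBoltSolution c x t C)
    {g : E3 → E3 →L[ℝ] E3 →L[ℝ] ℝ} {l : E3 → E3 →L[ℝ] ℝ} (hg : g x = solMetric c t C x)
    (hl : l x = solForm c t C x) :
    sharp g l x = (-(4 * Real.pi) * (boltScale c t C / quarterRoot c t)) • solField c t C x := by
  rw [sharp, hg, hl]
  exact inverse_apply_eq (fun v hv => h.solMetric_pos hc hv) h.solMetric_solField

lemma IsBoltSolution.formNorm_eq (hc : 0 ≤ c) (h : IsBoltSolution c x t C)
    {g : E3 → E3 →L[ℝ] E3 →L[ℝ] ℝ} {l : E3 → E3 →L[ℝ] ℝ} (hg : g x = solMetric c t C x)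
    (hl : l x = solForm c t C x) : formNorm g l x = 4 * Real.pi * boltScale c t C := by
  have ha := h.boltScale_pos
  rw [formNorm, h.sharp_eq hc hg hl, hl, h.solForm_solField, Real.sqrt_sq (by positivity)]

lemma IsBoltSolution.hodgeStar_eq (hc : 0 ≤ c) (h : IsBoltSolution c x t C)
    {g : E3 → E3 →L[ℝ] E3 →L[ℝ] ℝ} {l : E3 → E3 →L[ℝ] ℝ} (hg : g x = solMetric c t C x)
    (hl : l x = solForm c t C x) :
    hodgeStar g l x = stdVol.curryLeft ((-(4 * Real.pi)) • solField c t C x) := by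
  have hq := quarterRoot_pos h.pos
  have ha := h.boltScale_pos
  rw [hodgeStar, h.sharp_eq hc hg hl, metricVol, hg, h.det_solMetric, Real.sqrt_sq (by positivity)]
  ext v
  simp only [map_smul, ContinuousAlternatingMap.smul_apply,
    ContinuousAlternatingMap.curryLeft_apply_apply, smul_eq_mul]
  field_simp

lemma IsSolutionVar.radial_eq (h : IsBoltSolution c x t C) {w : E3} {T C' d₁ d₂ : ℝ}
    (hv : IsSolutionVar c x t C w T C' d₁ d₂) :
    x 1 * w 1 + x 2 * w 2 = -(4 * quarterRoot c t ^ 2 * C * C') +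
      2 * t * T * (1 - C ^ 2) / quarterRoot c t ^ 2 := by
  have hq := quarterRoot_pos h.pos
  have hsph := h.sphere
  have s1 := hv.sphere
  rw [← hv.y₁, ← hv.y₂]
  have ex1 : x 1 = 2 * quarterRoot c t * (x 1 / (2 * quarterRoot c t)) := by field_simp
  have ex2 : x 2 = 2 * quarterRoot c t * (x 2 / (2 * quarterRoot c t)) := by field_simp
  rw [ex1, ex2]
  simp only [mul_div_cancel_left₀ _ (show (2 * quarterRoot c t) ≠ 0 by positivity)]
  generalize x 1 / (2 * quarterRoot c t) = y₁ at *
  generalize x 2 / (2 * quarterRoot c t) = y₂ at *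
  set q := quarterRoot c t
  clear_value q
  field_simp
  linear_combination 4 * q ^ 4 * s1 + 2 * t * T * hsph

/-- This and the next lemma solve the linear equations for $du$ and $v\,dv$ in the unknowns $T,C'$,
whose determinant is $-2a$. -/
lemma IsSolutionVar.deriv_t (h : IsBoltSolution c x t C) {w : E3} {T C' d₁ d₂ : ℝ}
    (hv : IsSolutionVar c x t C w T C' d₁ d₂) :
    T = (2 * C * quarterRoot c t ^ 2 * w 0 + t * (x 1 * w 1 + x 2 * w 2) / 2) /
      boltScale c t C := by
  have hq := quarterRoot_pos h.pos
  rw [eq_div_iff h.boltScale_pos.ne', hv.radial_eq h, ← hv.mul, boltScale]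
  field_simp
  ring

lemma IsSolutionVar.deriv_C (h : IsBoltSolution c x t C) {w : E3} {T C' d₁ d₂ : ℝ}
    (hv : IsSolutionVar c x t C w T C' d₁ d₂) :
    C' = ((1 - C ^ 2) * t / quarterRoot c t ^ 2 * w 0 - C * (x 1 * w 1 + x 2 * w 2) / 2) /
      boltScale c t C := by
  have hq := quarterRoot_pos h.pos
  rw [eq_div_iff h.boltScale_pos.ne', hv.radial_eq h, ← hv.mul, boltScale]
  field_simp
  ring

end pointwise

/-! ### The pushforward form is harmonic -/

lemma stdVol_apply (v : Fin 3 → E3) : stdVol v =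
    v 0 0 * v 1 1 * v 2 2 - v 0 0 * v 1 2 * v 2 1 - v 0 1 * v 1 0 * v 2 2 + v 0 1 * v 1 2 * v 2 0
      + v 0 2 * v 1 0 * v 2 1 - v 0 2 * v 1 1 * v 2 0 :=
  Matrix.det_fin_three fun i => (v i).ofLp

lemma eq_sum_stdVec (w : E3) : w = ∑ i, w i • stdVec i := by
  ext j; fin_cases j <;> simp [stdVec, Fin.sum_univ_three]

lemma clm_apply_eq_sum (A : E3 →L[ℝ] E3) (v : E3) (i : Fin 3) :
    A v i = v 0 * A (stdVec 0) i + v 1 * A (stdVec 1) i + v 2 * A (stdVec 2) i := by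
  conv_lhs => rw [eq_sum_stdVec v, map_sum]
  simp [Fin.sum_univ_three]

/-- This is $d(Y\lrcorner\mathrm{vol})=(\operatorname{div}Y)\,\mathrm{vol}$. -/
lemma extDeriv_curryLeft_stdVol {Y : E3 → E3} {x : E3} (hY : DifferentiableAt ℝ Y x)
    (h : fderiv ℝ Y x (stdVec 0) 0 + fderiv ℝ Y x (stdVec 1) 1 + fderiv ℝ Y x (stdVec 2) 2 = 0) :
    extDeriv (fun y => stdVol.curryLeft (Y y)) x = 0 := by
  have hd : HasFDerivAt (fun y => stdVol.curryLeft (Y y)) (stdVol.curryLeft ∘L fderiv ℝ Y x) x :=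
    stdVol.curryLeft.hasFDerivAt.comp x hY.hasFDerivAt
  have hd' : ∀ (v : Fin 2 → E3) (w : E3),
      fderiv ℝ (fun y => stdVol.curryLeft (Y y) v) x w = stdVol ![fderiv ℝ Y x w, v 0, v 1] := by
    intro v w
    have h1 : HasDerivAt (fun r : ℝ => stdVol.curryLeft (Y (x + r • w)))
        (stdVol.curryLeft (fderiv ℝ Y x w)) 0 :=
      hd.comp_hasDerivAt_of_eq 0 (hasDerivAt_line x w) (by simp)
    have h2 : DifferentiableAt ℝ (fun y => stdVol.curryLeft (Y y) v) x := by
      have := (ContinuousAlternatingMap.apply ℝ E3 ℝ v).differentiableAt.comp x hd.differentiableAt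
      exact this
    have h3 := (ContinuousAlternatingMap.apply ℝ E3 ℝ v).hasFDerivAt.comp_hasDerivAt 0 h1
    rw [(hasDerivAt_comp_line h2 w).unique h3]
    change stdVol.curryLeft (fderiv ℝ Y x w) v = _
    rw [ContinuousAlternatingMap.curryLeft_apply_apply]
    congr 1
    ext i; fin_cases i <;> rfl
  ext v
  rw [extDeriv_apply hd.differentiableAt, Fin.sum_univ_three]
  simp only [hd', stdVol_apply, Fin.removeNth, Matrix.cons_val_zero,
    Matrix.cons_val_one, Matrix.cons_val, clm_apply_eq_sum (fderiv ℝ Y x) (v _)]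
  simp [Fin.succAbove, -neg_add_rev]
  linear_combination (v 0 0 * v 1 1 * v 2 2 - v 0 0 * v 1 2 * v 2 1 - v 0 1 * v 1 0 * v 2 2 +
    v 0 1 * v 1 2 * v 2 0 + v 0 2 * v 1 0 * v 2 1 - v 0 2 * v 1 1 * v 2 0) * h

lemma extDeriv_asForm_eq_zero {l : E3 → E3 →L[ℝ] ℝ} {x : E3} (hl : DifferentiableAt ℝ l x)
    (h : ∀ v w, fderiv ℝ (fun y => l y w) x v = fderiv ℝ (fun y => l y v) x w) :
    extDeriv (asForm l) x = 0 := by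
  have hd : DifferentiableAt ℝ (asForm l) x :=
    (ContinuousAlternatingMap.ofSubsingletonLIE (0 : Fin 1) :
      (E3 →L[ℝ] ℝ) ≃ₗᵢ[ℝ] E3 [⋀^Fin 1]→L[ℝ] ℝ).toContinuousLinearEquiv.differentiableAt.comp x hl
  ext v
  rw [extDeriv_apply hd, Fin.sum_univ_two]
  have e : ∀ w : Fin 1 → E3, (fun y => asForm l y w) = fun y => l y (w 0) := fun w => rfl
  simp only [e]
  simp [Fin.removeNth]
  rw [h]
  ring

lemma HasDerivAt.quarterRoot {c : ℝ} {f : ℝ → ℝ} {f' r : ℝ} (hf : HasDerivAt f f' r)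
    (h : 0 < c + f r ^ 2) : HasDerivAt (fun s => _root_.quarterRoot c (f s))
      (f r * f' / (2 * _root_.quarterRoot c (f r) ^ 3)) r := by
  have h1 := ((hf.pow 2).const_add c).rpow_const (p := 1 / 4) (Or.inl h.ne')
  refine h1.congr_deriv ?_
  have e := rpow_neg_three_quarters_eq h
  have : (1 / 4 - 1 : ℝ) = -(3 / 4) := by norm_num
  simp only [this, Pi.pow_apply, e]
  have hq := quarterRoot_pos h
  field_simp
  ring

section harmonic
variable {c : ℝ} {W : Set E3} {t C : E3 → ℝ}

lemma hasDerivAt_coord_line (x w : E3) (i : Fin 3) :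
    HasDerivAt (fun r : ℝ => (x + r • w) i) (w i) 0 := by
  simpa using ((hasDerivAt_id (0 : ℝ)).mul_const (w i)).const_add (x i)

lemma extDeriv_solForm (hW : IsOpen W) (ht : ContDiffOn ℝ ∞ t W) (hC : ContDiffOn ℝ ∞ C W)
    (h : ∀ x ∈ W, IsBoltSolution c x (t x) (C x)) {x : E3} (hx : x ∈ W) :
    extDeriv (asForm fun y => solForm c (t y) (C y) y) x = 0 := by
  have hl := (contDiffOn_solForm ht hC h).differentiableAt_of_isOpen hW hx
  have hs := h x hx
  have hq := quarterRoot_pos hs.pos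
  have ha := hs.boltScale_pos
  have key : ∀ v w, fderiv ℝ (fun y => solForm c (t y) (C y) y w) x v =
      -(4 * Real.pi) * ((2 * fderiv ℝ C x v * quarterRoot c (t x) +
        C x * (t x * fderiv ℝ t x v) / quarterRoot c (t x) ^ 3) * w 0 -
        (fderiv ℝ t x v / (2 * quarterRoot c (t x)) -
          t x * (t x * fderiv ℝ t x v) / (4 * quarterRoot c (t x) ^ 5)) *
          (x 1 * w 1 + x 2 * w 2) -
        t x / (2 * quarterRoot c (t x)) * (v 1 * w 1 + v 2 * w 2)) := by
    intro v w
    have lt := hasDerivAt_comp_line (ht.differentiableAt_of_isOpen hW hx) v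
    have lC := hasDerivAt_comp_line (hC.differentiableAt_of_isOpen hW hx) v
    have lq := lt.quarterRoot (c := c) (by simpa using hs.pos)
    have l1 := hasDerivAt_coord_line x v 1
    have l2 := hasDerivAt_coord_line x v 2
    have lmain := ((((lC.const_mul 2).mul lq).mul_const (w 0)).sub
      ((lt.div (lq.const_mul 2) (by simpa using hq.ne')).mul
        ((l1.mul_const (w 1)).add (l2.mul_const (w 2))))).const_mul (-(4 * Real.pi))
    have hdw : DifferentiableAt ℝ (fun y => solForm c (t y) (C y) y w) x :=
      hl.clm_apply (differentiableAt_const w)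
    have h1 := (hasDerivAt_comp_line hdw v).unique
      (lmain.congr_of_eventuallyEq (Filter.Eventually.of_forall fun r => solForm_apply _ _ _ _ _))
    rw [h1]
    simp only [zero_smul, add_zero, Pi.mul_apply, Pi.add_apply, Pi.div_apply]
    field_simp
    ring
  refine extDeriv_asForm_eq_zero hl fun v w => ?_
  have hv := isSolutionVar hW ht hC h hx v
  have hw := isSolutionVar hW ht hC h hx w
  -- With these derivatives inserted the expression is symmetric in $v$ and $w$.
  rw [key, key, hv.deriv_t hs, hv.deriv_C hs, hw.deriv_t hs, hw.deriv_C hs]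
  field_simp
  ring

lemma extDeriv_solField (hW : IsOpen W) (ht : ContDiffOn ℝ ∞ t W) (hC : ContDiffOn ℝ ∞ C W)
    (h : ∀ x ∈ W, IsBoltSolution c x (t x) (C x)) {x : E3} (hx : x ∈ W) :
    extDeriv (fun y => stdVol.curryLeft ((-(4 * Real.pi)) • solField c (t y) (C y) y)) x = 0 := by
  have hs := h x hx
  have hq := quarterRoot_pos hs.pos
  have ha := hs.boltScale_pos
  have hqs := ht.quarterRoot fun x hx => (h x hx).pos
  have hq0 : ∀ x ∈ W, 2 * quarterRoot c (t x) ^ 2 ≠ 0 := fun x hx => by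
    have := quarterRoot_pos (h x hx).pos
    positivity
  have hY : ContDiffOn ℝ ∞ (fun y => solField c (t y) (C y) y) W := by
    rw [contDiffOn_euclidean]
    intro i
    have hi : ∀ i : Fin 3, ContDiffOn ℝ ∞
        (fun y : E3 => -(y i * t y / (2 * quarterRoot c (t y) ^ 2))) W := fun i =>
      ((ContDiffOn.mul (ContDiff.contDiffOn (by fun_prop)) ht).div
        (contDiffOn_const.mul (hqs.pow 2)) hq0).neg
    fin_cases i
    · exact (hqs.pow 2).mul hC
    · exact hi 1
    · exact hi 2
  have hYd := hY.differentiableAt_of_isOpen hW hx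
  have hcomp : ∀ (i : Fin 3) (w : E3), HasDerivAt (fun r : ℝ => solField c (t (x + r • w))
      (C (x + r • w)) (x + r • w) i) (fderiv ℝ (fun y => solField c (t y) (C y) y) x w i) 0 := by
    intro i w
    have h1 : HasDerivAt (fun r : ℝ => solField c (t (x + r • w)) (C (x + r • w)) (x + r • w))
        (fderiv ℝ (fun y => solField c (t y) (C y) y) x w) 0 :=
      hYd.hasFDerivAt.comp_hasDerivAt_of_eq 0 (hasDerivAt_line x w) (by simp)
    exact (EuclideanSpace.proj i : E3 →L[ℝ] ℝ).hasFDerivAt.comp_hasDerivAt 0 h1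
  have e0 : fderiv ℝ (fun y => solField c (t y) (C y) y) x (stdVec 0) 0 =
      t x * fderiv ℝ t x (stdVec 0) / quarterRoot c (t x) ^ 2 * C x +
        quarterRoot c (t x) ^ 2 * fderiv ℝ C x (stdVec 0) := by
    have lt := hasDerivAt_comp_line (ht.differentiableAt_of_isOpen hW hx) (stdVec 0)
    have lC := hasDerivAt_comp_line (hC.differentiableAt_of_isOpen hW hx) (stdVec 0)
    have lq := lt.quarterRoot (c := c) (by simpa using hs.pos)
    rw [(hcomp 0 _).unique ((lq.pow 2).mul lC)]
    simp only [zero_smul, add_zero, Pi.mul_apply, Pi.pow_apply]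
    field_simp
    ring
  have ei : ∀ i : Fin 3, stdVec i i = (1 : ℝ) := by simp [stdVec]
  have e1 : ∀ i : Fin 3, i = 1 ∨ i = 2 →
      fderiv ℝ (fun y => solField c (t y) (C y) y) x (stdVec i) i =
      -((t x + x i * fderiv ℝ t x (stdVec i)) / (2 * quarterRoot c (t x) ^ 2) -
        x i * t x * (t x * fderiv ℝ t x (stdVec i)) / (2 * quarterRoot c (t x) ^ 6)) := by
    intro i hi
    have lt := hasDerivAt_comp_line (ht.differentiableAt_of_isOpen hW hx) (stdVec i)
    have lq := lt.quarterRoot (c := c) (by simpa using hs.pos)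
    have lx := hasDerivAt_coord_line x (stdVec i) i
    have l1 := (((lx.mul lt).div ((lq.pow 2).const_mul 2) (by simpa using hq.ne')).neg)
    have := (hcomp i (stdVec i)).unique (l1.congr_of_eventuallyEq
      (Filter.Eventually.of_forall fun r => by rcases hi with rfl | rfl <;> simp [solField]))
    rw [this]
    simp only [zero_smul, add_zero, Pi.mul_apply, Pi.pow_apply, ei]
    field_simp
    ring
  refine extDeriv_curryLeft_stdVol (hYd.fun_const_smul _) ?_
  rw [fderiv_fun_const_smul hYd]
  simp only [smul_apply, PiLp.smul_apply, smul_eq_mul, ← mul_add]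
  rw [e0, e1 1 (.inl rfl), e1 2 (.inr rfl)]
  have v0 := isSolutionVar hW ht hC h hx (stdVec 0)
  have v1 := isSolutionVar hW ht hC h hx (stdVec 1)
  have v2 := isSolutionVar hW ht hC h hx (stdVec 2)
  rw [v0.deriv_t hs, v0.deriv_C hs, v1.deriv_t hs, v2.deriv_t hs]
  have ea := hs.boltScale_mul
  have hsq := hs.sq
  simp [stdVec]
  generalize quarterRoot c (t x) = q at *
  generalize boltScale c (t x) (C x) = a at *
  clear v0 v1 v2 e0 e1 hcomp hYd hY hq0 hqs
  -- The contribution of the last two coordinates to the divergence, up to sign, reduced by means of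
  -- $v^2=4(1-C^2)q^2$ and the formula for $a$. It equals the contribution of the $u$-coordinate.
  have e : t x / q ^ 2 + (x 1 ^ 2 + x 2 ^ 2) * (t x / 2 / a) *
      (1 / (2 * q ^ 2) - t x ^ 2 / (2 * q ^ 6)) =
      (2 * t x * C x ^ 2 + (1 - C x ^ 2) * t x) / a := by
    rw [hsq]
    field_simp
    linear_combination (4 * t x) * ea
  refine Eq.trans ?_ (sub_eq_zero.2 e.symm)
  field_simp
  ring

theorem IsNormalForm.isHarmonicOn (hc : 0 ≤ c) {F : E3 → E3 → Ambient}
    (hF : IsNormalForm c W F t C) : IsHarmonicOn (baseMetric c) (pushforwardForm c F) W := by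
  refine ⟨(contDiffOn_solForm hF.smooth_t hF.smooth_C hF.sol).congr fun x hx =>
    hF.pushforwardForm_eq hx, fun x hx => ⟨?_, ?_⟩⟩
  · rw [← extDeriv_solForm hF.isOpen hF.smooth_t hF.smooth_C hF.sol hx]
    refine Filter.EventuallyEq.extDeriv_eq ?_
    filter_upwards [hF.isOpen.mem_nhds hx] with y hy
    rw [asForm, asForm, hF.pushforwardForm_eq hy]
  · rw [← extDeriv_solField hF.isOpen hF.smooth_t hF.smooth_C hF.sol hx]
    refine Filter.EventuallyEq.extDeriv_eq ?_
    filter_upwards [hF.isOpen.mem_nhds hx] with y hy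
    exact (hF.sol y hy).hodgeStar_eq hc (baseMetric_eq hc (hF.sol y hy)) (hF.pushforwardForm_eq hy)

end harmonic

/-! ### Rotations of the base -/

lemma rotBase_radial (ψ : ℝ) (x w : E3) :
    rotBase ψ x 1 * rotBase ψ w 1 + rotBase ψ x 2 * rotBase ψ w 2 = x 1 * w 1 + x 2 * w 2 := by
  simp [rotBase]
  linear_combination (x 1 * w 1 + x 2 * w 2) * Real.sin_sq_add_cos_sq ψ

lemma IsBoltSolution.of_rotBase {c : ℝ} {x : E3} {t C ψ : ℝ}
    (h : IsBoltSolution c (rotBase ψ x) t C) : IsBoltSolution c x t C where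
  mul := h.mul
  sq := by
    have := rotBase_radial ψ x x
    rw [← h.sq]
    linear_combination -this
  pos := h.pos
  ne := h.ne

lemma IsNormalForm.rotBase_eq {c : ℝ} (hc : 0 ≤ c) {W : Set E3} {F : E3 → E3 → Ambient}
    {t C : E3 → ℝ} (hF : IsNormalForm c W F t C) (hrot : ∀ ψ, MapsTo (rotBase ψ) W W) (ψ : ℝ)
    {x : E3} (hx : x ∈ W) : t (rotBase ψ x) = t x ∧ C (rotBase ψ x) = C x := by
  have hs := fun ψ => (hF.sol _ (hrot ψ hx)).of_rotBase
  rcases (hF.sol x hx).eq_or_eq_neg hc (hs ψ) with h | ⟨h1, h2⟩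
  · exact h
  exfalso
  -- Along the circle the solution can change only by a sign, so $f=\pm(t^2+C^2)$ never vanishes. A
  -- sign change would contradict the intermediate value theorem.
  let f : ℝ → ℝ := fun ψ => t x * t (rotBase ψ x) + C x * C (rotBase ψ x)
  have hcont : Continuous fun ψ => rotBase ψ x := by
    unfold rotBase
    fun_prop
  have hf : Continuous f := by
    have ht := hF.smooth_t.continuousOn.comp_continuous hcont fun ψ => hrot ψ hx
    have hC := hF.smooth_C.continuousOn.comp_continuous hcont fun ψ => hrot ψ hx
    exact (continuous_const.mul ht).add (continuous_const.mul hC)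
  have hpos : 0 < t x ^ 2 + C x ^ 2 := by
    rcases (hF.sol x hx).ne with h | h <;> positivity
  have h0 : rotBase 0 x = x := by
    ext i; fin_cases i <;> simp [rotBase]
  obtain ⟨φ, hφ⟩ : (0 : ℝ) ∈ range f := by
    refine mem_range_of_exists_le_of_exists_ge hf ⟨ψ, ?_⟩ ⟨0, ?_⟩
    · simp only [f, h1, h2]; linarith
    · simp only [f, h0]; linarith
  rcases (hF.sol x hx).eq_or_eq_neg hc (hs φ) with ⟨e1, e2⟩ | ⟨e1, e2⟩ <;>
  · simp only [f, e1, e2] at hφ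
    linarith

theorem IsNormalForm.pushforwardForm_rotBase {c : ℝ} (hc : 0 ≤ c) {W : Set E3}
    {F : E3 → E3 → Ambient} {t C : E3 → ℝ} (hF : IsNormalForm c W F t C)
    (hrot : ∀ ψ, MapsTo (rotBase ψ) W W) (ψ : ℝ) {x : E3} (hx : x ∈ W) (w : E3) :
    pushforwardForm c F (rotBase ψ x) (rotBase ψ w) = pushforwardForm c F x w := by
  obtain ⟨h1, h2⟩ := hF.rotBase_eq hc hrot ψ hx
  rw [hF.pushforwardForm_eq (hrot ψ hx), hF.pushforwardForm_eq hx, h1, h2, solForm_apply,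
    solForm_apply, rotBase_radial]
  rfl

/-! ### The values of the pushforward form -/

lemma IsBoltSolution.solForm_ne_zero {c : ℝ} {x : E3} {t C : ℝ} (h : IsBoltSolution c x t C) :
    solForm c t C x ≠ 0 := by
  intro h0
  have h1 := h.solForm_solField
  have := h.boltScale_pos
  rw [h0, zero_apply] at h1
  have : 0 < (4 * Real.pi * boltScale c t C) ^ 2 := by positivity
  linarith

lemma exists_of_mem_pushforwardValues {c : ℝ} {x : E3} {l : E3 →L[ℝ] ℝ}
    (hl : l ∈ pushforwardValues c x) :
    ∃ t C, IsBoltSolution c x t C ∧ l = solForm c t C x := by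
  obtain ⟨W, F, hF, hx, rfl⟩ := hl
  obtain ⟨t, C, hN⟩ := hF.exists_isNormalForm
  exact ⟨t x, C x, hN.sol x hx, hN.pushforwardForm_eq hx⟩

lemma solForm_mem_pushforwardValues {c : ℝ} (hc : 0 ≤ c) {W : Set E3} (hW : IsOpen W)
    {t C : E3 → ℝ} (ht : ContDiffOn ℝ ∞ t W) (hC : ContDiffOn ℝ ∞ C W)
    (h : ∀ x ∈ W, IsBoltSolution c x (t x) (C x)) {x : E3} (hx : x ∈ W) :
    solForm c (t x) (C x) x ∈ pushforwardValues c x := by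
  have hF := isBoltTrivialization_boltOf hc hW ht hC h
  have hN : IsNormalForm c W (fun x n => boltOf c x (t x) (C x) (unitVec n)) t C :=
    ⟨hW, hF.smooth, ht, hC, h, fun _ _ _ _ => rfl⟩
  exact ⟨W, _, hF, hx, (hN.pushforwardForm_eq hx).symm⟩

/-- The two solutions $\pm(t,C)$ give opposite forms, and each is realized by a local
trivialization. -/
theorem exists_pushforwardValues_eq {c : ℝ} (hc : 0 ≤ c) {x : E3} (hx : x ∉ singularCircle c) :
    ∃ l : E3 →L[ℝ] ℝ, l ≠ 0 ∧ pushforwardValues c x = {l, -l} := by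
  obtain ⟨W, hW, hxW, t, C, ht, hC, h⟩ := exists_local_solution hc hx
  refine ⟨solForm c (t x) (C x) x, (h x hxW).solForm_ne_zero, Subset.antisymm ?_ ?_⟩
  · intro l hl
    obtain ⟨t', C', h', rfl⟩ := exists_of_mem_pushforwardValues hl
    rcases (h x hxW).eq_or_eq_neg hc h' with ⟨h1, h2⟩ | ⟨h1, h2⟩
    · left; rw [h1, h2]
    · right; rw [h1, h2, solForm_neg]; rfl
  · rintro l (rfl | rfl)
    · exact solForm_mem_pushforwardValues hc hW ht hC h hxW
    · rw [← solForm_neg]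
      exact solForm_mem_pushforwardValues hc hW ht.neg hC.neg (fun y hy => (h y hy).neg) hxW

/-! ### Vanishing of the form at the singular circle -/

lemma abs_coord_le_norm (w : E3) (i : Fin 3) : |w i| ≤ ‖w‖ := by
  simpa using PiLp.norm_apply_le w i

/-- Cauchy–Schwarz with $v\le2q$, which cancels the denominator $2q$. -/
lemma IsBoltSolution.norm_solForm_le {c : ℝ} {x : E3} {t C : ℝ} (h : IsBoltSolution c x t C) :
    ‖solForm c t C x‖ ≤ 4 * Real.pi * (2 * (|C| * quarterRoot c t) + |t|) := by
  have hq := quarterRoot_pos h.pos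
  refine ContinuousLinearMap.opNorm_le_bound _ (by positivity) fun w => ?_
  have hp : |x 1 * w 1 + x 2 * w 2| ≤ 2 * quarterRoot c t * ‖w‖ := by
    refine abs_le_of_sq_le_sq ?_ (by positivity)
    have h1 : x 1 ^ 2 + x 2 ^ 2 ≤ (2 * quarterRoot c t) ^ 2 := by
      rw [h.sq]
      nlinarith [mul_nonneg (sq_nonneg C) (sq_nonneg (quarterRoot c t))]
    have h2 : w 1 ^ 2 + w 2 ^ 2 ≤ ‖w‖ ^ 2 := by
      rw [norm_sq_eq_sum]; linarith [sq_nonneg (w 0)]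
    calc (x 1 * w 1 + x 2 * w 2) ^ 2 ≤ (x 1 ^ 2 + x 2 ^ 2) * (w 1 ^ 2 + w 2 ^ 2) := by
          linarith [sq_nonneg (x 1 * w 2 - x 2 * w 1)]
      _ ≤ (2 * quarterRoot c t) ^ 2 * ‖w‖ ^ 2 := by gcongr
      _ = _ := by ring
  have hw := abs_coord_le_norm w 0
  rw [solForm_apply, Real.norm_eq_abs, abs_mul, abs_neg, abs_of_pos (by positivity : 0 < 4 * Real.pi),
    mul_assoc (4 * Real.pi)]
  gcongr
  calc |2 * C * quarterRoot c t * w 0 - t / (2 * quarterRoot c t) * (x 1 * w 1 + x 2 * w 2)|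
      ≤ |2 * C * quarterRoot c t * w 0| + |t / (2 * quarterRoot c t) * (x 1 * w 1 + x 2 * w 2)| :=
        abs_sub _ _
    _ = 2 * (|C| * quarterRoot c t) * |w 0| +
        |t| / (2 * quarterRoot c t) * |x 1 * w 1 + x 2 * w 2| := by
        simp only [abs_mul, abs_div, abs_two, abs_of_pos hq]; ring
    _ ≤ 2 * (|C| * quarterRoot c t) * ‖w‖ +
        |t| / (2 * quarterRoot c t) * (2 * quarterRoot c t * ‖w‖) := by gcongr
    _ = _ := by field_simp

/-- A bound on the square of `t` and of `C (c + t²)^{1/4}`, which vanishes on the singular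
circle. -/
noncomputable def excessBound (c : ℝ) (x : E3) : ℝ := |excess c x| + 2 * |x 0|

lemma IsBoltSolution.le_excessBound {c : ℝ} (hc : 0 ≤ c) {x : E3} {t C : ℝ}
    (h : IsBoltSolution c x t C) :
    (|C| * quarterRoot c t) ^ 2 ≤ excessBound c x ∧
      t ^ 2 ≤ excessBound c x * (excessBound c x + 2 * Real.sqrt c) := by
  have hX := h.isExcessRoot hc
  have hq := quarterRoot_pos h.pos
  have h4 := quarterRoot_pow_four h.pos
  have hs := Real.sqrt_nonneg c
  have hs2 := Real.sq_sqrt hc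
  have hd : excess c x = (1 - C ^ 2) * quarterRoot c t ^ 2 - Real.sqrt c := by
    rw [excess, h.sq]; ring
  rw [mul_pow, sq_abs]
  set X := quarterRoot c t ^ 2 - Real.sqrt c with hXdef
  have hZ : C ^ 2 * quarterRoot c t ^ 2 = X - excess c x := by rw [hd]; ring
  have hZ0 : 0 ≤ X - excess c x := by rw [← hZ]; positivity
  have hXZ : X * (X - excess c x) ≤ x 0 ^ 2 := by
    have h2 : 0 < X + 2 * Real.sqrt c := by linarith [hX.pos]
    refine le_of_mul_le_mul_right ?_ h2
    rw [hX.eq]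
    gcongr
    linarith
  -- With $Z=X-d$, $(X+Z)^2=d^2+4XZ\le d^2+4u^2\le(|d|+2|u|)^2$.
  have hsum : X + (X - excess c x) ≤ excessBound c x := by
    refine abs_le_of_sq_le_sq' ?_ (by unfold excessBound; positivity) |>.2
    rw [excessBound]
    nlinarith [sq_abs (excess c x), sq_abs (x 0), abs_nonneg (excess c x), abs_nonneg (x 0),
      mul_nonneg (abs_nonneg (excess c x)) (abs_nonneg (x 0))]
  have hX0 := hX.nonneg
  refine ⟨by rw [hZ]; linarith, ?_⟩
  have ht : t ^ 2 = X * (X + 2 * Real.sqrt c) := by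
    rw [hXdef]; linear_combination -h4 + hs2
  rw [ht]
  have : X ≤ excessBound c x := by linarith
  have : 0 ≤ excessBound c x := by linarith
  gcongr

theorem pushforwardValues_tendsto_zero {c : ℝ} (hc : 0 ≤ c) {x₀ : E3} (hx₀ : x₀ ∈ singularCircle c)
    {ε : ℝ} (hε : 0 < ε) :
    ∃ δ > 0, ∀ x, dist x x₀ < δ → ∀ l ∈ pushforwardValues c x, ‖l‖ < ε := by
  let b : E3 → ℝ := fun x => 4 * Real.pi * (2 * Real.sqrt (excessBound c x) +
    Real.sqrt (excessBound c x * (excessBound c x + 2 * Real.sqrt c)))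
  have hb : Continuous b := by
    have := (contDiff_excess c).continuous
    simp only [b, excessBound]
    fun_prop
  have hb0 : b x₀ = 0 := by
    obtain ⟨h1, h2⟩ := (mem_singularCircle_iff hc x₀).1 hx₀
    simp [b, excessBound, h1, h2]
  obtain ⟨δ, hδ, H⟩ := Metric.eventually_nhds_iff.1
    (hb.continuousAt.eventually_lt continuousAt_const (by rwa [hb0] : b x₀ < ε))
  refine ⟨δ, hδ, fun x hx l hl => lt_of_le_of_lt ?_ (H hx)⟩
  obtain ⟨t, C, h, rfl⟩ := exists_of_mem_pushforwardValues hl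
  obtain ⟨h1, h2⟩ := h.le_excessBound hc
  refine h.norm_solForm_le.trans ?_
  simp only [b]
  gcongr
  · exact Real.le_sqrt_of_sq_le h1
  · exact Real.abs_le_sqrt h2

/-! ### The cone metric and the chart at infinity -/

lemma coneMetric_apply (y v w : E3) : coneMetric (1 / Real.sqrt 2) y v w =
    1 / 2 * inner ℝ v w + 1 / 2 * (inner ℝ y v / ‖y‖) * (inner ℝ y w / ‖y‖) := by
  have h2 : (1 / Real.sqrt 2) ^ 2 = (1 / 2 : ℝ) := by rw [div_pow, Real.sq_sqrt] <;> norm_num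
  simp only [coneMetric, h2, inner_eq_sum]
  simp [Fin.sum_univ_three]
  ring

lemma coneMetric_pos {y v : E3} (hv : v ≠ 0) : 0 < coneMetric (1 / Real.sqrt 2) y v v := by
  rw [coneMetric_apply, real_inner_self_eq_norm_sq, mul_assoc]
  have := mul_self_nonneg (inner ℝ y v / ‖y‖)
  have := norm_pos_iff.2 hv
  positivity

/-- The chart `y ↦ (ϱ y₀ / 4, 2 q y₁ / ϱ, 2 q y₂ / ϱ)` with `ϱ = |y|`, `q = (c + ϱ⁴ / 16)^{1/4}`. -/
noncomputable def coneChart (c : ℝ) (y : E3) : E3 :=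
  !₂[‖y‖ ^ 2 / 4 * (y 0 / ‖y‖), 2 * quarterRoot c (‖y‖ ^ 2 / 4) * (y 1 / ‖y‖),
    2 * quarterRoot c (‖y‖ ^ 2 / 4) * (y 2 / ‖y‖)]

section chart
variable {c : ℝ}

lemma chart_pos (hc : 0 ≤ c) {y : E3} (hy : y ≠ 0) : 0 < c + (‖y‖ ^ 2 / 4) ^ 2 := by
  have := norm_pos_iff.2 hy
  positivity

lemma contDiffOn_coneChart (hc : 0 ≤ c) : ContDiffOn ℝ ∞ (coneChart c) {0}ᶜ := by
  have hn : ContDiffOn ℝ ∞ (fun y : E3 => ‖y‖) {0}ᶜ := contDiffOn_id.norm ℝ fun y hy => hy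
  have hq := ContDiffOn.quarterRoot (c := c) ((hn.pow 2).div_const 4) fun y hy => chart_pos hc hy
  have hy : ∀ i : Fin 3, ContDiffOn ℝ ∞ (fun y : E3 => y i / ‖y‖) {0}ᶜ := fun i =>
    ContDiffOn.div (ContDiff.contDiffOn (by fun_prop)) hn fun y hy => norm_ne_zero_iff.2 hy
  rw [contDiffOn_euclidean]
  intro i
  fin_cases i
  · exact ((hn.pow 2).div_const 4).mul (hy 0)
  · exact (contDiffOn_const.mul hq).mul (hy 1)
  · exact (contDiffOn_const.mul hq).mul (hy 2)

lemma isBoltSolution_coneChart (hc : 0 ≤ c) {y : E3} (hy : y ≠ 0) :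
    IsBoltSolution c (coneChart c y) (‖y‖ ^ 2 / 4) (y 0 / ‖y‖) where
  mul := rfl
  sq := by
    have h := norm_pos_iff.2 hy
    have hs := norm_sq_eq_sum y
    simp only [coneChart, Matrix.cons_val_one, Matrix.cons_val]
    field_simp
    linear_combination (-4 * quarterRoot c (‖y‖ ^ 2 / 4) ^ 2) * hs
  pos := chart_pos hc hy
  ne := .inl (by simpa using hy)

lemma hasDerivAt_norm_line {y : E3} (hy : y ≠ 0) (v : E3) :
    HasDerivAt (fun r : ℝ => ‖y + r • v‖) (inner ℝ y v / ‖y‖) 0 := by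
  have h1 := (hasDerivAt_line y v).norm_sq.sqrt (by simpa using hy)
  simp only [Real.sqrt_sq (norm_nonneg _)] at h1
  refine h1.congr_deriv ?_
  simp
  field_simp

/-- The chart realizes $t=\varrho^2/4$ and $(C,y_1,y_2)=y/\varrho$, so this is
$dt^2/q^2+2q^2g_{S^2}$ in the coordinate $y$. -/
theorem pullbackMetric_coneChart (hc : 0 ≤ c) {y : E3} (hy : y ≠ 0) (v w : E3) :
    pullbackMetric (coneChart c) (baseMetric c) y v w =
      inner ℝ y v * inner ℝ y w / (4 * quarterRoot c (‖y‖ ^ 2 / 4) ^ 2) +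
        2 * quarterRoot c (‖y‖ ^ 2 / 4) ^ 2 / ‖y‖ ^ 2 *
          (inner ℝ v w - inner ℝ y v * inner ℝ y w / ‖y‖ ^ 2) := by
  have hpos := norm_pos_iff.2 hy
  have hs := isBoltSolution_coneChart hc hy
  have hq := quarterRoot_pos hs.pos
  have hsum := norm_sq_eq_sum y
  have hd := (contDiffOn_coneChart hc).differentiableAt_of_isOpen isOpen_compl_singleton hy
  have e : ∀ i : Fin 3, i = 1 ∨ i = 2 →
      coneChart c y i / (2 * quarterRoot c (‖y‖ ^ 2 / 4)) = y i / ‖y‖ := by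
    intro i hi
    rcases hi with rfl | rfl <;> simp [coneChart] <;> field_simp
  have hvar : ∀ v : E3, IsSolutionVar c (coneChart c y) (‖y‖ ^ 2 / 4) (y 0 / ‖y‖)
      (fderiv ℝ (coneChart c) y v) (inner ℝ y v / 2)
      (v 0 / ‖y‖ - y 0 * inner ℝ y v / ‖y‖ ^ 3) (v 1 / ‖y‖ - y 1 * inner ℝ y v / ‖y‖ ^ 3)
      (v 2 / ‖y‖ - y 2 * inner ℝ y v / ‖y‖ ^ 3) := by
    intro v
    have hline : HasDerivAt (fun r : ℝ => coneChart c (y + r • v)) (fderiv ℝ (coneChart c) y v) 0 :=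
      hd.hasFDerivAt.comp_hasDerivAt_of_eq 0 (hasDerivAt_line y v) (by simp)
    have hcomp : ∀ i : Fin 3, HasDerivAt (fun r : ℝ => coneChart c (y + r • v) i)
        (fderiv ℝ (coneChart c) y v i) 0 := fun i =>
      (EuclideanSpace.proj i : E3 →L[ℝ] ℝ).hasFDerivAt.comp_hasDerivAt 0 hline
    have ln := hasDerivAt_norm_line hy v
    have lt := (ln.pow 2).div_const 4
    have lq := HasDerivAt.quarterRoot (c := c) lt (by simpa using hs.pos)
    have ly := fun i => (hasDerivAt_coord_line y v i).div ln (by simpa using hy)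
    refine ⟨?_, ?_, ?_, ?_⟩
    · rw [(hcomp 0).unique (lt.mul (ly 0))]
      simp
      field_simp
      ring
    · rw [(hcomp 1).unique ((lq.const_mul 2).mul (ly 1)), e 1 (.inl rfl)]
      simp
      field_simp
      ring
    · rw [(hcomp 2).unique ((lq.const_mul 2).mul (ly 2)), e 2 (.inr rfl)]
      simp
      field_simp
      ring
    · rw [e 1 (.inl rfl), e 2 (.inr rfl), inner_eq_sum]
      field_simp
      rw [hsum]
      ring
  rw [pullbackMetric, baseMetric_eq hc hs, ← (hvar v).metric_eq hs (hvar w)]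
  have key : (v 0 / ‖y‖ - y 0 * inner ℝ y v / ‖y‖ ^ 3) * (w 0 / ‖y‖ - y 0 * inner ℝ y w / ‖y‖ ^ 3) +
      (v 1 / ‖y‖ - y 1 * inner ℝ y v / ‖y‖ ^ 3) * (w 1 / ‖y‖ - y 1 * inner ℝ y w / ‖y‖ ^ 3) +
      (v 2 / ‖y‖ - y 2 * inner ℝ y v / ‖y‖ ^ 3) * (w 2 / ‖y‖ - y 2 * inner ℝ y w / ‖y‖ ^ 3) =
      (inner ℝ v w - inner ℝ y v * inner ℝ y w / ‖y‖ ^ 2) / ‖y‖ ^ 2 := by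
    have e1 := inner_eq_sum v w
    have e2 := inner_eq_sum y v
    have e3 := inner_eq_sum y w
    generalize (inner ℝ v w : ℝ) = p at *
    generalize (inner ℝ y v : ℝ) = P at *
    generalize (inner ℝ y w : ℝ) = Q at *
    generalize ‖y‖ = ρ at *
    field_simp
    rw [e1]
    linear_combination (ρ ^ 2 * Q) * e2 + (ρ ^ 2 * P) * e3 - P * Q * hsum
  rw [key]
  field_simp
  ring

/-- `coneChart` is a diffeomorphism onto the region where `t > 0` can be chosen. -/
theorem exists_coneChart_inverse (hc : 0 ≤ c) : ∃ Φ : E3 → E3,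
    ContDiffOn ℝ ∞ Φ {x | x 0 ≠ 0 ∨ 2 * c ^ (1 / 4 : ℝ) < radialV x} ∧
    MapsTo Φ {x | x 0 ≠ 0 ∨ 2 * c ^ (1 / 4 : ℝ) < radialV x} {0}ᶜ ∧
    MapsTo (coneChart c) {0}ᶜ {x | x 0 ≠ 0 ∨ 2 * c ^ (1 / 4 : ℝ) < radialV x} ∧
    LeftInvOn Φ (coneChart c) {0}ᶜ ∧
    RightInvOn Φ (coneChart c) {x | x 0 ≠ 0 ∨ 2 * c ^ (1 / 4 : ℝ) < radialV x} := by
  obtain ⟨t, C, ht, hC, h⟩ := exists_solution_outerRegion hc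
  set W : Set E3 := {x | x 0 ≠ 0 ∨ 2 * c ^ (1 / 4 : ℝ) < radialV x}
  have hs := fun x hx => (h x hx).1
  have hsqrt : ContDiffOn ℝ ∞ (fun x => 2 * √(t x)) W :=
    contDiffOn_const.mul (ht.sqrt fun x hx => (h x hx).2.ne')
  -- The unit vector $(C,y_1,y_2)$ scaled by $\varrho=2\sqrt t$.
  let Φ : E3 → E3 := fun x => !₂[2 * √(t x) * C x,
    2 * √(t x) * (x 1 / (2 * quarterRoot c (t x))), 2 * √(t x) * (x 2 / (2 * quarterRoot c (t x)))]
  have hnorm : ∀ x ∈ W, ‖Φ x‖ = 2 * √(t x) := by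
    intro x hx
    have h1 := (hs x hx).sphere
    have h2 := norm_sq_eq_sum (Φ x)
    rw [← sq_eq_sq₀ (norm_nonneg _) (by positivity), h2]
    simp only [Φ, Matrix.cons_val_zero, Matrix.cons_val_one, Matrix.cons_val]
    linear_combination (2 * √(t x)) ^ 2 * h1
  have hmaps : MapsTo (coneChart c) {0}ᶜ W := by
    intro y hy
    have hs := isBoltSolution_coneChart hc hy
    have hn : 0 < ‖y‖ := norm_pos_iff.2 hy
    by_cases h0 : y 0 = 0
    · right
      rw [lt_radialV_iff hc]
      have h1 := hs.sq
      have h2 : √c < quarterRoot c (‖y‖ ^ 2 / 4) ^ 2 := by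
        rw [← sqrt_eq_quarterRoot_sq hs.pos]
        exact Real.sqrt_lt_sqrt hc (by linarith [show 0 < (‖y‖ ^ 2 / 4) ^ 2 by positivity])
      rw [excess, h1, h0]
      simp
      linarith
    · left
      simp [coneChart, h0, hn.ne']
  refine ⟨Φ, ?_, ?_, hmaps, ?_, ?_⟩
  · rw [contDiffOn_euclidean]
    intro i
    fin_cases i
    · exact hsqrt.mul hC
    · exact hsqrt.mul (contDiffOn_yCoord ht hs 1)
    · exact hsqrt.mul (contDiffOn_yCoord ht hs 2)
  · intro x hx h0
    have h1 := hnorm x hx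
    have h2 := Real.sqrt_pos.2 (h x hx).2
    rw [h0, norm_zero] at h1
    linarith
  · intro y hy
    have hn : 0 < ‖y‖ := norm_pos_iff.2 hy
    have hsol := isBoltSolution_coneChart hc hy
    have hq := quarterRoot_pos hsol.pos
    have hpos := (h _ (hmaps hy)).2
    rcases hsol.eq_or_eq_neg hc (hs _ (hmaps hy)) with ⟨h1, h2⟩ | ⟨h1, h2⟩
    · have e : 2 * √(‖y‖ ^ 2 / 4) = ‖y‖ := by
        rw [show ‖y‖ ^ 2 / 4 = (‖y‖ / 2) ^ 2 by ring, Real.sqrt_sq (by positivity)]; ring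
      simp only [Φ, h1, h2, e]
      ext i
      fin_cases i <;> simp [coneChart] <;> field_simp
    -- The opposite solution has $t<0$, contrary to the choice on the outer region.
    · rw [h1] at hpos
      have : 0 < ‖y‖ ^ 2 := by positivity
      linarith
  · intro x hx
    have h1 := hnorm x hx
    have h2 := Real.sqrt_pos.2 (h x hx).2
    have h3 := Real.sq_sqrt (h x hx).2.le
    have h4 := (hs x hx).mul
    have hq := quarterRoot_pos (hs x hx).pos
    have e : (2 * √(t x)) ^ 2 / 4 = t x := by linear_combination h3
    rw [coneChart, h1, e]
    ext i
    fin_cases i <;> simp [Φ] <;> field_simp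
    exact h4

end chart

theorem exists_isometry_cone : ∃ Ψ : E3 → E3, IsDiffeoOn Ψ {0}ᶜ {0}ᶜ ∧
    ∀ y ∈ ({0}ᶜ : Set E3), ∀ v w,
      pullbackMetric Ψ (baseMetric 0) y v w = coneMetric (1 / Real.sqrt 2) y v w := by
  have hW : {x : E3 | x 0 ≠ 0 ∨ 2 * (0 : ℝ) ^ (1 / 4 : ℝ) < radialV x} = {0}ᶜ := by
    ext x
    rw [← singularCircle_zero]
    have := radialV_nonneg x
    simp only [singularCircle, mem_ofPred_eq, mem_compl_iff, not_and_or]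
    rw [Real.zero_rpow (by norm_num), mul_zero]
    exact or_congr_right ⟨fun h => h.ne', fun h => lt_of_le_of_ne this (Ne.symm h)⟩
  obtain ⟨Φ, h1, h2, h3, h4, h5⟩ := exists_coneChart_inverse (c := 0) le_rfl
  rw [hW] at h1 h2 h3 h5
  refine ⟨coneChart 0, ⟨contDiffOn_coneChart le_rfl, h3, Φ, h1, h2, h4, h5⟩, fun y hy v w => ?_⟩
  have hn : 0 < ‖y‖ := norm_pos_iff.2 hy
  have hq : quarterRoot 0 (‖y‖ ^ 2 / 4) ^ 2 = ‖y‖ ^ 2 / 4 :=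
    quarterRoot_sq_eq (chart_pos le_rfl hy) (by positivity) (by ring)
  rw [pullbackMetric_coneChart le_rfl hy, coneMetric_apply, hq]
  field_simp
  ring

/-- Outside a compact set, `coneChart` is a diffeomorphism from the end of the cone. -/
theorem exists_isDiffeoOn_coneChart {c : ℝ} (hc : 0 ≤ c) : ∃ K : Set E3, IsCompact K ∧
    singularCircle c ⊆ K ∧ IsDiffeoOn (coneChart c) {y | 1 < ‖y‖} Kᶜ := by
  obtain ⟨Φ, h1, h2, h3, h4, h5⟩ := exists_coneChart_inverse hc
  set W : Set E3 := {x | x 0 ≠ 0 ∨ 2 * c ^ (1 / 4 : ℝ) < radialV x} with hWdef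
  have hne : ∀ y : E3, 1 < ‖y‖ → y ∈ ({0}ᶜ : Set E3) := fun y hy =>
    norm_pos_iff.1 (zero_lt_one.trans hy)
  have hopen : IsOpen (W ∩ Φ ⁻¹' {y | 1 < ‖y‖}) :=
    h1.continuousOn.isOpen_inter_preimage (isOpen_outerRegion hc)
      (isOpen_lt continuous_const continuous_norm)
  -- The compact set is the complement of the image of $\{\varrho>1\}$. On it either $t\le1$, so
  -- $u^2\le1$ and $v^2\le4\sqrt{c+1}$, or $u=0$ and $v^2\le4\sqrt c$; this explains the radius of
  -- the ball below.
  refine ⟨(W ∩ Φ ⁻¹' {y | 1 < ‖y‖})ᶜ, ?_, ?_, (contDiffOn_coneChart hc).mono hne, ?_, Φ, ?_, ?_,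
    h4.mono hne, ?_⟩
  · refine Metric.isCompact_of_isClosed_isBounded hopen.isClosed_compl ?_
    refine (Metric.isBounded_closedBall (x := (0 : E3)) (r := √(1 + 4 * √(c + 1)))).subset ?_
    intro x hx
    rw [mem_closedBall_zero_iff]
    refine Real.le_sqrt_of_sq_le ?_
    rw [norm_sq_eq_sum, add_assoc]
    by_cases hxW : x ∈ W
    · have hy : ‖Φ x‖ ≤ 1 := by
        by_contra! hlt
        exact hx ⟨hxW, hlt⟩
      have hs := isBoltSolution_coneChart hc (h2 hxW)
      rw [h5 hxW] at hs
      have ht : (‖Φ x‖ ^ 2 / 4) ^ 2 ≤ 1 := by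
        have h6 : ‖Φ x‖ ^ 2 ≤ 1 := pow_le_one₀ (norm_nonneg _) hy
        refine pow_le_one₀ (by positivity) (by linarith)
      have hC := hs.sq_le_one
      refine add_le_add ?_ ?_
      · rw [← hs.mul, mul_pow]
        exact mul_le_one₀ ht (by positivity) hC
      · rw [hs.sq, ← sqrt_eq_quarterRoot_sq hs.pos]
        have h7 : √(c + (‖Φ x‖ ^ 2 / 4) ^ 2) ≤ √(c + 1) := Real.sqrt_le_sqrt (by linarith)
        have h8 := Real.sqrt_nonneg (c + (‖Φ x‖ ^ 2 / 4) ^ 2)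
        nlinarith [mul_nonneg (sq_nonneg ((Φ x) 0 / ‖Φ x‖)) h8]
    · simp only [hWdef, mem_ofPred_eq, not_or, not_not, not_lt] at hxW
      have h6 : x 1 ^ 2 + x 2 ^ 2 ≤ 4 * √c := by
        rw [← radialV_sq, ← two_mul_rpow_sq hc]
        exact pow_le_pow_left₀ (radialV_nonneg x) hxW.2 2
      have h7 : √c ≤ √(c + 1) := Real.sqrt_le_sqrt (by linarith)
      rw [hxW.1]
      linarith
  · intro x hx hmem
    rw [← h5 hmem.1] at hx
    exact (isBoltSolution_coneChart hc (h2 hmem.1)).notMem_singularCircle hc hx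
  · intro y hy
    rw [compl_compl]
    refine ⟨h3 (hne y hy), ?_⟩
    rw [mem_preimage, h4 (hne y hy)]
    exact hy
  · rw [compl_compl]
    exact h1.mono inter_subset_left
  · rw [compl_compl]
    exact fun x hx => hx.2
  · rw [compl_compl]
    exact h5.mono inter_subset_left

/-! ### The Levi-Civita connection of the cone -/

lemma fderiv_clm_apply_apply {g : E3 → E3 →L[ℝ] E3 →L[ℝ] ℝ} {y : E3} (hg : DifferentiableAt ℝ g y)
    (u v w : E3) {d : ℝ} (h : HasDerivAt (fun r : ℝ => g (y + r • u) v w) d 0) :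
    fderiv ℝ g y u v w = d := by
  have h1 := (hg.hasFDerivAt.clm_apply (hasFDerivAt_const v y)).clm_apply (hasFDerivAt_const w y)
  have h2 := (hasDerivAt_comp_line h1.differentiableAt u).unique h
  rw [h1.fderiv] at h2
  simpa using h2

lemma differentiableAt_coneMetric {y : E3} (hy : y ≠ 0) :
    DifferentiableAt ℝ (coneMetric (1 / Real.sqrt 2)) y := by
  have hn : ContDiffOn ℝ ∞ (fun y : E3 => ‖y‖) {0}ᶜ := contDiffOn_id.norm ℝ fun y hy => hy
  have hi : ∀ v : E3, ContDiffOn ℝ ∞ (fun y : E3 => inner ℝ y v / ‖y‖) {0}ᶜ := fun v =>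
    (contDiff_id.inner ℝ contDiff_const).contDiffOn.div hn fun y hy => norm_ne_zero_iff.2 hy
  have h : ContDiffOn ℝ ∞ (coneMetric (1 / Real.sqrt 2)) {0}ᶜ := by
    refine contDiffOn_clm_apply.2 fun v => contDiffOn_clm_apply.2 fun w => ?_
    simp only [coneMetric_apply]
    exact contDiffOn_const.add ((contDiffOn_const.mul (hi v)).mul (hi w))
  exact h.differentiableAt_of_isOpen isOpen_compl_singleton hy

lemma fderiv_coneMetric {y : E3} (hy : y ≠ 0) (u v w : E3) :
    fderiv ℝ (coneMetric (1 / Real.sqrt 2)) y u v w =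
      1 / 2 * ((inner ℝ u v * inner ℝ y w + inner ℝ y v * inner ℝ u w) / ‖y‖ ^ 2 -
        2 * inner ℝ y v * inner ℝ y w * inner ℝ y u / ‖y‖ ^ 4) := by
  have hn : 0 < ‖y‖ := norm_pos_iff.2 hy
  refine fderiv_clm_apply_apply (differentiableAt_coneMetric hy) u v w ?_
  have ln := hasDerivAt_norm_line hy u
  have li : ∀ v : E3, HasDerivAt (fun r : ℝ => (inner ℝ (y + r • u) v : ℝ)) (inner ℝ u v) 0 := by
    intro v
    simpa using (hasDerivAt_line y u).inner ℝ (hasDerivAt_const 0 v)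
  have h1 := ((((li v).div ln (by simpa using hy)).const_mul (1 / 2)).mul
    ((li w).div ln (by simpa using hy))).const_add (1 / 2 * inner ℝ v w)
  refine (h1.congr_of_eventuallyEq
    (Filter.Eventually.of_forall fun r => coneMetric_apply _ v w)).congr_deriv ?_
  simp
  field_simp
  ring

/-- The deviation from the flat connection is purely radial. The formula is checked by pairing with
an arbitrary vector in the Koszul identity. -/
theorem christoffel_coneMetric {y : E3} (hy : y ≠ 0) (v w : E3) :
    christoffel (coneMetric (1 / Real.sqrt 2)) y v w =
      (1 / 2 * (inner ℝ v w / ‖y‖ ^ 2 - inner ℝ y v * inner ℝ y w / ‖y‖ ^ 4)) • y := by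
  have hn : 0 < ‖y‖ := norm_pos_iff.2 hy
  refine inverse_apply_eq (fun v hv => coneMetric_pos hv) ?_
  ext z
  rw [coneMetric_apply]
  simp only [smul_apply, add_apply, sub_apply, ContinuousLinearMap.flip_apply,
    fderiv_coneMetric hy, inner_smul_left, inner_smul_right, real_inner_self_eq_norm_sq, smul_eq_mul]
  simp only [real_inner_comm v w, real_inner_comm v z, real_inner_comm w z, conj_trivial]
  field_simp
  ring

/-! ### Symbols on the end of the cone -/

/-- Functions of `y` that, together with all derivatives, have the order of a homogeneous function
of the given degree as `|y| → ∞`. -/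
inductive ConeSymbol : ℤ → (E3 → ℝ) → Prop
  | comp {F : ℝ → ℝ} (hF : ContDiff ℝ ∞ F) : ConeSymbol 0 fun y => F ‖y‖⁻¹
  | coord (i : Fin 3) : ConeSymbol 1 fun y => y i
  | invNorm : ConeSymbol (-1) fun y => ‖y‖⁻¹
  | add {m : ℤ} {f g : E3 → ℝ} (hf : ConeSymbol m f) (hg : ConeSymbol m g) :
      ConeSymbol m fun y => f y + g y
  | mul {m n : ℤ} {f g : E3 → ℝ} (hf : ConeSymbol m f) (hg : ConeSymbol n g) :
      ConeSymbol (m + n) fun y => f y * g y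
  | mono {m n : ℤ} {f : E3 → ℝ} (h : m ≤ n) (hf : ConeSymbol m f) : ConeSymbol n f

namespace ConeSymbol

lemma const (a : ℝ) : ConeSymbol 0 fun _ => a := comp (F := fun _ => a) contDiff_const

lemma mul_of_eq {m n k : ℤ} {f g : E3 → ℝ} (hf : ConeSymbol m f) (hg : ConeSymbol n g)
    (h : m + n = k) : ConeSymbol k fun y => f y * g y := h ▸ hf.mul hg

lemma const_mul {m : ℤ} {f : E3 → ℝ} (hf : ConeSymbol m f) (a : ℝ) :
    ConeSymbol m fun y => a * f y := (const a).mul_of_eq hf (zero_add m)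

lemma invNorm_pow (k : ℕ) : ConeSymbol (-k) fun y => ‖y‖⁻¹ ^ k := by
  induction k with
  | zero => simpa using const 1
  | succ k ih =>
    simp only [pow_succ]
    exact ih.mul_of_eq invNorm (by push_cast; ring)

/-- For $|y|\ge1$ the argument $|y|^{-1}$ stays in the compact interval $[0,1]$, which bounds the
generators $F(|y|^{-1})$. The other cases multiply or add bounds. -/
theorem exists_bound {m : ℤ} {f : E3 → ℝ} (hf : ConeSymbol m f) :
    ∃ C, 0 ≤ C ∧ ∀ y : E3, 1 ≤ ‖y‖ → |f y| ≤ C * ‖y‖ ^ m := by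
  induction hf with
  | @comp F hF =>
    obtain ⟨C, hC⟩ := isCompact_Icc.exists_bound_of_continuousOn (s := Icc (0 : ℝ) 1)
      hF.continuous.continuousOn
    have h0 := (norm_nonneg _).trans (hC 0 (by simp))
    exact ⟨C, h0, fun y hy => by
      simpa using hC ‖y‖⁻¹ ⟨by positivity, inv_le_one_of_one_le₀ hy⟩⟩
  | coord i => exact ⟨1, zero_le_one, fun y _ => by simpa using abs_coord_le_norm y i⟩
  | invNorm => exact ⟨1, zero_le_one, fun y _ => by simp⟩
  | add _ _ hf hg =>
    obtain ⟨A, hA0, hA⟩ := hf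
    obtain ⟨B, hB0, hB⟩ := hg
    refine ⟨A + B, by positivity, fun y hy => (abs_add_le _ _).trans ?_⟩
    rw [add_mul]
    exact add_le_add (hA y hy) (hB y hy)
  | mul _ _ hf hg =>
    obtain ⟨A, hA0, hA⟩ := hf
    obtain ⟨B, hB0, hB⟩ := hg
    refine ⟨A * B, by positivity, fun y hy => ?_⟩
    have hy0 : 0 < ‖y‖ := zero_lt_one.trans_le hy
    rw [abs_mul, zpow_add₀ hy0.ne', mul_mul_mul_comm]
    exact mul_le_mul (hA y hy) (hB y hy) (abs_nonneg _) (by positivity)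
  | mono h _ hf =>
    obtain ⟨A, hA0, hA⟩ := hf
    exact ⟨A, hA0, fun y hy => (hA y hy).trans (by gcongr)⟩

lemma hasFDerivAt_invNorm {y : E3} (hy : y ≠ 0) : HasFDerivAt (fun y : E3 => ‖y‖⁻¹)
    (∑ i, (-1 * (‖y‖⁻¹ ^ 3 * y i)) • (EuclideanSpace.proj i : E3 →L[ℝ] ℝ)) y := by
  have hn : 0 < ‖y‖ := norm_pos_iff.2 hy
  have hd : DifferentiableAt ℝ (fun y : E3 => ‖y‖⁻¹) y :=
    ((contDiffAt_norm ℝ hy (n := 1)).differentiableAt (by simp)).inv hn.ne'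
  convert hd.hasFDerivAt using 1
  ext v
  have h := (hasDerivAt_comp_line hd v).unique ((hasDerivAt_norm_line hy v).inv (by simpa using hy))
  rw [h, inner_eq_sum]
  simp [Fin.sum_univ_three]
  field_simp
  ring

/-- The class is closed under differentiation because $\partial_i|y|^{-1}=-|y|^{-3}y_i$ is again a
symbol, of order $-2$. For $F(|y|^{-1})$ this is one order better than required. -/
theorem exists_hasFDerivAt {m : ℤ} {f : E3 → ℝ} (hf : ConeSymbol m f) :
    ∃ g : Fin 3 → E3 → ℝ, (∀ i, ConeSymbol (m - 1) (g i)) ∧ ∀ y ≠ 0,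
      HasFDerivAt f (∑ i, g i y • (EuclideanSpace.proj i : E3 →L[ℝ] ℝ)) y := by
  have hinv : ∀ i : Fin 3, ConeSymbol (-2) fun y => -1 * (‖y‖⁻¹ ^ 3 * y i) := fun i =>
    ((invNorm_pow 3).mul_of_eq (coord i) (by norm_num)).const_mul (-1)
  induction hf with
  | @comp F hF =>
    have hF' : ContDiff ℝ ∞ (deriv F) := (contDiff_infty_iff_deriv.1 hF).2
    refine ⟨fun i y => deriv F ‖y‖⁻¹ * (-1 * (‖y‖⁻¹ ^ 3 * y i)), fun i =>
      ((comp hF').mul (hinv i)).mono (by norm_num), fun y hy => ?_⟩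
    have h := ((contDiff_infty_iff_deriv.1 hF).1 ‖y‖⁻¹).hasDerivAt.comp_hasFDerivAt y
      (hasFDerivAt_invNorm hy)
    exact h.congr_fderiv (by simp only [Finset.smul_sum, smul_smul])
  | coord j =>
    refine ⟨fun i _ => if i = j then 1 else 0, fun i => const _, fun y _ => ?_⟩
    simpa using (EuclideanSpace.proj j : E3 →L[ℝ] ℝ).hasFDerivAt
  | invNorm =>
    exact ⟨_, fun i => (hinv i).mono (by norm_num), fun y hy => hasFDerivAt_invNorm hy⟩
  | add _ _ hf hg =>
    obtain ⟨a, ha, hfa⟩ := hf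
    obtain ⟨b, hb, hgb⟩ := hg
    refine ⟨fun i y => a i y + b i y, fun i => (ha i).add (hb i), fun y hy => ?_⟩
    exact ((hfa y hy).add (hgb y hy)).congr_fderiv (by simp only [add_smul, Finset.sum_add_distrib])
  | @mul m n f g hf₀ hg₀ hf hg =>
    obtain ⟨a, ha, hfa⟩ := hf
    obtain ⟨b, hb, hgb⟩ := hg
    refine ⟨fun i y => f y * b i y + g y * a i y, fun i =>
      (hf₀.mul_of_eq (hb i) (by ring)).add (hg₀.mul_of_eq (ha i) (by ring)), fun y hy => ?_⟩
    exact ((hfa y hy).mul (hgb y hy)).congr_fderiv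
      (by simp only [add_smul, mul_smul, Finset.sum_add_distrib, Finset.smul_sum])
  | mono h _ hf =>
    obtain ⟨a, ha, hfa⟩ := hf
    exact ⟨a, fun i => (ha i).mono (by linarith), hfa⟩

end ConeSymbol

/-! ### Tensors with symbol coefficients -/

/-- Sums of tensors `f dx_{I₀} ⊗ ⋯ ⊗ dx_{I_{k-1}}` with symbols `f` of the given order. -/
inductive ConeTensor (k : ℕ) (m : ℤ) : (E3 → (Fin k → E3) → ℝ) → Prop
  | zero : ConeTensor k m fun _ _ => 0
  | monomial {f : E3 → ℝ} (hf : ConeSymbol m f) (I : Fin k → Fin 3) :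
      ConeTensor k m fun y v => f y * ∏ i, v i (I i)
  | add {S T : E3 → (Fin k → E3) → ℝ} (hS : ConeTensor k m S) (hT : ConeTensor k m T) :
      ConeTensor k m fun y v => S y v + T y v

namespace ConeTensor

variable {k : ℕ} {m : ℤ}

lemma sum {ι : Type*} (s : Finset ι) {T : ι → E3 → (Fin k → E3) → ℝ}
    (hT : ∀ i, ConeTensor k m (T i)) : ConeTensor k m fun y v => ∑ i ∈ s, T i y v := by
  classical
  induction s using Finset.induction_on with
  | empty => simpa using zero
  | insert a s ha ih =>
    simp only [Finset.sum_insert ha]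
    exact (hT a).add ih

lemma mono {n : ℤ} (h : m ≤ n) {T : E3 → (Fin k → E3) → ℝ} (hT : ConeTensor k m T) :
    ConeTensor k n T := by
  induction hT with
  | zero => exact zero
  | monomial hf I => exact monomial (hf.mono h) I
  | add _ _ hS hT => exact hS.add hT

lemma differentiableAt {T : E3 → (Fin k → E3) → ℝ} (hT : ConeTensor k m T) {y : E3} (hy : y ≠ 0)
    (v : Fin k → E3) : DifferentiableAt ℝ (fun y => T y v) y := by
  induction hT with
  | zero => exact differentiableAt_const 0
  | monomial hf I =>
    obtain ⟨g, -, hg⟩ := hf.exists_hasFDerivAt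
    exact (hg y hy).differentiableAt.mul_const _
  | add _ _ hS hT => exact hS.add hT

/-- The cone metric is at least half the Euclidean one, so components are controlled by cone norms
at the cost of $\sqrt2$ per slot. -/
lemma norm_le_sqrt_coneMetric (y v : E3) :
    ‖v‖ ≤ √2 * √(coneMetric (1 / √2) y v v) := by
  rw [← Real.sqrt_mul (by norm_num)]
  refine Real.le_sqrt_of_sq_le ?_
  rw [coneMetric_apply, real_inner_self_eq_norm_sq, mul_assoc]
  linarith [mul_self_nonneg (inner ℝ y v / ‖y‖)]

theorem exists_bound {T : E3 → (Fin k → E3) → ℝ} (hT : ConeTensor k m T) :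
    ∃ C, ∀ y : E3, 1 ≤ ‖y‖ → ∀ v,
      |T y v| ≤ C * ‖y‖ ^ m * ∏ i, √(coneMetric (1 / √2) y (v i) (v i)) := by
  induction hT with
  | zero => exact ⟨0, fun y _ v => by simp⟩
  | monomial hf I =>
    obtain ⟨C, hC0, hC⟩ := hf.exists_bound
    refine ⟨C * √2 ^ k, fun y hy v => ?_⟩
    have h1 : |∏ i, v i (I i)| ≤ √2 ^ k * ∏ i, √(coneMetric (1 / √2) y (v i) (v i)) := by
      rw [Finset.abs_prod]
      calc ∏ i, |v i (I i)| ≤ ∏ i, √2 * √(coneMetric (1 / √2) y (v i) (v i)) :=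
            Finset.prod_le_prod (fun _ _ => abs_nonneg _) fun i _ =>
              (abs_coord_le_norm _ _).trans (norm_le_sqrt_coneMetric y (v i))
        _ = _ := by simp [Finset.prod_mul_distrib]
    rw [abs_mul]
    calc |_| * |∏ i, v i (I i)| ≤
          (C * ‖y‖ ^ m) * (√2 ^ k * ∏ i, √(coneMetric (1 / √2) y (v i) (v i))) :=
          mul_le_mul (hC y hy) h1 (abs_nonneg _) (by positivity)
      _ = _ := by ring
  | add _ _ hS hT =>
    obtain ⟨A, hA⟩ := hS
    obtain ⟨B, hB⟩ := hT
    refine ⟨A + B, fun y hy v => (abs_add_le _ _).trans ?_⟩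
    rw [add_mul, add_mul]
    exact add_le_add (hA y hy v) (hB y hy v)

/-- The Christoffel symbols of the cone metric. -/
noncomputable def coneGamma (a d b : Fin 3) (y : E3) : ℝ :=
  1 / 2 * (((if a = d then 1 else 0) * ‖y‖⁻¹ ^ 2 + -1 * (y a * y d * ‖y‖⁻¹ ^ 4)) * y b)

lemma coneSymbol_coneGamma (a d b : Fin 3) : ConeSymbol (-1) (coneGamma a d b) := by
  refine ConeSymbol.const_mul (ConeSymbol.mul_of_eq (m := -2) (ConeSymbol.add ?_ ?_)
    (ConeSymbol.coord b) (by norm_num)) _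
  · exact (ConeSymbol.invNorm_pow 2).const_mul _
  · exact ((((ConeSymbol.coord a).mul (ConeSymbol.coord d)).mul_of_eq (ConeSymbol.invNorm_pow 4)
      (by norm_num)).const_mul (-1))

lemma christoffel_coneMetric_apply {y : E3} (hy : y ≠ 0) (v w : E3) (b : Fin 3) :
    christoffel (coneMetric (1 / √2)) y v w b =
      ∑ a, ∑ d, coneGamma a d b y * (v a * w d) := by
  rw [christoffel_coneMetric hy]
  simp only [coneGamma, Fin.sum_univ_three, inner_eq_sum, PiLp.smul_apply, smul_eq_mul]
  simp
  field_simp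
  ring

lemma prod_update {I : Fin k → Fin 3} (u : Fin k → E3) (i : Fin k) (z : E3) :
    ∏ j, Function.update u i z j (I j) = z (I i) * ∏ j ∈ Finset.univ.erase i, u j (I j) := by
  rw [← Finset.mul_prod_erase _ _ (Finset.mem_univ i), Function.update_self]
  congr 1
  refine Finset.prod_congr rfl fun j hj => ?_
  rw [Function.update_of_ne (Finset.ne_of_mem_erase hj)]

lemma prod_update_index {I : Fin k → Fin 3} (u : Fin k → E3) (i : Fin k) (d : Fin 3) :
    ∏ j, u j (Function.update I i d j) = u i d * ∏ j ∈ Finset.univ.erase i, u j (I j) := by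
  rw [← Finset.mul_prod_erase _ _ (Finset.mem_univ i), Function.update_self]
  congr 1
  refine Finset.prod_congr rfl fun j hj => ?_
  rw [Function.update_of_ne (Finset.ne_of_mem_erase hj)]

/-- Partial derivatives of a coefficient and products with Christoffel symbols, which have order
$-1$, both lower the order by one. The Christoffel term replaces one index $I_i$ by $d$ and puts $a$
in the new first slot. -/
theorem exists_covDeriv {T : E3 → (Fin k → E3) → ℝ} (hT : ConeTensor k m T) :
    ∃ S, ConeTensor (k + 1) (m - 1) S ∧ ∀ y ≠ 0, ∀ v,
      covDeriv (coneMetric (1 / √2)) T y v = S y v := by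
  induction hT with
  | zero => exact ⟨_, zero, fun y _ v => by simp [covDeriv]⟩
  | @monomial f hf I =>
    obtain ⟨g, hg, hfg⟩ := hf.exists_hasFDerivAt
    refine ⟨_, (ConeTensor.sum Finset.univ fun a : Fin 3 => monomial (hg a) (Fin.cons a I)).add
      (ConeTensor.sum Finset.univ fun i : Fin k => ConeTensor.sum Finset.univ fun a : Fin 3 =>
        ConeTensor.sum Finset.univ fun d : Fin 3 =>
          monomial ((hf.mul_of_eq (coneSymbol_coneGamma a d (I i)) (sub_eq_add_neg m 1).symm).const_mul
            (-1)) (Fin.cons a (Function.update I i d))), fun y hy v => ?_⟩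
    rw [covDeriv, sub_eq_add_neg, ← Finset.sum_neg_distrib]
    congr 1
    · rw [((hfg y hy).mul_const _).fderiv]
      simp only [smul_apply, sum_apply, PiLp.proj_apply, smul_eq_mul, Fin.prod_univ_succ,
        Fin.cons_zero, Fin.cons_succ, Finset.mul_sum]
      refine Finset.sum_congr rfl fun a _ => ?_
      simp only [Fin.tail]
      ring
    · refine Finset.sum_congr rfl fun i _ => ?_
      rw [prod_update, christoffel_coneMetric_apply hy, Finset.sum_mul, Finset.mul_sum,
        ← Finset.sum_neg_distrib]
      refine Finset.sum_congr rfl fun a _ => ?_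
      rw [Finset.sum_mul, Finset.mul_sum, ← Finset.sum_neg_distrib]
      refine Finset.sum_congr rfl fun d _ => ?_
      simp only [Fin.prod_univ_succ, Fin.cons_zero, Fin.cons_succ]
      rw [prod_update_index (fun j => v j.succ)]
      simp only [Fin.tail]
      ring
  | @add S T hS₀ hT₀ hS hT =>
    obtain ⟨A, hA, hSA⟩ := hS
    obtain ⟨B, hB, hTB⟩ := hT
    refine ⟨_, hA.add hB, fun y hy v => ?_⟩
    rw [← hSA y hy v, ← hTB y hy v]
    simp only [covDeriv]
    rw [fderiv_fun_add (hS₀.differentiableAt hy _) (hT₀.differentiableAt hy _),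
      Finset.sum_add_distrib, add_apply]
    ring

/-- Agreement on the open set $\{|y|>1\}$ passes to derivatives, so the tensors need not be compared
elsewhere. -/
theorem exists_iterCovDeriv {T T' : E3 → (Fin k → E3) → ℝ} (hT : ConeTensor k m T)
    (h : ∀ y : E3, 1 < ‖y‖ → ∀ v, T' y v = T y v) (j : ℕ) :
    ∃ S, ConeTensor (k + j) (m - j) S ∧ ∀ y : E3, 1 < ‖y‖ → ∀ v,
      iterCovDeriv (coneMetric (1 / √2)) T' j y v = S y v := by
  induction j with
  | zero => exact ⟨T, by simpa using hT, h⟩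
  | succ j ih =>
    obtain ⟨S, hS, hTS⟩ := ih
    obtain ⟨S', hS', hSS'⟩ := hS.exists_covDeriv
    refine ⟨S', hS'.mono (by push_cast; linarith), fun y hy v => ?_⟩
    have hy0 : y ≠ 0 := norm_pos_iff.1 (zero_lt_one.trans hy)
    rw [← hSS' y hy0 v, iterCovDeriv, covDeriv, covDeriv]
    have e : (fun z => iterCovDeriv (coneMetric (1 / √2)) T' j z (Fin.tail v)) =ᶠ[𝓝 y]
        fun z => S z (Fin.tail v) := by
      filter_upwards [(isOpen_lt continuous_const continuous_norm).mem_nhds hy] with z hz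
      exact hTS z hz _
    rw [e.fderiv_eq]
    congr 1
    exact Finset.sum_congr rfl fun i _ => hTS y hy _

end ConeTensor

/-! ### The metric is asymptotically conical -/

lemma quarterRoot_chart_sq {c : ℝ} (hc : 0 ≤ c) {y : E3} (hy : y ≠ 0) :
    quarterRoot c (‖y‖ ^ 2 / 4) ^ 2 = ‖y‖ ^ 2 / 4 * √(1 + 16 * c * ‖y‖⁻¹ ^ 4) := by
  have hn : 0 < ‖y‖ := norm_pos_iff.2 hy
  refine quarterRoot_sq_eq (chart_pos hc hy) (by positivity) ?_
  rw [mul_pow, Real.sq_sqrt (by positivity)]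
  field_simp
  ring

theorem exists_coneTensor_sub {c : ℝ} (hc : 0 ≤ c) : ∃ T, ConeTensor 2 (-2) T ∧
    ∀ y : E3, 1 < ‖y‖ → ∀ w : Fin 2 → E3,
      pullbackMetric (coneChart c) (baseMetric c) y (w 0) (w 1) -
        coneMetric (1 / √2) y (w 0) (w 1) = T y w := by
  let A : ℝ → ℝ := fun s => √(1 + 16 * c * s ^ 4)
  have hpos : ∀ s : ℝ, 0 < 1 + 16 * c * s ^ 4 := fun s => by positivity
  have hA0 : ∀ s, 0 < A s := fun s => Real.sqrt_pos.2 (hpos s)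
  have hA : ContDiff ℝ ∞ A := ContDiff.sqrt (by fun_prop) fun s => (hpos s).ne'
  -- With $A^2-1=16cs^4$, these quotients times $s^4$ are $\frac{A-1}2$ and
  -- $(\frac1A-1)-\frac{A-1}2$, the coefficients of the Euclidean and radial parts of the
  -- difference. This form displays the factor $s^4$.
  have hF : ContDiff ℝ ∞ fun s => 8 * c / (A s + 1) :=
    contDiff_const.div (hA.add contDiff_const) fun s => by have := hA0 s; positivity
  have hG : ContDiff ℝ ∞ fun s => -(16 * c) / (A s * (A s + 1)) - 8 * c / (A s + 1) :=
    (contDiff_const.div (hA.mul (hA.add contDiff_const))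
      fun s => by have := hA0 s; positivity).sub hF
  have h4 := ConeSymbol.invNorm_pow 4
  -- The calculus gives order $-4$; only the weaker order $-2$ is kept.
  have s1 : ConeSymbol (-2) fun y => 8 * c / (A ‖y‖⁻¹ + 1) * ‖y‖⁻¹ ^ 4 :=
    ((ConeSymbol.comp hF).mul h4).mono (by norm_num)
  have s2 : ∀ a b : Fin 3, ConeSymbol (-2) fun y =>
      (-(16 * c) / (A ‖y‖⁻¹ * (A ‖y‖⁻¹ + 1)) - 8 * c / (A ‖y‖⁻¹ + 1)) * ‖y‖⁻¹ ^ 4 *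
        (y a * y b * ‖y‖⁻¹ ^ 2) := fun a b =>
    (((ConeSymbol.comp hG).mul h4).mul (((ConeSymbol.coord a).mul (ConeSymbol.coord b)).mul
      (ConeSymbol.invNorm_pow 2))).mono (by norm_num)
  refine ⟨_, (ConeTensor.sum Finset.univ fun a : Fin 3 => ConeTensor.monomial s1 ![a, a]).add
    (ConeTensor.sum Finset.univ fun a : Fin 3 => ConeTensor.sum Finset.univ fun b : Fin 3 =>
      ConeTensor.monomial (s2 a b) ![a, b]), fun y hy w => ?_⟩
  have hn : 0 < ‖y‖ := zero_lt_one.trans hy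
  have hy0 : y ≠ 0 := norm_pos_iff.1 hn
  have hAp := hA0 ‖y‖⁻¹
  have hA2 : A ‖y‖⁻¹ ^ 2 = 1 + 16 * c * ‖y‖⁻¹ ^ 4 := Real.sq_sqrt (hpos _).le
  have hq : quarterRoot c (‖y‖ ^ 2 / 4) ^ 2 = ‖y‖ ^ 2 / 4 * A ‖y‖⁻¹ := quarterRoot_chart_sq hc hy0
  rw [pullbackMetric_coneChart hc hy0, coneMetric_apply, hq]
  generalize A ‖y‖⁻¹ = B at *
  have e1 : 8 * c / (B + 1) * ‖y‖⁻¹ ^ 4 = (B - 1) / 2 := by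
    field_simp at hA2 ⊢
    linear_combination -hA2
  have e2 : (-(16 * c) / (B * (B + 1)) - 8 * c / (B + 1)) * ‖y‖⁻¹ ^ 4 =
      (B⁻¹ - 1) - (B - 1) / 2 := by
    field_simp at hA2 ⊢
    linear_combination (2 + B) * hA2
  simp only [e1, e2, Fin.prod_univ_two, Matrix.cons_val_zero, Matrix.cons_val_one]
  have e3 : ∑ a, (B - 1) / 2 * (w 0 a * w 1 a) = (B - 1) / 2 * inner ℝ (w 0) (w 1) := by
    rw [inner_eq_sum, Fin.sum_univ_three]; ring
  have e4 : ∑ a, ∑ b, ((B⁻¹ - 1) - (B - 1) / 2) * (y a * y b * ‖y‖⁻¹ ^ 2) * (w 0 a * w 1 b) =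
      ((B⁻¹ - 1) - (B - 1) / 2) * ‖y‖⁻¹ ^ 2 * (inner ℝ y (w 0) * inner ℝ y (w 1)) := by
    simp only [inner_eq_sum, Fin.sum_univ_three]; ring
  rw [e3, e4]
  field_simp
  ring

theorem isAsymptoticallyConical_baseMetric {c : ℝ} (hc : 0 < c) :
    IsAsymptoticallyConical (baseMetric c) (singularCircle c) (1 / √2) (-2) := by
  obtain ⟨K, hK, hS, hΨ⟩ := exists_isDiffeoOn_coneChart hc.le
  obtain ⟨T, hT, h⟩ := exists_coneTensor_sub hc.le
  refine ⟨1, one_pos, K, hK, hS, coneChart c, hΨ, fun j => ?_⟩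
  obtain ⟨S, hS, hj⟩ := hT.exists_iterCovDeriv h j
  obtain ⟨C, hC⟩ := hS.exists_bound
  refine ⟨C, 1, le_rfl, fun y hy v => ?_⟩
  have e : ‖y‖ ^ (-2 - (j : ℝ)) = ‖y‖ ^ (-2 - (j : ℤ)) := by
    rw [← Real.rpow_intCast]; push_cast; rfl
  rw [hj y hy v, e]
  exact hC y hy.le v

/-! ### Assembly of the statement -/

theorem proposition4p11 (c : ℝ) (hc : 0 ≤ c) :
    -- the bolts form a smooth 2-sphere bundle `B` over the complement of `S¹_c`, orientable
    -- over each of two open sets that cover it; there are no bolts over `S¹_c`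
    (∃ F, IsBoltTrivialization c {x | x 0 ≠ 0 ∨ radialV x < 2 * c ^ (1 / 4 : ℝ)} F) ∧
    (∃ F, IsBoltTrivialization c {x | x 0 ≠ 0 ∨ 2 * c ^ (1 / 4 : ℝ) < radialV x} F) ∧
    (∀ x ∈ singularCircle c, bolt c x = ∅) ∧
    (c = 0 → singularCircle c = {0}) ∧
    -- the pushforward metric
    ∃ k : E3 → E3 →L[ℝ] E3 →L[ℝ] ℝ,
      IsRiemannianMetricOn k (singularCircle c)ᶜ ∧ IsPushforwardMetric c k ∧
      -- the pushforward form: harmonic, of norm the bolt size, and `S¹`-invariant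
      (∀ W F, IsBoltTrivialization c W F →
        IsHarmonicOn k (pushforwardForm c F) W ∧
        (∀ x ∈ W, ∀ m ∈ bolt c x,
          formNorm k (pushforwardForm c F) x = 4 * Real.pi * boltSize c m ∧
          boltArea c F x = 4 * Real.pi * boltSize c m) ∧
        ((∀ ψ, MapsTo (rotBase ψ) W W) → ∀ ψ, ∀ x ∈ W, ∀ w,
          pushforwardForm c F (rotBase ψ x) (rotBase ψ w) = pushforwardForm c F x w)) ∧
      -- away from `S¹_c` it is non-zero and determined up to the sign given by the orientation
      (∀ x, x ∉ singularCircle c → ∃ l : E3 →L[ℝ] ℝ, l ≠ 0 ∧ pushforwardValues c x = {l, -l}) ∧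
      -- it extends continuously by zero to `S¹_c`
      (∀ x₀ ∈ singularCircle c, ∀ ε > 0, ∃ δ > 0, ∀ x, dist x x₀ < δ →
        ∀ l ∈ pushforwardValues c x, ‖l‖ < ε) ∧
      -- `k₀` is a Riemannian cone, and `k_c` is asymptotic to it with rate `-2`
      (c = 0 → ∃ Ψ : E3 → E3, IsDiffeoOn Ψ {0}ᶜ {0}ᶜ ∧ ∀ y ∈ ({0}ᶜ : Set E3), ∀ v w,
        pullbackMetric Ψ k y v w = coneMetric (1 / Real.sqrt 2) y v w) ∧
      (0 < c → IsAsymptoticallyConical k (singularCircle c) (1 / Real.sqrt 2) (-2)) := by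
  obtain ⟨t₁, C₁, ht₁, hC₁, h₁⟩ := exists_solution_innerRegion hc
  obtain ⟨t₂, C₂, ht₂, hC₂, h₂⟩ := exists_solution_outerRegion hc
  refine ⟨⟨_, isBoltTrivialization_boltOf hc (isOpen_innerRegion hc) ht₁ hC₁ h₁⟩,
    ⟨_, isBoltTrivialization_boltOf hc (isOpen_outerRegion hc) ht₂ hC₂ fun x hx => (h₂ x hx).1⟩,
    fun x hx => bolt_eq_empty hc hx, ?_, baseMetric c, isRiemannianMetricOn_baseMetric hc,
    isPushforwardMetric_baseMetric hc, fun W F hF => ?_,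
    fun x hx => exists_pushforwardValues_eq hc hx,
    fun x₀ hx₀ ε hε => pushforwardValues_tendsto_zero hc hx₀ hε, ?_,
    fun h => isAsymptoticallyConical_baseMetric h⟩
  · rintro rfl
    exact singularCircle_zero
  · obtain ⟨t, C, hN⟩ := hF.exists_isNormalForm
    refine ⟨hN.isHarmonicOn hc, fun x hx m hm => ?_,
      fun hrot ψ x hx w => hN.pushforwardForm_rotBase hc hrot ψ hx w⟩
    have hs := hN.sol x hx
    rw [boltSize_eq hc hs hm]
    exact ⟨hs.formNorm_eq hc (baseMetric_eq hc hs) (hN.pushforwardForm_eq hx), hN.boltArea_eq hx⟩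
  · rintro rfl
    exact exists_isometry_cone
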